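/- Let $q$ be a complex number with $0<|q|<1$, and for $k=0,1,2,\dots$ write $$(u)_k=\prod_{j=0}^{k-1}(1-uq^j),\qquad (u_1,\dots,u_m)_k=(u_1)_k\cdots(u_m)_k .$$ Let $r\ge 1$ and $N\ge 0$ be integers, and let $a,b,c,d,e,f,g,x_1,\dots,x_r$ be complex numbers with $$a^3q^{3-r+N}=bcdefg ,$$ such that no denominator in the formula below vanishes (that is, $a\neq 0$ (hence $b,\dots,g\ne0$), $x_i\ne 0$, the $x_i$ are distinct, $ax_ix_j\neq 1$ for all $i,j$ (including $i=j$), $eq^{1-r-N}/b\ne 1$, and all shifted factorials in denominators are nonzero). Then $$ \begin{aligned} &\sum_{k_1,\dots,k_r=0}^N\ \prod_{1\le i<j\le r} \frac{(x_iq^{k_i}-x_jq^{k_j})(1-ax_ix_jq^{k_i+k_j})}{(x_i-x_j)(1-ax_ix_j)} \prod_{i=1}^r\frac{1-ax_i^2q^{2k_i}}{1-ax_i^2}\,q^{k_i}\\ &\qquad\times\prod_{i=1}^r\frac{(ax_i^2,bx_i,cx_i,dx_i,ex_i,fx_i,gx_i,q^{-N})_{k_i}} {(q,ax_iq/b,ax_iq/c,ax_iq/d,ax_iq/e,ax_iq/f,ax_iq/g,ax_i^2q^{1+N})_{k_i}}\\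 &=q^{\binom r3}\left(\frac{q^{N+1}}{b}\right)^{\binom r2}\frac{1}{\big((b/e)_{N+r-1}\big)^r} \prod_{1\le i<j\le r}\frac{1}{(x_i-x_j)(1-ax_ix_j)}\\ &\qquad\times\prod_{i=1}^{r}\frac{(ex_i)^N\,(ax_i^2q)_N\,(bx_i)_{N+r-1}\,(q^{2-r}ax_i/b)_{r-1}} {(q^{N+r+1-i},aq^{2-r}/be,aq^{2-r}/bc,aq^{2-r}/bd,aq^{2-r}/bf,aq^{2-r}/bg)_{i-1}}\\ &\qquad\times\prod_{i=1}^r\frac{(q^{2-i}a/ce,q^{2-i}a/de,q^{2-i}a/ef,q^{2-i}a/eg)_{N+i-1}} {(ax_iq/c,ax_iq/d,ax_iq/e,ax_iq/f,ax_iq/g)_N}\\ &\qquad\times\sum_{k_1,\dots,k_r=0}^{N+r-1}\ \prod_{1\le i<j\le r} (q^{k_i}-q^{k_j})(1-eq^{1-r-N+k_i+k_j}/b)\\ &\qquad\quad\times\prod_{i=1}^r \frac{(1-eq^{1-r-N+2k_i}/b)\,(eq^{1-r-N}/b,ex_i,eq^{-N}/ax_i,q^{1-r-N})_{k_i}} {(1-eq^{1-r-N}/b)\,(q,q^{2-r-N}/bx_i,ax_iq^{2-r}/b,eq/b)_{k_i}}\\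 &\qquad\quad\times\prod_{i=1}^r\frac{(aq^{2-r}/bc,aq^{2-r}/bd,aq^{2-r}/bf,aq^{2-r}/bg)_{k_i}} {(ceq^{-N}/a,deq^{-N}/a,efq^{-N}/a,egq^{-N}/a)_{k_i}}\,q^{k_i}. \end{aligned} $$ -/

import Mathlib

/-- The `q`-shifted factorial `(a; q)_k = (1 - a) (1 - a q) ⋯ (1 - a q ^ (k - 1))`, for a
nonnegative integer `k`. -/
def qShifted {K : Type*} [CommRing K] (q a : K) (k : ℕ) : K :=
  ∏ j ∈ Finset.range k, (1 - a * q ^ j)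

/-- The condensed notation `(a₁, …, a_m; q)_k = (a₁; q)_k ⋯ (a_m; q)_k`. -/
def qShiftedProd {K : Type*} [CommRing K] (q : K) (l : List K) (k : ℕ) : K :=
  (l.map fun a => qShifted q a k).prod

/-- The index set `{0, …, M}^r` of a multiple sum over `k₁, …, k_r`. -/
def cube (r M : ℕ) : Finset (Fin r → ℕ) :=
  Fintype.piFinset fun _ => Finset.range (M + 1)

/-! ### Elementary rules for q-shifted factorials. -/

section QShifted

variable {K : Type*} [CommRing K]

/-! Put r = n + 1. With ζ = 1/y + a y one has (y_i - y_j)(1 - a y_i y_j) = y_i y_j (ζ_j - ζ_i), so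
the product over i < j in the summand is, up to powers of the y_i, a Vandermonde determinant in the
ζ_i. Up to a constant, this is also the determinant of the values at ζ_i of the polynomials P_s =
∏_{u<s} (X - p'_u) ∏_{t<n-s} (X - p_t), 0 ≤ s ≤ n (`det_eval_mixedProduct`). Choose p_t = b q^t +
a/(b q^t) and p'_u = e q^u + a/(e q^u). Then y (ζ - p_t) = (1 - b q^t y)(1 - a y/(b q^t)), so
multiplication by P_s merely moves the parameters b, e of a very-well-poised term to b q^(n-s), e
q^s (`left_row`). By multilinearity the left multiple sum is a determinant of single terminating
₁₀φ₉ series.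

Each entry is transformed by a twofold iterate of Bailey's transformation
(`bailey_transformation_iterated`). Bailey's transformation itself comes from interchanging the sums
in a double series, with Jackson's sum (`jackson_sum`) used once to create the inner sum and once to
evaluate the other one. The new series has base μ q^(2s), where μ = e q^(-N-n)/b, and `right_row`
recognises it as an entry of the determinant that belongs to the right multiple sum, with p_t now
built on q^(-N-n) and p'_u on μ. The factor in between splits into a row part and a column part
(`entry_factor`). Hence the two determinants are proportional (`multiple_transformation`), and
`scalar_identity` evaluates the constant.

This argument divides by quantities that the theorem allows to vanish. It is therefore carried out
for parameters such that no relevant monomial in them is a power of q. In general the parameters are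
multiplied by powers of t that respect the balancing condition: all but countably many t are
generic, both sides are continuous at t = 1, and the identity passes to the limit. -/

@[simp] theorem qShifted_zero (q a : K) : qShifted q a 0 = 1 := by simp [qShifted]

theorem qShifted_succ (q a : K) (k : ℕ) :
    qShifted q a (k + 1) = qShifted q a k * (1 - a * q ^ k) := by
  simp [qShifted, Finset.prod_range_succ]

theorem qShifted_add (q a : K) (m n : ℕ) :
    qShifted q a (m + n) = qShifted q a m * qShifted q (a * q ^ m) n := by
  simp [qShifted, Finset.prod_range_add, pow_add, mul_assoc]

theorem qShifted_succ' (q a : K) (k : ℕ) :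
    qShifted q a (k + 1) = (1 - a) * qShifted q (a * q) k := by
  rw [add_comm, qShifted_add]
  simp [qShifted_succ]

/-- Both sides are `(a; q)_{m + n}`. -/
theorem qShifted_mul_swap (q a : K) (m n : ℕ) :
    qShifted q a m * qShifted q (a * q ^ m) n = qShifted q a n * qShifted q (a * q ^ n) m := by
  rw [← qShifted_add, ← qShifted_add, add_comm]

end QShifted

/-- `u` is not an integral power of `q`. -/
def QGeneric {K : Type*} [Field K] (q u : K) : Prop :=
  ∀ m : ℤ, u * q ^ m ≠ 1

/-- The `k`-th term of the very-well-poised series with base `A` and parameters `l`. -/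
def vwpTerm {K : Type*} [Field K] (q A : K) (l : List K) (k : ℕ) : K :=
  (1 - A * q ^ (2 * k)) / (1 - A) * (qShifted q A k / qShifted q q k) *
    (l.map fun u => qShifted q u k / qShifted q (A * q / u) k).prod * q ^ k

/-! ### Parameters that avoid the powers of q. -/

section Generic

variable {K : Type*} [Field K] {q u v : K}

/-- Genericity is stable under multiplication by powers of q and under inversion, so one hypothesis
on a monomial covers every factorial built from it. The separate `v` lets the target keep whatever
form it has in the goal. -/
theorem QGeneric.mul_zpow (hq : q ≠ 0) (h : QGeneric q u) (n : ℤ) (hv : v = u * q ^ n) :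
    QGeneric q v := by
  intro m
  rw [hv, mul_assoc, ← zpow_add₀ hq]
  exact h _

theorem QGeneric.inv (h : QGeneric q u) : QGeneric q u⁻¹ := by
  intro m hm
  refine h (-m) ?_
  rw [zpow_neg]
  have := congrArg (·⁻¹) hm
  simpa [mul_inv, mul_comm] using this

theorem QGeneric.inv_mul_zpow (hq : q ≠ 0) (h : QGeneric q u) (n : ℤ) (hv : v = u⁻¹ * q ^ n) :
    QGeneric q v := h.inv.mul_zpow hq n hv

theorem QGeneric.one_sub_ne_zero (h : QGeneric q u) : 1 - u ≠ 0 := by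
  have := h 0
  simp only [zpow_zero, mul_one] at this
  exact sub_ne_zero.2 this.symm

theorem QGeneric.one_sub_mul_ne_zero (h : QGeneric q u) (m : ℤ) : 1 - u * q ^ m ≠ 0 :=
  sub_ne_zero.2 (h m).symm

theorem QGeneric.one_sub_mul_pow_ne_zero (h : QGeneric q u) (m : ℕ) : 1 - u * q ^ m ≠ 0 := by
  exact_mod_cast h.one_sub_mul_ne_zero m

theorem QGeneric.qShifted_ne_zero (h : QGeneric q u) (k : ℕ) : qShifted q u k ≠ 0 :=
  Finset.prod_ne_zero_iff.2 fun j _ => h.one_sub_mul_pow_ne_zero j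

theorem QGeneric.qShifted_self_ne_zero (h : ∀ n : ℕ, q ^ (n + 1) ≠ 1) (k : ℕ) :
    qShifted q q k ≠ 0 :=
  Finset.prod_ne_zero_iff.2 fun j _ => sub_ne_zero.2 (by rw [← pow_succ']; exact (h j).symm)

end Generic

/-! ### Rational identities behind Jackson's sum. -/

section Jackson

variable {K : Type*} [Field K]

theorem qShifted_inv_pow_eq_zero {q : K} (hq : q ≠ 0) {n k : ℕ} (h : n < k) :
    qShifted q (q ^ n)⁻¹ k = 0 :=
  Finset.prod_eq_zero (Finset.mem_range.2 h) (by simp [hq])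

/-- The partial-fraction identity behind the induction step in Jackson's summation. -/
theorem jackson_addition_formula {w β γ δ L : K} (hw : w ≠ 0) (hL : L ≠ 0) :
    (1 - w * L ^ 2) * ((1 - β * γ / w) * (1 - β * δ / w) * (1 - γ * δ / w)) -
      (1 - β * L) * (1 - γ * L) * (1 - δ * L) * (1 - β * γ * δ / (w ^ 2 * L)) =
    -(w * L ^ 2) * (1 - β * γ * δ * L / w) * (1 - β / (w * L)) * (1 - γ / (w * L)) *
      (1 - δ / (w * L)) := by
  field_simp
  ring

/-- Once the addition formula has absorbed the separate dependence on β, γ, δ, only their product p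
survives. This is the rational identity that is left, with x = q^m and Q = q^n. -/
theorem jackson_step_core {w p q x Q : K} (hw : w ≠ 0) (hp : p ≠ 0)
    (hq : q ≠ 0) (hx : x ≠ 0) (hQ : Q ≠ 0) :
    (1 - w * q * x ^ 2) * (1 - w ^ 2 * Q / p) * (1 - 1 / (q * Q)) * q * (1 - w / p) =
      -(w ^ 3 / p ^ 2) * ((1 - p / (w ^ 2 * x)) *
        ((1 - q * x) * (1 - p * x / (w * Q)) * (1 - w * q * Q * x)) +
        (1 - w * x) * (1 - w ^ 2 * Q / p * q * x) * (1 - x / Q) * q *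
          ((w * (q * x) ^ 2) * (1 - p * (q * x) / w) * (p / (w * q * x) ^ 3))) := by
  field_simp
  ring

/-- Bookkeeping of denominators: `E` and `Ex` stand for the factors of w/β, w/γ, w/δ with exponents
0 and m + 1, and `D` for the product in the addition formula. Treating them as atoms keeps the
clearing of fractions small; the shapes N = κ D and A = v D - t Ex make `D` cancel. -/
theorem jackson_step_aux {n1 E r1 r2 r3 N p y Ex z D u v A κ t : K} (hE : E ≠ 0) (hEx : Ex ≠ 0)
    (hD : D ≠ 0) (hp : p ≠ 0) (hr1 : r1 ≠ 0) (hr2 : r2 ≠ 0) (hr3 : r3 ≠ 0)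
    (hN : N = κ * D) (hA : A = v * D - t * Ex) (hy : y = v * u)
    (core : n1 * p = κ * (z * (r1 * r2 * r3) + u * t)) :
    n1 / (r1 * E * r2 * r3) - N / (E * p) * (y / (r1 * Ex * r2 * r3)) =
      N / (E * p) * z / D - N / (E * p) * (u * A / (r1 * Ex * r2 * r3)) / D := by
  subst hN hA hy
  field_simp
  linear_combination Ex * core

/-- The telescoping relation of `jackson_sum` between m and m + 1, divided by the common factor, for
x = q^m and Q = q^n. `X` and `R` are what the term of base A and the core of the term of base w,
both at m + 1, become after this division. -/
theorem jackson_step {w β γ δ q x Q D : K} (hw : w ≠ 0) (hβ : β ≠ 0) (hγ : γ ≠ 0) (hδ : δ ≠ 0)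
    (hq : q ≠ 0) (hx : x ≠ 0) (hQ : Q ≠ 0) (h1 : 1 - q * x ≠ 0)
    (hD : D = (1 - β * γ / w) * (1 - β * δ / w) * (1 - γ * δ / w)) (hD0 : D ≠ 0)
    (hβ1 : 1 - w / β ≠ 0) (hγ1 : 1 - w / γ ≠ 0) (hδ1 : 1 - w / δ ≠ 0)
    (hβx : 1 - w * q / β * x ≠ 0) (hγx : 1 - w * q / γ * x ≠ 0) (hδx : 1 - w * q / δ * x ≠ 0)
    (h2 : 1 - w / (β * γ * δ) ≠ 0)
    (h3 : 1 - β * γ * δ / (w * Q) * x ≠ 0) (h4 : 1 - w * q * Q * x ≠ 0) {c R X : K}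
    (hc : c = (1 - w / (β * γ)) * (1 - w / (β * δ)) * (1 - w / (γ * δ)) /
      ((1 - w / β) * (1 - w / γ) * (1 - w / δ) * (1 - w / (β * γ * δ))))
    (hX : X = (1 - w * q * x ^ 2) * (1 - w ^ 2 * Q / (β * γ * δ)) * (1 - (q * Q)⁻¹) * q /
      ((1 - q * x) * ((1 - w / β) * (1 - w / γ) * (1 - w / δ)) *
        (1 - β * γ * δ / (w * Q) * x) * (1 - w * q * Q * x)))
    (hR : R = (1 - w * x) * (1 - w ^ 2 * Q / (β * γ * δ) * q * x) * (1 - Q⁻¹ * x) * q /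
      ((1 - q * x) * ((1 - w * q / β * x) * (1 - w * q / γ * x) * (1 - w * q / δ * x)) *
        (1 - β * γ * δ / (w * Q) * x) * (1 - w * q * Q * x))) :
    X - c * ((1 - w * q ^ 2 * x ^ 2) * R) =
      c * (1 - β * γ * δ / (w ^ 2 * x)) / D -
      c * (R * ((1 - β * (q * x)) * (1 - γ * (q * x)) * (1 - δ * (q * x)) *
        (1 - β * γ * δ / (w ^ 2 * (q * x))))) / D := by
  rw [hX, hR, hc, ← mul_div_assoc (1 - w * q ^ 2 * x ^ 2),
    div_mul_eq_mul_div
      ((1 - w * x) * (1 - w ^ 2 * Q / (β * γ * δ) * q * x) * (1 - Q⁻¹ * x) * q)]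
  have key := jackson_addition_formula (β := β) (γ := γ) (δ := δ) hw (mul_ne_zero hq hx)
  rw [← hD] at key
  have e : ∀ z : K, z ≠ 0 → (1 - z / (w * (q * x))) = -(z / (w * q * x)) * (1 - w * q * x / z) := by
    intro z hz; field_simp; ring
  have e' : ∀ z : K, w * q * x / z = w * q / z * x := fun z => by ring
  simp only [e'] at e
  refine jackson_step_aux (κ := -(w ^ 3 / (β * γ * δ) ^ 2)) (v := 1 - w * (q * x) ^ 2)
    (t := (w * (q * x) ^ 2) * (1 - β * γ * δ * (q * x) / w) * (β * γ * δ / (w * q * x) ^ 3))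
    (mul_ne_zero (mul_ne_zero hβ1 hγ1) hδ1) (mul_ne_zero (mul_ne_zero hβx hγx) hδx) hD0 h2 h1 h3 h4 ?_ ?_ ?_ ?_
  · rw [hD]; field_simp; ring
  · rw [e β hβ, e γ hγ, e δ hδ] at key
    field_simp at key ⊢
    linear_combination -key
  · ring
  · rw [show β * γ * δ / (w * Q) * x = β * γ * δ * x / (w * Q) by ring,
      show Q⁻¹ * x = x / Q by ring, ← one_div]
    exact jackson_step_core hw (by simp [*]) hq hx hQ

end Jackson

/-! ### Jackson's terminating ₈φ₇ sum. -/

section Jackson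

variable {K : Type*} [Field K]

theorem vwpTerm_zero {q A : K} (hA : 1 - A ≠ 0) (l : List K) : vwpTerm q A l 0 = 1 := by
  have : (l.map fun _ => (1 : K)).prod = 1 := by simp
  simp [vwpTerm, hA]

/-- The value of Jackson's terminating `₈φ₇` sum. -/
def jacksonValue (q A β γ δ : K) (n : ℕ) : K :=
  qShifted q (A * q) n * qShifted q (A * q / (β * γ)) n * qShifted q (A * q / (β * δ)) n *
      qShifted q (A * q / (γ * δ)) n /
    (qShifted q (A * q / β) n * qShifted q (A * q / γ) n * qShifted q (A * q / δ) n *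
      qShifted q (A * q / (β * γ * δ)) n)

theorem jacksonValue_succ (q A β γ δ : K) (n : ℕ) :
    jacksonValue q A β γ δ (n + 1) =
      (1 - A * q) * ((1 - A * q / (β * γ)) * (1 - A * q / (β * δ)) * (1 - A * q / (γ * δ)) /
        ((1 - A * q / β) * (1 - A * q / γ) * (1 - A * q / δ) * (1 - A * q / (β * γ * δ)))) *
      jacksonValue q (A * q) β γ δ n := by
  simp only [jacksonValue, qShifted_succ', div_mul_eq_mul_div]
  simp only [div_eq_mul_inv, mul_inv]
  ring

set_option maxHeartbeats 1000000 in
-- Induction on n with A left free: the term for (A, n + 1) minus a constant times the term for (A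
-- q, n) telescopes, and the constant is the one in `jacksonValue_succ`. The genericity hypotheses
-- pass from A to A q and keep all denominators nonzero.
theorem jackson_sum {q : K} (hq0 : q ≠ 0) (hq : ∀ n : ℕ, q ^ (n + 1) ≠ 1) {β γ δ : K}
    (hβ : β ≠ 0) (hγ : γ ≠ 0) (hδ : δ ≠ 0) (n : ℕ) :
    ∀ {A : K}, A ≠ 0 → QGeneric q A → QGeneric q (A / β) → QGeneric q (A / γ) →
      QGeneric q (A / δ) → QGeneric q (A / (β * γ)) → QGeneric q (A / (β * δ)) →
      QGeneric q (A / (γ * δ)) → QGeneric q (A / (β * γ * δ)) →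
      ∑ k ∈ Finset.range (n + 1),
        vwpTerm q A [β, γ, δ, A ^ 2 * q ^ (n + 1) / (β * γ * δ), (q ^ n)⁻¹] k =
      jacksonValue q A β γ δ n := by
  induction n with
  | zero =>
    intro A _ hA _ _ _ _ _ _ _
    simp [vwpTerm_zero hA.one_sub_ne_zero, jacksonValue]
  | succ n ih =>
    intro A hA0 hA hAβ hAγ hAδ hβγ hβδ hγδ hβγδ
    have sh : ∀ {u v : K}, v = u * q → QGeneric q u → QGeneric q v := fun h hu =>
      hu.mul_zpow hq0 1 (by simpa using h)
    have ih' := ih (A := A * q) (mul_ne_zero hA0 hq0) (sh rfl hA) (sh (by ring) hAβ)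
      (sh (by ring) hAγ) (sh (by ring) hAδ) (sh (by ring) hβγ) (sh (by ring) hβδ)
      (sh (by ring) hγδ) (sh (by ring) hβγδ)
    rw [jacksonValue_succ, ← ih', Finset.sum_range_succ _ (n + 1)]
    obtain ⟨w, hw⟩ : ∃ w, w = A * q := ⟨_, rfl⟩
    have hw0 : w ≠ 0 := hw ▸ mul_ne_zero hA0 hq0
    -- The fourth parameters of the two series differ only by a factor q: w² q^n / (βγδ) for base A,
    -- and q times this for base w.
    have hεA : A ^ 2 * q ^ (n + 1 + 1) / (β * γ * δ) = w ^ 2 * q ^ n / (β * γ * δ) := by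
      rw [hw]; ring
    have hεw : w ^ 2 * q ^ (n + 1) / (β * γ * δ) = w ^ 2 * q ^ n / (β * γ * δ) * q := by ring
    rw [← hw, hεA, hεw]
    have gw : QGeneric q w := sh hw hA
    have gβ : QGeneric q (w / β) := sh (by rw [hw]; ring) hAβ
    have gγ : QGeneric q (w / γ) := sh (by rw [hw]; ring) hAγ
    have gδ : QGeneric q (w / δ) := sh (by rw [hw]; ring) hAδ
    have gβγ : QGeneric q (w / (β * γ)) := sh (by rw [hw]; ring) hβγ
    have gβδ : QGeneric q (w / (β * δ)) := sh (by rw [hw]; ring) hβδ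
    have gγδ : QGeneric q (w / (γ * δ)) := sh (by rw [hw]; ring) hγδ
    have gp : QGeneric q (w / (β * γ * δ)) := sh (by rw [hw]; ring) hβγδ
    have inv1 : ∀ {u v : K}, u = v⁻¹ → QGeneric q v → 1 - u ≠ 0 := fun h hv =>
      h ▸ hv.inv.one_sub_ne_zero
    obtain ⟨c, hc⟩ : ∃ c, c = (1 - w / (β * γ)) * (1 - w / (β * δ)) * (1 - w / (γ * δ)) /
        ((1 - w / β) * (1 - w / γ) * (1 - w / δ) * (1 - w / (β * γ * δ))) := ⟨_, rfl⟩
    obtain ⟨D, hD⟩ : ∃ D, D = (1 - β * γ / w) * (1 - β * δ / w) * (1 - γ * δ / w) := ⟨_, rfl⟩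
    have hD0 : D ≠ 0 := by
      rw [hD]
      exact mul_ne_zero (mul_ne_zero (inv1 (by simp) gβγ) (inv1 (by simp) gβδ))
        (inv1 (by simp) gγδ)
    obtain ⟨core, hcore⟩ : ∃ core : ℕ → K, ∀ m, core m =
        qShifted q w m / qShifted q q m *
        ([β, γ, δ, w ^ 2 * q ^ n / (β * γ * δ) * q, (q ^ n)⁻¹].map
          fun u => qShifted q u m / qShifted q (w * q / u) m).prod * q ^ m := ⟨_, fun _ => rfl⟩
    have hT : ∀ m, vwpTerm q w [β, γ, δ, w ^ 2 * q ^ n / (β * γ * δ) * q, (q ^ n)⁻¹] m =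
        (1 - w * q ^ (2 * m)) / (1 - w) * core m := by
      intro m; rw [hcore, vwpTerm]; ring
    have e1 : ∀ z : K, w * q / z = w / z * q := fun z => by ring
    have e2 : w * q / (w ^ 2 * q ^ n / (β * γ * δ) * q) = β * γ * δ / (w * q ^ n) := by
      field_simp
    have e3 : w * q / (q ^ n)⁻¹ = w * q * q ^ n := by field_simp
    have e4 : w / (w ^ 2 * q ^ n / (β * γ * δ)) = β * γ * δ / (w * q ^ n) := by field_simp
    have e5 : w / (q ^ (n + 1))⁻¹ = w * q * q ^ n := by field_simp; ring
    have e6 : (q ^ (n + 1))⁻¹ * q = (q ^ n)⁻¹ := by field_simp; ring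
    obtain ⟨X, hX⟩ : ∃ X : ℕ → K, ∀ m, X m =
        (1 - w * q * (q ^ m) ^ 2) * (1 - w ^ 2 * q ^ n / (β * γ * δ)) * (1 - (q * q ^ n)⁻¹) * q /
        ((1 - q * q ^ m) * ((1 - w / β) * (1 - w / γ) * (1 - w / δ)) *
          (1 - β * γ * δ / (w * q ^ n) * q ^ m) * (1 - w * q * q ^ n * q ^ m)) := ⟨_, fun _ => rfl⟩
    obtain ⟨R, hR⟩ : ∃ R : ℕ → K, ∀ m, R m =
        (1 - w * q ^ m) * (1 - w ^ 2 * q ^ n / (β * γ * δ) * q * q ^ m) *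
          (1 - (q ^ n)⁻¹ * q ^ m) * q /
        ((1 - q * q ^ m) * ((1 - w * q / β * q ^ m) * (1 - w * q / γ * q ^ m) *
          (1 - w * q / δ * q ^ m)) *
          (1 - β * γ * δ / (w * q ^ n) * q ^ m) * (1 - w * q * q ^ n * q ^ m)) := ⟨_, fun _ => rfl⟩
    have hcs : ∀ m, core (m + 1) = core m * ((1 - β * q ^ m) * (1 - γ * q ^ m) * (1 - δ * q ^ m)) *
        R m := by
      intro m
      rw [hcore, hcore, hR]
      simp only [List.map_cons, List.map_nil, List.prod_cons, List.prod_nil, e2, e3,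
        qShifted_succ, mul_one]
      rw [pow_succ q m]
      generalize (1 - w * q ^ m) = x1
      generalize (1 - w ^ 2 * q ^ n / (β * γ * δ) * q * q ^ m) = x2
      generalize (1 - (q ^ n)⁻¹ * q ^ m) = x3
      generalize (1 - q * q ^ m) = x4
      generalize (1 - w * q / β * q ^ m) = x5
      generalize (1 - w * q / γ * q ^ m) = x6
      generalize (1 - w * q / δ * q ^ m) = x7
      generalize (1 - β * γ * δ / (w * q ^ n) * q ^ m) = x8
      generalize (1 - w * q * q ^ n * q ^ m) = x9
      generalize (1 - β * q ^ m) = x10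
      generalize (1 - γ * q ^ m) = x11
      generalize (1 - δ * q ^ m) = x12
      generalize qShifted q (w ^ 2 * q ^ n / (β * γ * δ) * q) m = x13
      generalize qShifted q (β * γ * δ / (w * q ^ n)) m = x14
      generalize qShifted q (w * q / β) m = y1
      generalize qShifted q (w * q / γ) m = y2
      generalize qShifted q (w * q / δ) m = y3
      generalize qShifted q (w * q * q ^ n) m = y4
      generalize qShifted q (q ^ n)⁻¹ m = y5
      generalize qShifted q w m = y6
      ring
    have hT' : ∀ m, vwpTerm q A [β, γ, δ, w ^ 2 * q ^ n / (β * γ * δ), (q ^ (n + 1))⁻¹] (m + 1) =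
        core m * ((1 - β * q ^ m) * (1 - γ * q ^ m) * (1 - δ * q ^ m)) *
        X m := by
      intro m
      rw [hcore, vwpTerm, hX]
      have hA1 : 1 - A ≠ 0 := hA.one_sub_ne_zero
      simp only [List.map_cons, List.map_nil, List.prod_cons, List.prod_nil, ← hw, e2, e3, e4, e5,
        mul_one]
      have e7 : A * q ^ (2 * (m + 1)) = w * q * (q ^ m) ^ 2 := by rw [hw]; ring
      rw [qShifted_succ' q A, qShifted_succ q q, qShifted_succ q β, qShifted_succ q γ,
        qShifted_succ q δ, qShifted_succ' q (w / β), qShifted_succ' q (w / γ),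
        qShifted_succ' q (w / δ), qShifted_succ' q (w ^ 2 * q ^ n / (β * γ * δ)),
        qShifted_succ q (β * γ * δ / (w * q ^ n)), qShifted_succ' q (q ^ (n + 1))⁻¹, e6, ← hw,
        qShifted_succ q (w * q * q ^ n), ← e1, ← e1, ← e1, e7, pow_succ' q n, pow_succ q m]
      generalize (1 - w * q * (q ^ m) ^ 2) = x1
      generalize (1 - w ^ 2 * q ^ n / (β * γ * δ)) = x2
      generalize (1 - (q * q ^ n)⁻¹) = x3
      generalize (1 - q * q ^ m) = x4
      generalize (1 - w / β) = x5
      generalize (1 - w / γ) = x6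
      generalize (1 - w / δ) = x7
      generalize (1 - β * γ * δ / (w * q ^ n) * q ^ m) = x8
      generalize (1 - w * q * q ^ n * q ^ m) = x9
      generalize (1 - β * q ^ m) = x10
      generalize (1 - γ * q ^ m) = x11
      generalize (1 - δ * q ^ m) = x12
      generalize qShifted q (w ^ 2 * q ^ n / (β * γ * δ) * q) m = x13
      generalize qShifted q (β * γ * δ / (w * q ^ n)) m = x14
      generalize qShifted q (w * q / β) m = y1
      generalize qShifted q (w * q / γ) m = y2
      generalize qShifted q (w * q / δ) m = y3
      generalize qShifted q (w * q * q ^ n) m = y4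
      generalize qShifted q (q ^ n)⁻¹ m = y5
      generalize qShifted q w m = y6
      have e10 : ∀ y z : K, x1 / (1 - A) * ((1 - A) * y / z) = x1 * (y / z) := by
        intro y z; field_simp
      rw [e10]
      ring
    obtain ⟨Z, hZ⟩ : ∃ Z : ℕ → K, ∀ m, Z m = (1 - β * q ^ m) * (1 - γ * q ^ m) * (1 - δ * q ^ m) :=
      ⟨_, fun _ => rfl⟩
    -- Closed form of the partial sums of the difference: the start is the addition formula at L =
    -- 1, each further term is `jackson_step`.
    have partialSum : ∀ m, ∑ k ∈ Finset.range (m + 1),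
        (vwpTerm q A [β, γ, δ, w ^ 2 * q ^ n / (β * γ * δ), (q ^ (n + 1))⁻¹] k -
          (1 - w) * c *
            vwpTerm q w [β, γ, δ, w ^ 2 * q ^ n / (β * γ * δ) * q, (q ^ n)⁻¹] k) =
        -(core m * Z m * (c * (1 - β * γ * δ / (w ^ 2 * q ^ m)) / D)) := by
      intro m
      induction m with
      | zero =>
        have h0 : core 0 = 1 := by
          have := hT 0
          rw [vwpTerm_zero gw.one_sub_ne_zero] at this
          simpa [gw.one_sub_ne_zero] using this.symm
        have key := jackson_addition_formula (β := β) (γ := γ) (δ := δ) hw0 (one_ne_zero)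
        rw [Finset.sum_range_one, vwpTerm_zero hA.one_sub_ne_zero,
          vwpTerm_zero gw.one_sub_ne_zero, h0, hZ, pow_zero]
        have n1 := gβ.one_sub_ne_zero
        have n2 := gγ.one_sub_ne_zero
        have n3 := gδ.one_sub_ne_zero
        have n4 := gp.one_sub_ne_zero
        have hcD : c = -(w ^ 3 / (β * γ * δ) ^ 2) * D /
            ((1 - w / β) * (1 - w / γ) * (1 - w / δ) * (1 - w / (β * γ * δ))) := by
          rw [hc, hD]
          congr 1
          field_simp
          ring
        have hfac : -(w * 1 ^ 2) * (1 - β * γ * δ * 1 / w) * (1 - β / (w * 1)) * (1 - γ / (w * 1)) *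
            (1 - δ / (w * 1)) = -((β * γ * δ) ^ 2 / w ^ 3) *
            ((1 - w / β) * (1 - w / γ) * (1 - w / δ) * (1 - w / (β * γ * δ))) := by
          field_simp
          ring
        rw [hfac, ← hD] at key
        obtain ⟨y, hy⟩ : ∃ y, y =
          (1 - w / β) * (1 - w / γ) * (1 - w / δ) * (1 - w / (β * γ * δ)) := ⟨_, rfl⟩
        have hy0 : y ≠ 0 := by
          rw [hy]; exact mul_ne_zero (mul_ne_zero (mul_ne_zero n1 n2) n3) n4
        rw [← hy] at key hcD
        have hc2 : c * y = -(w ^ 3 / (β * γ * δ) ^ 2) * D := by rw [hcD]; field_simp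
        have hu : w ^ 3 / (β * γ * δ) ^ 2 * ((β * γ * δ) ^ 2 / w ^ 3) = 1 := by field_simp
        have : D * (1 - (1 - w) * c * 1) =
            -(1 * ((1 - β * 1) * (1 - γ * 1) * (1 - δ * 1)) *
              (c * (1 - β * γ * δ / (w ^ 2 * 1)))) := by
          linear_combination -c * key + ((β * γ * δ) ^ 2 / w ^ 3) * hc2 - D * hu
        rw [← mul_right_inj' hD0, this]
        field_simp
      | succ m ihm =>
        rw [Finset.sum_range_succ, ihm, hT', hT, hcs, ← hZ]
        have step := jackson_step (X := X m) (R := R m) (x := q ^ m) (Q := q ^ n) hw0 hβ hγ hδ hq0 (pow_ne_zero _ hq0)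
          (pow_ne_zero _ hq0) (sub_ne_zero.2 (by rw [← pow_succ']; exact (hq m).symm)) hD hD0
          gβ.one_sub_ne_zero gγ.one_sub_ne_zero gδ.one_sub_ne_zero
          ((sh (e1 β) gβ).one_sub_mul_pow_ne_zero m) ((sh (e1 γ) gγ).one_sub_mul_pow_ne_zero m)
          ((sh (e1 δ) gδ).one_sub_mul_pow_ne_zero m) gp.one_sub_ne_zero
          ((gp.inv_mul_zpow hq0 (-n) (by
            rw [zpow_neg, zpow_natCast]; field_simp)).one_sub_mul_pow_ne_zero m)
          (by
            have := gw.one_sub_mul_pow_ne_zero (1 + n + m)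
            rwa [pow_add, pow_add, pow_one, ← mul_assoc, ← mul_assoc] at this)
          hc (hX m) (hR m)
        have hw1 := gw.one_sub_ne_zero
        rw [hZ (m + 1), pow_succ' q m, show w * q ^ (2 * (m + 1)) = w * q ^ 2 * (q ^ m) ^ 2 by ring]
        have e8 : ∀ u v : K, (1 - w) * c * (u / (1 - w) * v) = c * (u * v) := by
          intro u v; field_simp
        rw [e8]
        generalize (1 - w * q ^ 2 * (q ^ m) ^ 2) = z1 at step ⊢
        generalize (1 - β * γ * δ / (w ^ 2 * q ^ m)) = z2 at step ⊢
        generalize (1 - β * γ * δ / (w ^ 2 * (q * q ^ m))) = z3 at step ⊢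
        generalize ((1 - β * (q * q ^ m)) * (1 - γ * (q * q ^ m)) * (1 - δ * (q * q ^ m))) = z4
          at step ⊢
        linear_combination (core m * Z m) * step
    -- The factor (q^(-n))_(n+1) vanishes. This removes the boundary term at n + 1, and also shows
    -- that the series of base w already stops at n.
    have hlast : core (n + 1) = 0 := by
      have : qShifted q (q ^ n)⁻¹ (n + 1) = 0 := qShifted_inv_pow_eq_zero hq0 n.lt_succ_self
      rw [hcore]
      simp [this]
    have final := partialSum (n + 1)
    rw [hlast, zero_mul, zero_mul, neg_zero, Finset.sum_sub_distrib, sub_eq_zero] at final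
    rw [← hc, ← Finset.sum_range_succ, final, ← Finset.mul_sum, Finset.sum_range_succ _ (n + 1), hT (n + 1),
      hlast, mul_zero, add_zero]

end Jackson

/-! ### Reversal rules and the double series behind Bailey's transformation. -/

section Bailey

variable {K : Type*} [Field K]

/-- The product `∏ (u; q)_k / (A q / u; q)_k` over the parameters `u` of a well-poised series with
base `A`. -/
def wellPoised (q A : K) (l : List K) (k : ℕ) : K :=
  (l.map fun u => qShifted q u k / qShifted q (A * q / u) k).prod

theorem vwpTerm_eq (q A : K) (l : List K) (k : ℕ) :
    vwpTerm q A l k = (1 - A * q ^ (2 * k)) / (1 - A) * (qShifted q A k / qShifted q q k) *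
      wellPoised q A l k * q ^ k := rfl

@[simp] theorem wellPoised_nil (q A : K) (k : ℕ) : wellPoised q A [] k = 1 := rfl

theorem wellPoised_cons (q A u : K) (l : List K) (k : ℕ) :
    wellPoised q A (u :: l) k =
      qShifted q u k / qShifted q (A * q / u) k * wellPoised q A l k := by
  simp [wellPoised]

theorem wellPoised_append (q A : K) (l l' : List K) (k : ℕ) :
    wellPoised q A (l ++ l') k = wellPoised q A l k * wellPoised q A l' k := by
  simp [wellPoised]

/-- Rests on A q^(2k) q / (u q^k) = (A q / u) q^k: starting at index k preserves well-poisedness,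
with the base changed by q^(2k). -/
theorem wellPoised_add {q : K} (hq : q ≠ 0) (A : K) (l : List K) (k m : ℕ) :
    wellPoised q A l (k + m) =
      wellPoised q A l k * wellPoised q (A * q ^ (2 * k)) (l.map (· * q ^ k)) m := by
  induction l with
  | nil => simp
  | cons u l ih =>
    have : A * q ^ (2 * k) * q / (u * q ^ k) = A * q / u * q ^ k := by
      -- For u = 0 both arguments are 0, since division by zero gives 0; so no hypothesis on the
      -- parameters is needed.
      by_cases hu : u = 0
      · simp [hu]
      · field_simp
        ring
    rw [List.map_cons, wellPoised_cons, wellPoised_cons, wellPoised_cons, ih, qShifted_add,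
      qShifted_add, this, mul_div_mul_comm]
    ring

/-- Reverse the product and use 1 - 1/v = -(1 - v)/v in each factor. The signed power of q that
remains does not involve z, so it drops out of `qShifted_reflect_ratio`. -/
theorem qShifted_reflect {q z : K} (hq : q ≠ 0) (hz : z ≠ 0) (m k : ℕ) :
    qShifted q (q / (z * q ^ (m + k))) k * z ^ k =
      qShifted q (z * q ^ m) k * ∏ j ∈ Finset.range k, -(q ^ (m + j))⁻¹ := by
  rw [qShifted, ← Finset.prod_range_reflect, qShifted, ← Finset.prod_mul_distrib,
    ← Finset.card_range k, ← Finset.prod_const, Finset.card_range, ← Finset.prod_mul_distrib]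
  refine Finset.prod_congr rfl fun j hj => ?_
  have hj' := Finset.mem_range.1 hj
  obtain ⟨i, rfl⟩ : ∃ i, k = j + 1 + i := ⟨k - (j + 1), by omega⟩
  have : j + 1 + i - 1 - j = i := by omega
  rw [this]
  field_simp
  ring

theorem qShifted_reflect_ratio {q z w : K} (hq : q ≠ 0) (hz : z ≠ 0) (hw : w ≠ 0) (m k : ℕ) :
    qShifted q (q / (z * q ^ (m + k))) k * z ^ k * qShifted q (w * q ^ m) k =
      qShifted q (q / (w * q ^ (m + k))) k * w ^ k * qShifted q (z * q ^ m) k := by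
  rw [qShifted_reflect hq hz, qShifted_reflect hq hw]
  ring

/-- The summand of the double series behind Bailey's transformation, rearranged. -/
theorem bailey_summand {q A B z : K} (hq0 : q ≠ 0) (hq : ∀ n : ℕ, q ^ (n + 1) ≠ 1)
    (hA : QGeneric q A) (hB : QGeneric q B) (hz : QGeneric q z) (hB0 : B ≠ 0) (hz0 : z ≠ 0)
    (hBz : A = B * z) (l l' : List K) (k m : ℕ) :
    (1 - A * q ^ (2 * (k + m))) / (1 - A) * (qShifted q A (k + m) / qShifted q q (k + m)) *
        wellPoised q A l (k + m) * q ^ (k + m) *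
        (qShifted q z (k + m) / qShifted q (B * q) (k + m)) *
        vwpTerm q B (l' ++ [A * q ^ (k + m), (q ^ (k + m))⁻¹]) k =
      qShifted q (A * q) (2 * k) / qShifted q (B * q) (2 * k) * z ^ k * wellPoised q A l k *
        vwpTerm q B l' k * vwpTerm q (A * q ^ (2 * k)) (z :: l.map (· * q ^ k)) m := by
  have hA0 : A ≠ 0 := hBz ▸ mul_ne_zero hB0 hz0
  have hqn := QGeneric.qShifted_self_ne_zero hq
  have sh : ∀ {u : K}, QGeneric q u → ∀ i j, qShifted q (u * q ^ i) j ≠ 0 := fun h i j =>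
    (h.mul_zpow hq0 (i : ℤ) (by rw [zpow_natCast])).qShifted_ne_zero j
  have hBq : ∀ i j, qShifted q (B * q * q ^ i) j ≠ 0 := fun i j => by
    have := sh hB (1 + i) j
    rwa [pow_add, pow_one, ← mul_assoc] at this
  have f1 : qShifted q (A * q ^ (k + m)) k =
      qShifted q A (2 * k) * qShifted q (A * q ^ (2 * k)) m / qShifted q A (k + m) := by
    rw [eq_div_iff (hA.qShifted_ne_zero _), mul_comm, ← qShifted_add, ← qShifted_add]
    congr 1; ring
  have f2 : qShifted q (B * q * q ^ (k + m)) k = qShifted q (B * q) (2 * k) *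
      qShifted q (B * q * q ^ (2 * k)) m / qShifted q (B * q) (k + m) := by
    rw [eq_div_iff (by simpa using hBq 0 (k + m)), mul_comm, ← qShifted_add, ← qShifted_add]
    congr 1; ring
  have f3 : qShifted q z (k + m) = qShifted q z m * qShifted q (z * q ^ m) k := by
    rw [← qShifted_add, add_comm]
  have f4 : qShifted q q (k + m) = qShifted q q m * qShifted q (q * q ^ m) k := by
    rw [← qShifted_add, add_comm]
  have f4' : qShifted q (q * q ^ m) k ≠ 0 := fun h => hqn (k + m) (by rw [f4, h, mul_zero])
  have f5 : qShifted q (q ^ (k + m))⁻¹ k = qShifted q (B * q / (A * q ^ (k + m))) k * z ^ k *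
      qShifted q (q * q ^ m) k / (q ^ k * qShifted q (z * q ^ m) k) := by
    have := qShifted_reflect_ratio hq0 hz0 hq0 m k
    rw [eq_div_iff (mul_ne_zero (pow_ne_zero _ hq0) (sh hz _ _))]
    have e1 : q / (z * q ^ (m + k)) = B * q / (A * q ^ (k + m)) := by
      rw [hBz, add_comm]; field_simp
    have e2 : q / (q * q ^ (m + k)) = (q ^ (k + m))⁻¹ := by rw [add_comm]; field_simp
    rw [e1, e2] at this
    rw [this, mul_assoc]
  have f6 : (1 - A)⁻¹ * qShifted q A (2 * k) * (1 - A * q ^ (2 * k)) = qShifted q (A * q) (2 * k) := by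
    rw [inv_mul_eq_div, div_mul_eq_mul_div, div_eq_iff hA.one_sub_ne_zero, ← qShifted_succ,
      qShifted_succ', mul_comm]
  have e3 : B * q / (q ^ (k + m))⁻¹ = B * q * q ^ (k + m) := by field_simp
  have e4 : A * q ^ (2 * k) * q / z = B * q * q ^ (2 * k) := by rw [hBz]; field_simp
  have g1 : qShifted q (B * q / (A * q ^ (k + m))) k ≠ 0 := by
    refine (hz.inv_mul_zpow hq0 (1 - (k + m : ℕ)) ?_).qShifted_ne_zero k
    rw [zpow_sub₀ hq0, zpow_natCast, zpow_one, hBz]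
    field_simp
  rw [vwpTerm_eq, vwpTerm_eq, vwpTerm_eq, wellPoised_append, wellPoised_cons, wellPoised_cons,
    wellPoised_cons, wellPoised_nil, wellPoised_add hq0, e3, e4, f1, f2, f3, f4, f5, ← f6]
  have e5 : A * q ^ (2 * (k + m)) = A * q ^ (2 * k) * q ^ (2 * m) := by ring
  generalize qShifted q (B * q / (A * q ^ (k + m))) k = y1 at *
  rw [e5, pow_add]
  have n1 := hA.one_sub_ne_zero
  have n2 := hA.one_sub_mul_pow_ne_zero (2 * k)
  have n3 := hA.qShifted_ne_zero (k + m)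
  have n4 := hBq 0 (k + m)
  have n5 := hBq 0 (2 * k)
  have n6 := hBq (2 * k) m
  have n7 := sh hz m k
  have n8 := hB.one_sub_ne_zero
  have n9 := hqn k
  have n10 := hqn m
  simp only [pow_zero, mul_one] at n4 n5
  clear f1 f2 f3 f4 f5 f6 e3 e4 e5 sh hBq hqn hBz
  generalize qShifted q (B * q) (k + m) = y2 at *
  generalize qShifted q (B * q) (2 * k) = y3 at *
  generalize qShifted q (B * q * q ^ (2 * k)) m = y4 at *
  generalize qShifted q (z * q ^ m) k = y5 at *
  generalize qShifted q (q * q ^ m) k = y6 at *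
  generalize qShifted q A (k + m) = y7 at *
  generalize qShifted q A (2 * k) = y8 at *
  generalize qShifted q (A * q ^ (2 * k)) m = y9 at *
  generalize 1 - A * q ^ (2 * k) * q ^ (2 * m) = x1 at *
  generalize 1 - A * q ^ (2 * k) = x2 at *
  generalize 1 - B * q ^ (2 * k) = x3 at *
  generalize 1 - A = x4 at *
  generalize 1 - B = x5 at *
  generalize wellPoised q (A * q ^ (2 * k)) (l.map (· * q ^ k)) m = y10 at *
  generalize wellPoised q A l k = y11 at *
  generalize wellPoised q B l' k = y12 at *
  generalize qShifted q q k = y13 at *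
  generalize qShifted q q m = y14 at *
  generalize qShifted q z m = y15 at *
  generalize qShifted q B k = y16 at *
  field_simp

end Bailey

/-! ### The outer sum of the double series. -/

section Bailey

variable {K : Type*} [Field K]

theorem vwpTerm_append (q A : K) (l l' : List K) (k : ℕ) :
    vwpTerm q A (l ++ l') k = vwpTerm q A l k * wellPoised q A l' k := by
  rw [vwpTerm_eq, vwpTerm_eq, wellPoised_append]
  ring

/-- The prefactor of Bailey's transformation. -/
def baileyFactor (q A L E F : K) (N : ℕ) : K :=
  qShifted q (A * q) N * qShifted q (A * q / (E * F)) N * qShifted q (L * q / E) N *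
      qShifted q (L * q / F) N /
    (qShifted q (A * q / E) N * qShifted q (A * q / F) N * qShifted q (L * q) N *
      qShifted q (L * q / (E * F)) N)

/-- Once the sum over m is evaluated by Jackson's formula with base A q^(2k), what remains must be
the k-th factor of the series of base L. Balancing makes A q / G and L q / G the reversals of L q /
(E F) and A q / (E F); this is what absorbs z^k. -/
theorem bailey_outer {q A L z E F G : K} (hq0 : q ≠ 0) (hA : QGeneric q A) (hL : QGeneric q L)
    (hE0 : E ≠ 0) (hF0 : F ≠ 0)
    (hL0 : L ≠ 0) (hz0 : z ≠ 0) (hAz : A = L * z)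
    (hAE : QGeneric q (A / E)) (hAF : QGeneric q (A / F)) (hLE : QGeneric q (L / E))
    (hLF : QGeneric q (L / F)) (hAEF : QGeneric q (A / (E * F))) (hLEF : QGeneric q (L / (E * F)))
    {N k : ℕ} (hk : k ≤ N) (hbal : A * L * q ^ (N + 1) = E * F * G) :
    qShifted q (A * q) (2 * k) / qShifted q (L * q) (2 * k) * z ^ k *
        wellPoised q A [E, F, G, (q ^ N)⁻¹] k *
        jacksonValue q (A * q ^ (2 * k)) z (E * q ^ k) (F * q ^ k) (N - k) =
      baileyFactor q A L E F N * wellPoised q L [E, F, G, (q ^ N)⁻¹] k := by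
  have hA0 : A ≠ 0 := hAz ▸ mul_ne_zero hL0 hz0
  obtain ⟨m, rfl⟩ : ∃ m, N = m + k := ⟨N - k, by omega⟩
  have sub : m + k - k = m := by omega
  have hG : G = A * L * q ^ (m + k + 1) / (E * F) := by rw [hbal]; field_simp
  have nz : ∀ {u v : K}, QGeneric q u → ∀ i : ℕ, v = u * q ^ i → ∀ j, qShifted q v j ≠ 0 :=
    fun h i hv j => (h.mul_zpow hq0 (i : ℤ) (by rw [zpow_natCast, hv])).qShifted_ne_zero j
  have split : ∀ u v : K, v = u * q ^ k → qShifted q u (m + k) ≠ 0 →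
      qShifted q v m = qShifted q u (m + k) / qShifted q u k := by
    intro u v hv h
    rw [add_comm, qShifted_add, ← hv] at h ⊢
    have := left_ne_zero_of_mul h
    field_simp
  have n1 := nz hA 1 (v := A * q) (by ring)
  have n2 := nz hL 1 (v := L * q) (by ring)
  have n3 := nz hAE 1 (v := A * q / E) (by ring)
  have n4 := nz hAF 1 (v := A * q / F) (by ring)
  have n5 := nz hLE 1 (v := L * q / E) (by ring)
  have n6 := nz hLF 1 (v := L * q / F) (by ring)
  have n7 := nz hAEF 1 (v := A * q / (E * F)) (by ring)
  have n8 := nz hLEF 1 (v := L * q / (E * F)) (by ring)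
  have a1 : qShifted q (A * q ^ (2 * k) * q) m = qShifted q (A * q) (m + k) *
      qShifted q (A * q * q ^ (m + k)) k / qShifted q (A * q) (2 * k) := by
    rw [eq_div_iff (n1 _), ← qShifted_add, mul_comm,
      show A * q ^ (2 * k) * q = A * q * q ^ (2 * k) by ring, ← qShifted_add]
    congr 1; ring
  have a2 : qShifted q (A * q ^ (2 * k) * q / z) m = qShifted q (L * q) (m + k) *
      qShifted q (L * q * q ^ (m + k)) k / qShifted q (L * q) (2 * k) := by
    rw [eq_div_iff (n2 _), ← qShifted_add, mul_comm,
      show A * q ^ (2 * k) * q / z = L * q * q ^ (2 * k) by rw [hAz]; field_simp, ← qShifted_add]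
    congr 1; ring
  have a3 := split (A * q / E) (A * q ^ (2 * k) * q / (E * q ^ k)) (by field_simp; ring) (n3 _)
  have a4 := split (A * q / F) (A * q ^ (2 * k) * q / (F * q ^ k)) (by field_simp; ring) (n4 _)
  have a5 := split (L * q / E) (A * q ^ (2 * k) * q / (z * (E * q ^ k)))
    (by rw [hAz]; field_simp; ring) (n5 _)
  have a6 := split (L * q / F) (A * q ^ (2 * k) * q / (z * (F * q ^ k)))
    (by rw [hAz]; field_simp; ring) (n6 _)
  have b1 : A * q ^ (2 * k) * q / (E * q ^ k * (F * q ^ k)) = A * q / (E * F) := by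
    field_simp; ring
  have b2 : A * q ^ (2 * k) * q / (z * (E * q ^ k) * (F * q ^ k)) = L * q / (E * F) := by
    rw [hAz]; field_simp; ring
  have b3 : A * q / G = q / (L * q / (E * F) * q ^ (m + k)) := by rw [hG]; field_simp; ring
  have b4 : L * q / G = q / (A * q / (E * F) * q ^ (m + k)) := by rw [hG]; field_simp; ring
  have b5 : ∀ u : K, u / (q ^ (m + k))⁻¹ = u * q ^ (m + k) := fun u => by field_simp
  have y1 : A * q / (E * F) ≠ 0 := by simp [*]
  have y2 : L * q / (E * F) ≠ 0 := by simp [*]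
  have hrefl := qShifted_reflect_ratio hq0 y1 y2 m k
  rw [← b3, ← b4] at hrefl
  have c1 : qShifted q (A * q / (E * F)) (m + k) =
      qShifted q (A * q / (E * F)) m * qShifted q (A * q / (E * F) * q ^ m) k := qShifted_add ..
  have c2 : qShifted q (L * q / (E * F)) (m + k) =
      qShifted q (L * q / (E * F)) m * qShifted q (L * q / (E * F) * q ^ m) k := qShifted_add ..
  have n9 : qShifted q (A * q / G) k ≠ 0 := by
    refine (hLEF.inv_mul_zpow hq0 (-(m + k : ℕ)) ?_).qShifted_ne_zero k
    rw [b3, zpow_neg, zpow_natCast]; field_simp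
  have n10 : qShifted q (L * q / G) k ≠ 0 := by
    refine (hAEF.inv_mul_zpow hq0 (-(m + k : ℕ)) ?_).qShifted_ne_zero k
    rw [b4, zpow_neg, zpow_natCast]; field_simp
  have n11 := n7 (m + k)
  have n12 := n8 (m + k)
  rw [c1] at n11
  rw [c2] at n12
  have n13 := left_ne_zero_of_mul n11
  have n14 := right_ne_zero_of_mul n11
  have n15 := left_ne_zero_of_mul n12
  have n16 := right_ne_zero_of_mul n12
  have n17 := nz hA (1 + (m + k)) (v := A * q * q ^ (m + k)) (by ring) k
  have n18 := nz hL (1 + (m + k)) (v := L * q * q ^ (m + k)) (by ring) k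
  have hyz : A * q / (E * F) = z * (L * q / (E * F)) := by rw [hAz]; ring
  rw [sub, baileyFactor, jacksonValue, a1, a2, a3, a4, a5, a6, b1, b2, c1, c2]
  simp only [wellPoised_cons, wellPoised_nil, b5]
  replace n1 := And.intro (n1 (m + k)) (n1 (2 * k))
  replace n2 := And.intro (n2 (m + k)) (n2 (2 * k))
  replace n3 := And.intro (n3 (m + k)) (n3 k)
  replace n4 := And.intro (n4 (m + k)) (n4 k)
  replace n5 := And.intro (n5 (m + k)) (n5 k)
  replace n6 := And.intro (n6 (m + k)) (n6 k)
  have hr : z ^ k * (qShifted q (L * q / G) k * qShifted q (L * q / (E * F) * q ^ m) k) =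
      qShifted q (A * q / G) k * qShifted q (A * q / (E * F) * q ^ m) k := by
    rw [hyz, mul_pow] at hrefl
    refine mul_right_cancel₀ (pow_ne_zero k y2) ?_
    rw [hyz]
    linear_combination hrefl
  obtain ⟨n1, n1'⟩ := n1
  obtain ⟨n2, n2'⟩ := n2
  obtain ⟨n3, n3'⟩ := n3
  obtain ⟨n4, n4'⟩ := n4
  obtain ⟨n5, n5'⟩ := n5
  obtain ⟨n6, n6'⟩ := n6
  clear a1 a2 a3 a4 a5 a6 b1 b2 b3 b4 b5 c1 c2 n11 n12 split nz hyz hG hrefl hbal n7 n8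
  generalize qShifted q (A * q) (m + k) = y1 at *
  generalize qShifted q (A * q) (2 * k) = y2 at *
  generalize qShifted q (L * q) (m + k) = y3 at *
  generalize qShifted q (L * q) (2 * k) = y4 at *
  generalize qShifted q (A * q / E) (m + k) = y5 at *
  generalize qShifted q (A * q / E) k = y6 at *
  generalize qShifted q (A * q / F) (m + k) = y7 at *
  generalize qShifted q (A * q / F) k = y8 at *
  generalize qShifted q (L * q / E) (m + k) = y9 at *
  generalize qShifted q (L * q / E) k = y10 at *
  generalize qShifted q (L * q / F) (m + k) = y11 at *
  generalize qShifted q (L * q / F) k = y12 at *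
  generalize qShifted q (A * q / (E * F)) m = y13 at *
  generalize qShifted q (A * q / (E * F) * q ^ m) k = y14 at *
  generalize qShifted q (L * q / (E * F)) m = y15 at *
  generalize qShifted q (L * q / (E * F) * q ^ m) k = y16 at *
  generalize qShifted q (A * q / G) k = y17 at *
  generalize qShifted q (L * q / G) k = y18 at *
  generalize qShifted q (A * q * q ^ (m + k)) k = y19 at *
  generalize qShifted q (L * q * q ^ (m + k)) k = y20 at *
  generalize qShifted q E k = y21 at *
  generalize qShifted q F k = y22 at *
  generalize qShifted q G k = y23 at *
  generalize qShifted q (q ^ (m + k))⁻¹ k = y24 at *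
  field_simp
  linear_combination (y21 * y22 * y23 * y24) * hr

end Bailey

/-! ### Bailey's transformation. -/

section Bailey

variable {K : Type*} [Field K]

/-- Bailey's transformation of terminating balanced very-well-poised `₁₀φ₉` series. -/
theorem bailey_transformation {q A L B C D E F G : K} (hq0 : q ≠ 0)
    (hq : ∀ n : ℕ, q ^ (n + 1) ≠ 1) (hA0 : A ≠ 0) (hB0 : B ≠ 0) (hC0 : C ≠ 0) (hD0 : D ≠ 0)
    (hE0 : E ≠ 0) (hF0 : F ≠ 0) (hL0 : L ≠ 0)
    (hBCD : L * (B * C * D) = A ^ 2 * q) {N : ℕ} (hbal : A * L * q ^ (N + 1) = E * F * G)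
    (hA : QGeneric q A) (hL : QGeneric q L) (hAL : QGeneric q (A / L))
    (hB : QGeneric q B) (hC : QGeneric q C) (hD : QGeneric q D)
    (hAB : QGeneric q (A / B)) (hAC : QGeneric q (A / C)) (hAD : QGeneric q (A / D))
    (hAE : QGeneric q (A / E)) (hAF : QGeneric q (A / F)) (hLE : QGeneric q (L / E))
    (hLF : QGeneric q (L / F)) (hAEF : QGeneric q (A / (E * F)))
    (hLEF : QGeneric q (L / (E * F))) :
    ∑ k ∈ Finset.range (N + 1), vwpTerm q A [B, C, D, E, F, G, (q ^ N)⁻¹] k =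
      baileyFactor q A L E F N * ∑ k ∈ Finset.range (N + 1),
        vwpTerm q L [L * B / A, L * C / A, L * D / A, E, F, G, (q ^ N)⁻¹] k := by
  obtain ⟨z, hz⟩ : ∃ z, z = A / L := ⟨_, rfl⟩
  have hAz : A = L * z := by rw [hz]; field_simp
  have hz0 : z ≠ 0 := hz ▸ div_ne_zero hA0 hL0
  have hzg : QGeneric q z := hz ▸ hAL
  have nz : ∀ {u v : K}, QGeneric q u → v = u * q → ∀ j, qShifted q v j ≠ 0 :=
    fun h hv j => (h.mul_zpow hq0 1 (by rw [zpow_one, hv])).qShifted_ne_zero j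
  have hDe : D = A ^ 2 * q / (L * B * C) := by
    rw [← hBCD]; field_simp
  have e1 : L * q / (L * B / A) = A * q / B := by field_simp
  have e2 : L * q / (L * C / A) = A * q / C := by field_simp
  have e3 : L * q / (L * D / A) = A * q / D := by field_simp
  have e4 : L * q / (L * B / A * (L * C / A)) = D := by rw [hDe]; field_simp
  have e5 : L * q / (L * B / A * (L * D / A)) = C := by rw [hDe]; field_simp
  have e6 : L * q / (L * C / A * (L * D / A)) = B := by rw [hDe]; field_simp
  have e7 : L / (L * B / A * (L * C / A) * (L * D / A)) = z * q ^ (-1 : ℤ) := by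
    rw [hz, hDe, zpow_neg, zpow_one]; field_simp
  have e8 : L * q / (L * B / A * (L * C / A) * (L * D / A)) = z := by
    rw [hz, hDe]; field_simp
  have back : ∀ {u v : K}, v * q = u → QGeneric q u → QGeneric q v := fun h hu =>
    hu.mul_zpow hq0 (-1) (by rw [zpow_neg, zpow_one, ← h]; field_simp)
  -- Jackson's sum read backwards: the B, C, D part of the n-th term becomes a series of base L.
  have inner : ∀ n, wellPoised q A [B, C, D] n = qShifted q z n / qShifted q (L * q) n *
      ∑ k ∈ Finset.range (n + 1),
        vwpTerm q L ([L * B / A, L * C / A, L * D / A] ++ [A * q ^ n, (q ^ n)⁻¹]) k := by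
    intro n
    have j := jackson_sum hq0 hq (β := L * B / A) (γ := L * C / A) (δ := L * D / A)
      (div_ne_zero (mul_ne_zero hL0 hB0) hA0) (div_ne_zero (mul_ne_zero hL0 hC0) hA0)
      (div_ne_zero (mul_ne_zero hL0 hD0) hA0) n hL0 hL
      (by convert hAB using 1; field_simp) (by convert hAC using 1; field_simp)
      (by convert hAD using 1; field_simp) (back (by rw [div_mul_eq_mul_div, e4]) hD)
      (back (by rw [div_mul_eq_mul_div, e5]) hC) (back (by rw [div_mul_eq_mul_div, e6]) hB)
      (hzg.mul_zpow hq0 _ e7)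
    have e9 : L ^ 2 * q ^ (n + 1) / (L * B / A * (L * C / A) * (L * D / A)) = A * q ^ n := by
      rw [hDe]; field_simp; ring
    rw [e9] at j
    rw [List.cons_append, List.cons_append, List.cons_append, List.nil_append, j, jacksonValue,
      e1, e2, e3, e4, e5, e6, e8]
    simp only [wellPoised_cons, wellPoised_nil]
    have n1 := nz hL (v := L * q) rfl n
    have n2 := hzg.qShifted_ne_zero n
    have n3 := nz hAB (v := A * q / B) (by ring) n
    have n4 := nz hAC (v := A * q / C) (by ring) n
    have n5 := nz hAD (v := A * q / D) (by ring) n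
    generalize qShifted q (L * q) n = y1 at *
    generalize qShifted q z n = y2 at *
    generalize qShifted q (A * q / B) n = y3 at *
    generalize qShifted q (A * q / C) n = y4 at *
    generalize qShifted q (A * q / D) n = y5 at *
    field_simp
  obtain ⟨g, hg⟩ : ∃ g : ℕ → ℕ → K, ∀ n k, g n k =
      (1 - A * q ^ (2 * n)) / (1 - A) * (qShifted q A n / qShifted q q n) *
        wellPoised q A [E, F, G, (q ^ N)⁻¹] n * q ^ n *
        (qShifted q z n / qShifted q (L * q) n) *
        vwpTerm q L ([L * B / A, L * C / A, L * D / A] ++ [A * q ^ n, (q ^ n)⁻¹]) k :=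
    ⟨_, fun _ _ => rfl⟩
  -- The index k + (n - k), instead of n, is the shape needed for the interchange of summations.
  have outer : ∀ n, vwpTerm q A [B, C, D, E, F, G, (q ^ N)⁻¹] n =
      ∑ k ∈ Finset.range (n + 1), g (k + (n - k)) k := by
    intro n
    have : ∀ k ∈ Finset.range (n + 1), g (k + (n - k)) k = g n k := fun k hk => by
      rw [Nat.add_sub_cancel' (Nat.lt_succ_iff.1 (Finset.mem_range.1 hk))]
    rw [Finset.sum_congr rfl this]
    simp only [hg]
    rw [← Finset.mul_sum, mul_assoc _ (qShifted q z n / _), ← inner, vwpTerm_eq,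
      show [B, C, D, E, F, G, (q ^ N)⁻¹] = [B, C, D] ++ [E, F, G, (q ^ N)⁻¹] from rfl,
      wellPoised_append]
    ring
  -- Interchange the sums with n = k + m. The sum over m is again one of Jackson's, now with base A
  -- q^(2k).
  rw [Finset.sum_congr rfl fun n _ => outer n,
    Finset.sum_range_diag_flip (N + 1) fun k m => g (k + m) k, Finset.mul_sum]
  refine Finset.sum_congr rfl fun k hk => ?_
  have hkN : k ≤ N := Nat.lt_succ_iff.1 (Finset.mem_range.1 hk)
  have hsum := fun m => bailey_summand hq0 hq hA hL hzg hL0 hz0 hAz [E, F, G, (q ^ N)⁻¹]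
    [L * B / A, L * C / A, L * D / A] k m
  simp only [hg, hsum]
  rw [← Finset.mul_sum, Nat.sub_add_comm hkN]
  have sh : ∀ {u v : K} (i : ℤ), v = u * q ^ i → QGeneric q u → QGeneric q v := fun i hv hu =>
    hu.mul_zpow hq0 i hv
  have z2 : ((2 * k : ℕ) : ℤ) = 2 * (k : ℤ) := by push_cast; ring
  have hAz' : A / z = L := by rw [hAz]; field_simp
  have p2 : q ^ (2 * k) = q ^ k * q ^ k := by ring
  have hGe : G = A * L * q ^ (N + 1) / (E * F) := by rw [hbal]; field_simp
  have jk := jackson_sum hq0 hq (β := z) (γ := E * q ^ k) (δ := F * q ^ k) hz0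
    (mul_ne_zero hE0 (pow_ne_zero _ hq0)) (mul_ne_zero hF0 (pow_ne_zero _ hq0)) (N - k)
    (A := A * q ^ (2 * k)) (mul_ne_zero hA0 (pow_ne_zero _ hq0))
    (sh (2 * k : ℕ) (by rw [zpow_natCast]) hA)
    (sh (2 * k : ℕ) (by rw [zpow_natCast, hAz]; field_simp) hL)
    (sh k (by rw [zpow_natCast, p2]; field_simp) hAE)
    (sh k (by rw [zpow_natCast, p2]; field_simp) hAF)
    (sh k (by rw [zpow_natCast, hAz, p2]; field_simp) hLE)
    (sh k (by rw [zpow_natCast, hAz, p2]; field_simp) hLF)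
    (sh 0 (by rw [zpow_zero, p2]; field_simp) hAEF)
    (sh 0 (by rw [zpow_zero, hAz, p2]; field_simp) hLEF)
  have l1 : (A * q ^ (2 * k)) ^ 2 * q ^ (N - k + 1) / (z * (E * q ^ k) * (F * q ^ k)) =
      G * q ^ k := by
    obtain ⟨m, rfl⟩ : ∃ m, N = m + k := ⟨N - k, by omega⟩
    rw [hGe, Nat.add_sub_cancel, hAz]
    field_simp
    ring
  have l2 : (q ^ (N - k))⁻¹ = (q ^ N)⁻¹ * q ^ k := by
    obtain ⟨m, rfl⟩ : ∃ m, N = m + k := ⟨N - k, by omega⟩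
    rw [Nat.add_sub_cancel, pow_add]
    field_simp
  rw [l1, l2] at jk
  simp only [List.map_cons, List.map_nil]
  rw [jk, show [L * B / A, L * C / A, L * D / A, E, F, G, (q ^ N)⁻¹] =
    [L * B / A, L * C / A, L * D / A] ++ [E, F, G, (q ^ N)⁻¹] from rfl, vwpTerm_append]
  have out := bailey_outer hq0 hA hL hE0 hF0 hL0 hz0 hAz hAE hAF hLE hLF hAEF hLEF hkN hbal
  linear_combination (vwpTerm q L [L * B / A, L * C / A, L * D / A] k) * out

end Bailey

/-! ### The twofold iterate of Bailey's transformation. -/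

section Iterated

variable {K : Type*} [Field K]

theorem vwpTerm_perm {q A : K} {l l' : List K} (h : l.Perm l') (k : ℕ) :
    vwpTerm q A l k = vwpTerm q A l' k := by
  rw [vwpTerm, vwpTerm, (h.map _).prod_eq]

/-- The prefactor of the twofold iterate of Bailey's transformation. -/
def iteratedFactor (q A B C D E F G : K) (N : ℕ) : K :=
  E ^ N * qShifted q (A * q) N * qShifted q B N / qShifted q (B / E) N *
    (qShifted q (A * q / (C * E)) N * qShifted q (A * q / (D * E)) N *
        qShifted q (A * q / (E * F)) N * qShifted q (A * q / (E * G)) N /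
      (qShifted q (A * q / C) N * qShifted q (A * q / D) N * qShifted q (A * q / E) N *
        qShifted q (A * q / F) N * qShifted q (A * q / G) N))

/-- Reversing N factors produces this signed power of q. Only its square, q^(-N(N-1)), survives in
the iterate, so the sign plays no role. -/
theorem prod_neg_inv_pow_sq {q : K} (hq : q ≠ 0) (N : ℕ) :
    (∏ j ∈ Finset.range N, -(q ^ (0 + j))⁻¹) ^ 2 * (q ^ N) ^ N = q ^ N := by
  induction N with
  | zero => simp
  | succ N ih =>
    rw [Finset.prod_range_succ, ← mul_right_inj' (pow_ne_zero N hq)]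
    have e1 : (q ^ (N + 1)) ^ (N + 1) = (q ^ N) ^ N * (q ^ N * q ^ (N + 1)) := by ring
    have e2 : (q ^ N)⁻¹ * q ^ N = 1 := inv_mul_cancel₀ (pow_ne_zero _ hq)
    rw [e1, zero_add]
    generalize ∏ j ∈ Finset.range N, -(q ^ (0 + j))⁻¹ = s at *
    generalize (q ^ N)⁻¹ = i at *
    generalize (q ^ N) ^ N = X at *
    linear_combination (q ^ N * q ^ N * i ^ 2 * q ^ (N + 1)) * ih +
      (q ^ N * q ^ (N + 1) * (i * q ^ N + 1)) * e2

set_option maxHeartbeats 1000000 in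
/-- A twofold iterate of Bailey's transformation. -/
theorem bailey_transformation_iterated {q A B C D E F G : K} (hq0 : q ≠ 0)
    (hq : ∀ n : ℕ, q ^ (n + 1) ≠ 1) (hA0 : A ≠ 0) (hB0 : B ≠ 0) (hC0 : C ≠ 0) (hD0 : D ≠ 0)
    (hE0 : E ≠ 0) (hF0 : F ≠ 0) (hG0 : G ≠ 0) {N : ℕ}
    (hbal : A ^ 3 * q ^ (N + 2) = B * C * D * E * F * G)
    (hA : QGeneric q A) (hABCD : QGeneric q (A / (B * C * D)))
    (hAABCD : QGeneric q (A ^ 2 / (B * C * D))) (hABFG : QGeneric q (A / (B * F * G)))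
    (hACD : QGeneric q (A / (C * D))) (hAFG : QGeneric q (A / (F * G)))
    (hB : QGeneric q B) (hC : QGeneric q C) (hD : QGeneric q D) (hF : QGeneric q F)
    (hG : QGeneric q G) (hAB : QGeneric q (A / B)) (hAC : QGeneric q (A / C))
    (hAD : QGeneric q (A / D)) (hAE : QGeneric q (A / E)) (hAF : QGeneric q (A / F))
    (hAG : QGeneric q (A / G)) (hBE : QGeneric q (B / E)) (hACE : QGeneric q (A / (C * E)))
    (hADE : QGeneric q (A / (D * E))) (hAEF : QGeneric q (A / (E * F)))
    (hAEG : QGeneric q (A / (E * G))) :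
    ∑ k ∈ Finset.range (N + 1), vwpTerm q A [B, C, D, E, F, G, (q ^ N)⁻¹] k =
      iteratedFactor q A B C D E F G N * ∑ k ∈ Finset.range (N + 1),
        vwpTerm q (E * (q ^ N)⁻¹ / B) [E, E * (q ^ N)⁻¹ / A, A * q / (B * C), A * q / (B * D),
          A * q / (B * F), A * q / (B * G), (q ^ N)⁻¹] k := by
  -- The bases after the first and the second application: L · BCD = A² q and, by balancing, M · (L
  -- B / A) F G = L² q.
  obtain ⟨L, hL⟩ : ∃ L, L = A ^ 2 * q / (B * C * D) := ⟨_, rfl⟩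
  obtain ⟨M, hM⟩ : ∃ M, M = E * (q ^ N)⁻¹ / B := ⟨_, rfl⟩
  have hL0 : L ≠ 0 := by rw [hL]; simp [*]
  have hM0 : M ≠ 0 := by rw [hM]; simp [*]
  have hGe : G = A ^ 3 * q ^ (N + 2) / (B * C * D * E * F) := by rw [hbal]; field_simp
  have sh : ∀ {u v : K} (i : ℤ), v = u * q ^ i → QGeneric q u → QGeneric q v := fun i hv hu =>
    hu.mul_zpow hq0 i hv
  have shi : ∀ {u v : K} (i : ℤ), v = u⁻¹ * q ^ i → QGeneric q u → QGeneric q v :=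
    fun i hv hu => hu.inv_mul_zpow hq0 i hv
  have nz : ∀ {u v : K}, QGeneric q u → v = u * q → ∀ j, qShifted q v j ≠ 0 :=
    fun h hv j => (h.mul_zpow hq0 1 (by rw [zpow_one, hv])).qShifted_ne_zero j
  have zN : q ^ (-(N : ℤ)) = (q ^ N)⁻¹ := by rw [zpow_neg, zpow_natCast]
  have zN1 : q ^ (-((N + 1 : ℕ) : ℤ)) = (q ^ (N + 1))⁻¹ := by rw [zpow_neg, zpow_natCast]
  have hLg : QGeneric q L := sh 1 (by rw [hL, zpow_one]; ring) hAABCD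
  have hLF : QGeneric q (L / F) :=
    shi (-((N + 1 : ℕ) : ℤ)) (by rw [zN1, hL, hGe]; field_simp; ring) hAEG
  have hLG : QGeneric q (L / G) :=
    shi (-((N + 1 : ℕ) : ℤ)) (by rw [zN1, hL, hGe]; field_simp; ring) hAEF
  have first := bailey_transformation (L := L) (E := F) (F := G) (G := E) (N := N) hq0 hq hA0 hB0
    hC0 hD0 hF0 hG0 hL0 (by rw [hL]; field_simp)
    (by rw [hL, hGe]; field_simp; ring)
    hA hLg (shi (-1) (by rw [hL, zpow_neg, zpow_one]; field_simp) hABCD) hB hC hD hAB hAC hAD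
    hAF hAG hLF hLG hAFG
    (shi (-((N + 1 : ℕ) : ℤ)) (by rw [zN1, hL, hGe]; field_simp; ring) hAE)
  -- The second application rescales the triple L B / A, F, G and keeps L C / A, L D / A, E.
  have second := bailey_transformation (A := L) (L := M) (B := L * B / A) (C := F) (D := G)
    (E := L * C / A) (F := L * D / A) (G := E) (N := N) hq0 hq hL0
    (div_ne_zero (mul_ne_zero hL0 hB0) hA0) hF0 hG0 (div_ne_zero (mul_ne_zero hL0 hC0) hA0)
    (div_ne_zero (mul_ne_zero hL0 hD0) hA0) hM0
    (by rw [hL, hM, hGe]; field_simp; ring) (by rw [hL, hM]; field_simp; ring)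
    hLg (shi (-(N : ℤ)) (by rw [zN, hM]; field_simp) hBE)
    (shi (-1) (by rw [hL, hM, hGe, zpow_neg, zpow_one]; field_simp; ring) hABFG)
    (sh 1 (by rw [hL, zpow_one]; field_simp) hACD) hF hG
    (sh 0 (by rw [zpow_zero]; field_simp) hAB) hLF hLG
    (sh 0 (by rw [zpow_zero]; field_simp) hAC) (sh 0 (by rw [zpow_zero]; field_simp) hAD)
    (shi (-((N + 1 : ℕ) : ℤ)) (by rw [zN1, hL, hM]; field_simp; ring) hADE)
    (shi (-((N + 1 : ℕ) : ℤ)) (by rw [zN1, hL, hM]; field_simp; ring) hACE)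
    (sh (-1) (by rw [hL, zpow_neg, zpow_one]; field_simp) hB)
    (sh 0 (by rw [zpow_zero, hL, hM, hGe]; field_simp; ring) hAFG)
  have perm1 : ∀ k, vwpTerm q A [B, C, D, E, F, G, (q ^ N)⁻¹] k =
      vwpTerm q A [B, C, D, F, G, E, (q ^ N)⁻¹] k := fun k => vwpTerm_perm (by
    refine .cons _ (.cons _ (.cons _ ?_))
    exact (List.perm_append_comm (l₁ := [E]) (l₂ := [F, G])).append_right [(q ^ N)⁻¹]) k
  have perm2 : ∀ k, vwpTerm q L [L * B / A, L * C / A, L * D / A, F, G, E, (q ^ N)⁻¹] k =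
      vwpTerm q L [L * B / A, F, G, L * C / A, L * D / A, E, (q ^ N)⁻¹] k := fun k =>
    vwpTerm_perm (.cons _ ((List.perm_append_comm (l₁ := [L * C / A, L * D / A])
      (l₂ := [F, G])).append_right [E, (q ^ N)⁻¹])) k
  have m1 : M * (L * B / A) / L = E * (q ^ N)⁻¹ / A := by rw [hM]; field_simp
  have m2 : M * F / L = A * q / (B * G) := by rw [hM, hL, hGe]; field_simp; ring
  have m3 : M * G / L = A * q / (B * F) := by rw [hM, hL, hGe]; field_simp; ring
  have m4 : L * C / A = A * q / (B * D) := by rw [hL]; field_simp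
  have m5 : L * D / A = A * q / (B * C) := by rw [hL]; field_simp
  have perm3 : ∀ k, vwpTerm q M [E * (q ^ N)⁻¹ / A, A * q / (B * G), A * q / (B * F),
      A * q / (B * D), A * q / (B * C), E, (q ^ N)⁻¹] k =
      vwpTerm q M [E, E * (q ^ N)⁻¹ / A, A * q / (B * C), A * q / (B * D),
          A * q / (B * F), A * q / (B * G), (q ^ N)⁻¹] k := fun k => vwpTerm_perm (by
    refine List.Perm.append_right [(q ^ N)⁻¹] (l₁ := [_, _, _, _, _, _])
      (l₂ := [_, _, _, _, _, _]) ?_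
    refine (List.perm_append_comm (l₁ := [_, _, _, _, _]) (l₂ := [_])).trans ?_
    exact .cons _ (.cons _ (List.reverse_perm [_, _, _, _]))) k
  rw [Finset.sum_congr rfl fun k _ => perm1 k, first, Finset.sum_congr rfl fun k _ => perm2 k,
    second, m1, m2, m3, ← hM]
  have m45 : ∀ k, vwpTerm q M [E * (q ^ N)⁻¹ / A, A * q / (B * G), A * q / (B * F),
      L * C / A, L * D / A, E, (q ^ N)⁻¹] k = vwpTerm q M [E, E * (q ^ N)⁻¹ / A, A * q / (B * C),
        A * q / (B * D), A * q / (B * F), A * q / (B * G), (q ^ N)⁻¹] k := fun k => by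
    rw [m4, m5, perm3]
  rw [Finset.sum_congr rfl fun k _ => m45 k, ← mul_assoc]
  congr 1
  obtain ⟨s, hs⟩ : ∃ s, s = ∏ j ∈ Finset.range N, -(q ^ (0 + j))⁻¹ := ⟨_, rfl⟩
  have hs2 : s ^ 2 * (q ^ N) ^ N = q ^ N := hs ▸ prod_neg_inv_pow_sq hq0 N
  have hs0 : s ≠ 0 := by
    rintro rfl
    exact pow_ne_zero N hq0 (by simpa using hs2.symm)
  -- Six factorials in the product of the two prefactors need reversal. Four stand in numerators and
  -- two in denominators, which leaves s².
  have reflect : ∀ z u : K, z ≠ 0 → u = q / (z * q ^ N) →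
      qShifted q u N = qShifted q z N * s / z ^ N := by
    intro z u hz hu
    have := qShifted_reflect hq0 hz 0 N
    rw [← hs, zero_add, pow_zero, mul_one, ← hu] at this
    rw [eq_div_iff (pow_ne_zero _ hz), this]
  have r1 := reflect (A * q / E) (L * q / (F * G)) (by simp [*])
    (by rw [hL, hGe]; field_simp; ring)
  have r2 := reflect (A * q / (E * G)) (L * q / F) (div_ne_zero (mul_ne_zero hA0 hq0) (mul_ne_zero hE0 hG0))
    (by rw [hL, hGe]; field_simp; ring)
  have r3 := reflect (A * q / (E * F)) (L * q / G) (by simp [*])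
    (by rw [hL, hGe]; field_simp; ring)
  have r4 := reflect (A * q / (D * E)) (M * q / (L * C / A)) (by simp [*])
    (by rw [hL, hM]; field_simp)
  have r5 := reflect (A * q / (C * E)) (M * q / (L * D / A)) (by simp [*])
    (by rw [hL, hM]; field_simp)
  have r6 := reflect (B / E) (M * q) (div_ne_zero hB0 hE0) (by rw [hM]; field_simp)
  have r7 : L * q / (L * C / A) = A * q / C := by field_simp
  have r8 : L * q / (L * D / A) = A * q / D := by field_simp
  have r9 : L * q / (L * C / A * (L * D / A)) = B := by rw [hL]; field_simp
  have r10 : M * q / (L * C / A * (L * D / A)) = A * q / (F * G) := by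
    rw [hL, hM, hGe]; field_simp; ring
  -- The N-th powers released by the reversals combine through the balancing condition.
  have hpow : (A * q / E) ^ N * (B / E) ^ N * q ^ N = E ^ N * (q ^ N) ^ N *
      ((A * q / (E * G)) ^ N * (A * q / (E * F)) ^ N * (A * q / (D * E)) ^ N *
        (A * q / (C * E)) ^ N) := by
    simp only [← mul_pow]
    congr 1
    rw [hGe]
    field_simp
    ring
  rw [baileyFactor, baileyFactor, iteratedFactor, r1, r2, r3, r4, r5, r6, r7, r8, r9, r10]
  have n1 := nz hAFG (v := A * q / (F * G)) (by ring) N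
  have n2 := nz hLg rfl N
  have n3 := hBE.qShifted_ne_zero N
  have n4 := nz hAC (v := A * q / C) (by ring) N
  have n5 := nz hAD (v := A * q / D) (by ring) N
  have n6 := nz hAE (v := A * q / E) (by ring) N
  have n7 := nz hAF (v := A * q / F) (by ring) N
  have n8 := nz hAG (v := A * q / G) (by ring) N
  have p1 : (A * q / E) ^ N ≠ 0 := pow_ne_zero _ (by simp [*])
  have p2 : (B / E) ^ N ≠ 0 := pow_ne_zero _ (div_ne_zero hB0 hE0)
  have p3 : (A * q / (E * G)) ^ N ≠ 0 := pow_ne_zero _ (div_ne_zero (mul_ne_zero hA0 hq0) (mul_ne_zero hE0 hG0))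
  have p4 : (A * q / (E * F)) ^ N ≠ 0 := pow_ne_zero _ (by simp [*])
  have p5 : (A * q / (D * E)) ^ N ≠ 0 := pow_ne_zero _ (by simp [*])
  have p6 : (A * q / (C * E)) ^ N ≠ 0 := pow_ne_zero _ (by simp [*])
  have p7 : (q ^ N) ^ N ≠ 0 := pow_ne_zero _ (pow_ne_zero _ hq0)
  have p8 : q ^ N ≠ 0 := pow_ne_zero _ hq0
  clear r1 r2 r3 r4 r5 r6 r7 r8 r9 r10 m1 m2 m3 m4 m5 m45 perm1 perm2 perm3 first second reflect
    hGe hbal zN zN1 hL hM nz sh shi hs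
  generalize (q ^ N) ^ N = u0 at *
  generalize (A * q / E) ^ N = u1 at *
  generalize (B / E) ^ N = u2 at *
  generalize (A * q / (E * G)) ^ N = u3 at *
  generalize (A * q / (E * F)) ^ N = u4 at *
  generalize (A * q / (D * E)) ^ N = u5 at *
  generalize (A * q / (C * E)) ^ N = u6 at *
  generalize q ^ N = u7 at *
  generalize E ^ N = u8 at *
  generalize qShifted q (A * q) N = y1 at *
  generalize qShifted q (A * q / (F * G)) N = y2 at *
  generalize qShifted q (L * q) N = y3 at *
  generalize qShifted q (B / E) N = y4 at *
  generalize qShifted q (A * q / C) N = y5 at *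
  generalize qShifted q (A * q / D) N = y6 at *
  generalize qShifted q (A * q / E) N = y7 at *
  generalize qShifted q (A * q / F) N = y8 at *
  generalize qShifted q (A * q / G) N = y9 at *
  generalize qShifted q (A * q / (E * G)) N = y10 at *
  generalize qShifted q (A * q / (E * F)) N = y11 at *
  generalize qShifted q (A * q / (D * E)) N = y12 at *
  generalize qShifted q (A * q / (C * E)) N = y13 at *
  generalize qShifted q B N = y14 at *
  have hfin : s ^ 2 * u1 * u2 = u8 * (u3 * u4 * u5 * u6) := by
    refine mul_right_cancel₀ p7 ?_
    linear_combination u1 * u2 * hs2 + hpow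
  field_simp
  linear_combination (y1 * y10 * y11 * y14 * y12 * y13) * hfin

end Iterated

/-! ### A Vandermonde determinant in a mixed product basis. -/

section Determinant

open Matrix Polynomial

variable {R : Type*} [CommRing R]

/-- The product `∏ (X - q_u) ∏ (X - p_t)` over `u < s` and `t < n - s`. -/
noncomputable def mixedProduct (p q : ℕ → R) (n s : ℕ) : R[X] :=
  (∏ u ∈ Finset.range s, (X - C (q u))) * ∏ t ∈ Finset.range (n - s), (X - C (p t))

theorem mixedProduct_monic (p q : ℕ → R) (n s : ℕ) : (mixedProduct p q n s).Monic :=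
  (monic_prod_of_monic _ _ fun _ _ => monic_X_sub_C _).mul
    (monic_prod_of_monic _ _ fun _ _ => monic_X_sub_C _)

theorem mixedProduct_natDegree [Nontrivial R] (p q : ℕ → R) {n s : ℕ} (h : s ≤ n) :
    (mixedProduct p q n s).natDegree = n := by
  rw [mixedProduct, Monic.natDegree_mul (monic_prod_of_monic _ _ fun _ _ => monic_X_sub_C _)
    (monic_prod_of_monic _ _ fun _ _ => monic_X_sub_C _),
    natDegree_prod_of_monic _ _ fun _ _ => monic_X_sub_C _,
    natDegree_prod_of_monic _ _ fun _ _ => monic_X_sub_C _]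
  simp [h]

/-- The two products of degree n + 1 differ in a single linear factor, X - q_s against X - p_(n-s).
-/
theorem mixedProduct_succ_sub (p q : ℕ → R) {n s : ℕ} (h : s ≤ n) :
    mixedProduct p q (n + 1) (s + 1) = mixedProduct p q (n + 1) s -
      C (q s - p (n - s)) * mixedProduct p q n s := by
  have e1 : n + 1 - (s + 1) = n - s := by omega
  have e2 : n + 1 - s = (n - s) + 1 := by omega
  rw [mixedProduct, mixedProduct, mixedProduct, e1, e2, Finset.prod_range_succ,
    Finset.prod_range_succ _ (n - s), C_sub]
  ring

/-- Subtracting from each column its predecessor leaves multiples of the products of degree n, by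
`mixedProduct_succ_sub`. The row of top coefficients then has the single nonzero entry 1, in column
0, and expansion along it gives a recursion. The n + 1 minus signs match the sign of the cofactor.
-/
theorem det_coeff_mixedProduct [Nontrivial R] (p q : ℕ → R) (n : ℕ) :
    (Matrix.of fun i j : Fin (n + 1) => (mixedProduct p q n j).coeff i).det =
      ∏ m ∈ Finset.range n, ∏ u ∈ Finset.range (m + 1), (q u - p (m - u)) := by
  induction n with
  | zero => simp [mixedProduct]
  | succ n ih =>
    have hdet : (Matrix.of fun i j : Fin (n + 2) => (mixedProduct p q (n + 1) j).coeff i).det =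
        (Matrix.of fun i j : Fin (n + 2) =>
          (Fin.cases (mixedProduct p q (n + 1) 0)
            (fun s : Fin (n + 1) => -(C (q s - p (n - s)) * mixedProduct p q n s)) j :
              R[X]).coeff i).det := by
      refine Matrix.det_eq_of_forall_col_eq_smul_add_pred (fun _ => 1) (fun i => by simp) ?_
      intro i j
      have := mixedProduct_succ_sub p q (n := n) (s := j) (by omega)
      simp [this]
      ring
    rw [hdet, Matrix.det_succ_row _ (Fin.last (n + 1)), Fin.sum_univ_succ]
    have hlast : ∀ s : Fin (n + 1), (mixedProduct p q n s).coeff (n + 1) = 0 := fun s =>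
      coeff_eq_zero_of_natDegree_lt (by
        rw [mixedProduct_natDegree p q (Nat.lt_succ_iff.1 s.2)]; exact n.lt_succ_self)
    have htop : (mixedProduct p q (n + 1) 0).coeff (n + 1) = 1 := by
      have h1 := mixedProduct_monic p q (n + 1) 0
      rwa [Monic, leadingCoeff, mixedProduct_natDegree p q (Nat.zero_le _)] at h1
    have hsub : (Matrix.of fun i j : Fin (n + 1) => (-(q j - p (n - j))) *
        (mixedProduct p q n j).coeff i).det =
        (∏ j : Fin (n + 1), -(q j - p (n - j))) *
          ∏ m ∈ Finset.range n, ∏ u ∈ Finset.range (m + 1), (q u - p (m - u)) := by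
      rw [← ih]
      exact Matrix.det_mul_row _ _
    have hmat : (Matrix.of fun i j : Fin (n + 2) =>
          (Fin.cases (mixedProduct p q (n + 1) 0)
            (fun s : Fin (n + 1) => -(C (q s - p (n - s)) * mixedProduct p q n s)) j :
              R[X]).coeff i).submatrix (Fin.last (n + 1)).succAbove (Fin.succAbove 0) =
        Matrix.of fun i j : Fin (n + 1) => (-(q j - p (n - j))) *
          (mixedProduct p q n j).coeff i := by
      ext i j
      simp [-map_sub]
      ring
    rw [hmat, hsub, Finset.sum_eq_zero fun s _ => by simp [-map_sub, hlast]]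
    simp only [Matrix.of_apply, Fin.cases_zero, Fin.val_last, htop, Fin.val_zero, add_zero,
      Finset.prod_neg, Finset.card_univ, Fintype.card_fin]
    rw [Finset.prod_range_succ, Fin.prod_univ_eq_prod_range (fun j => q j - p (n - j)) (n + 1)]
    rw [mul_one, ← mul_assoc, ← mul_assoc, ← mul_pow]
    simp [mul_comm]

/-- The matrix of values is the Vandermonde matrix times the matrix of coefficients. -/
theorem det_eval_mixedProduct [Nontrivial R] (p q : ℕ → R) (n : ℕ) (ζ : Fin (n + 1) → R) :
    (Matrix.of fun i j : Fin (n + 1) => (mixedProduct p q n j).eval (ζ i)).det =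
      (∏ i, ∏ j ∈ Finset.Ioi i, (ζ j - ζ i)) *
        ∏ m ∈ Finset.range n, ∏ u ∈ Finset.range (m + 1), (q u - p (m - u)) := by
  rw [← Matrix.det_vandermonde, ← det_coeff_mixedProduct, ← Matrix.det_mul]
  congr 1
  ext i j
  rw [Matrix.of_apply, eval_eq_sum_range' (n := n + 1), Matrix.mul_apply,
    Finset.sum_range]
  · simp [Matrix.vandermonde, mul_comm]
  · rw [mixedProduct_natDegree p q (Nat.lt_succ_iff.1 j.2)]
    exact n.lt_succ_self

theorem eval_mixedProduct (p q : ℕ → R) (n s : ℕ) (ζ : R) :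
    (mixedProduct p q n s).eval ζ =
      (∏ u ∈ Finset.range s, (ζ - q u)) * ∏ t ∈ Finset.range (n - s), (ζ - p t) := by
  simp [mixedProduct, eval_prod]

/-- A determinant of sums is a multiple sum of determinants. -/
theorem sum_prod_mul_det {r : ℕ} (s : Finset ℕ) (w : Fin r → ℕ → R)
    (M : Fin r → ℕ → Fin r → R) :
    ∑ k ∈ Fintype.piFinset fun _ : Fin r => s,
        (∏ i, w i (k i)) * (Matrix.of fun i j => M i (k i) j).det =
      (Matrix.of fun i j => ∑ k ∈ s, w i k * M i k j).det := by
  simp only [← Matrix.det_transpose (Matrix.of _), Matrix.det_apply', Matrix.transpose_apply,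
    Matrix.of_apply, Finset.mul_sum]
  rw [Finset.sum_comm]
  refine Finset.sum_congr rfl fun σ _ => ?_
  rw [Finset.prod_univ_sum, Finset.mul_sum]
  refine Finset.sum_congr rfl fun k _ => ?_
  rw [Finset.prod_mul_distrib]
  ring

end Determinant

/-! ### Single series as determinant entries. -/

section Rows

open Polynomial

variable {K : Type*} [Field K]

/-- Each factor splits as y (1/y + a y - c q^t - a/(c q^t)) = (1 - c q^t y)(1 - a y/(c q^t)). The
second factors, read backwards, form a q-shifted factorial. -/
theorem pow_mul_prod_sub {q a c y : K} (hq : q ≠ 0) (hc : c ≠ 0) (hy : y ≠ 0) (m : ℕ) :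
    y ^ m * ∏ t ∈ Finset.range m, (1 / y + a * y - (c * q ^ t + a / (c * q ^ t))) =
      qShifted q (c * y) m * qShifted q (a * y * q / (c * q ^ m)) m := by
  have h : qShifted q (a * y * q / (c * q ^ m)) m =
      ∏ t ∈ Finset.range m, (1 - a * y / (c * q ^ t)) := by
    rw [qShifted, ← Finset.prod_range_reflect]
    refine Finset.prod_congr rfl fun j hj => ?_
    obtain ⟨i, rfl⟩ : ∃ i, m = j + 1 + i :=
      ⟨m - (j + 1), by have := Finset.mem_range.1 hj; omega⟩
    have : j + 1 + i - 1 - j = i := by omega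
    rw [this]
    field_simp
    ring
  rw [h, qShifted, ← Finset.prod_mul_distrib]
  conv_lhs => rw [← Finset.card_range m, ← Finset.prod_const, Finset.card_range,
    ← Finset.prod_mul_distrib]
  refine Finset.prod_congr rfl fun t _ => ?_
  field_simp
  ring

/-- Multiplying by a linear factor of `y = x q ^ k` shifts the parameter `c x` by a power of `q`. -/
theorem shift_parameter {q u v : K} (hq : q ≠ 0) {m k : ℕ}
    (h1 : qShifted q v k ≠ 0) (h2 : qShifted q (v / q ^ m) k ≠ 0) :
    qShifted q u k / qShifted q v k * (qShifted q (u * q ^ k) m * qShifted q (v * q ^ k / q ^ m) m) =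
      qShifted q u m * qShifted q (v / q ^ m) m *
        (qShifted q (u * q ^ m) k / qShifted q (v / q ^ m) k) := by
  have e1 := qShifted_mul_swap q u k m
  have e2 := qShifted_mul_swap q (v / q ^ m) k m
  rw [div_mul_cancel₀ _ (pow_ne_zero m hq), div_mul_eq_mul_div] at e2
  rw [div_mul_eq_mul_div, div_eq_iff h1, mul_div_assoc', div_mul_eq_mul_div, eq_div_iff h2]
  linear_combination qShifted q (v * q ^ k / q ^ m) m * qShifted q (v / q ^ m) k * e1 +
    qShifted q u m * qShifted q (u * q ^ m) k * e2

/-- For y = x q^k the linear factors built on b and on e are absorbed by `shift_parameter`, once for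
each of the two parameters. -/
theorem left_row {q a b e x : K} (hq : q ≠ 0) (hb : b ≠ 0) (he : e ≠ 0) (hx : x ≠ 0)
    (hab : QGeneric q (a * x / b)) (hae : QGeneric q (a * x / e)) (l : List K) (n s k : ℕ) :
    vwpTerm q (a * x ^ 2) (b * x :: e * x :: l) k * ((x * q ^ k) ^ s * (x * q ^ k) ^ (n - s) *
      (mixedProduct (fun t => b * q ^ t + a / (b * q ^ t)) (fun u => e * q ^ u + a / (e * q ^ u))
        n s).eval (1 / (x * q ^ k) + a * (x * q ^ k))) =
    qShifted q (b * x) (n - s) * qShifted q (a * x * q / (b * q ^ (n - s))) (n - s) *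
      (qShifted q (e * x) s * qShifted q (a * x * q / (e * q ^ s)) s) *
      vwpTerm q (a * x ^ 2) (b * x * q ^ (n - s) :: e * x * q ^ s :: l) k := by
  have hy : x * q ^ k ≠ 0 := mul_ne_zero hx (pow_ne_zero _ hq)
  have nz : ∀ {c : K}, QGeneric q (a * x / c) → qShifted q (a * x * q / c) k ≠ 0 := fun h =>
    (h.mul_zpow hq 1 (by rw [zpow_one]; ring)).qShifted_ne_zero k
  have nz' : ∀ {c : K} (m : ℕ), QGeneric q (a * x / c) →
      qShifted q (a * x * q / c / q ^ m) k ≠ 0 := fun m h =>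
    (h.mul_zpow hq (1 - m) (by
      rw [zpow_sub₀ hq, zpow_one, zpow_natCast]; ring)).qShifted_ne_zero k
  have e1 : ∀ c m, c ≠ 0 → a * (x * q ^ k) * q / (c * q ^ m) = a * x * q / c * q ^ k / q ^ m := by
    intro c m _; field_simp
  have e2 : ∀ c m, a * x * q / (c * q ^ m) = a * x * q / c / q ^ m := by
    intro c m; rw [div_div]
  have e3 : ∀ c, c ≠ 0 → a * x ^ 2 * q / (c * x) = a * x * q / c := by
    intro c _; field_simp
  have e4 : ∀ c m, c ≠ 0 → a * x ^ 2 * q / (c * x * q ^ m) = a * x * q / c / q ^ m := by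
    intro c m _; field_simp
  have A := pow_mul_prod_sub (a := a) hq he hy s
  have B := pow_mul_prod_sub (a := a) hq hb hy (n - s)
  rw [e1 _ _ he, ← mul_assoc e x] at A
  rw [e1 _ _ hb, ← mul_assoc b x] at B
  have SE := shift_parameter (u := e * x) (m := s) hq (nz hae) (nz' s hae)
  have SB := shift_parameter (u := b * x) (m := n - s) hq (nz hab) (nz' (n - s) hab)
  rw [eval_mixedProduct, mul_mul_mul_comm, A, B, vwpTerm_eq, vwpTerm_eq]
  simp only [wellPoised_cons]
  rw [e3 b hb, e3 e he, e4 b _ hb, e4 e _ he, e2, e2]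
  generalize qShifted q (e * x) k / qShifted q (a * x * q / e) k = y1 at *
  generalize qShifted q (b * x) k / qShifted q (a * x * q / b) k = y2 at *
  generalize (1 - a * x ^ 2 * q ^ (2 * k)) / (1 - a * x ^ 2) *
    (qShifted q (a * x ^ 2) k / qShifted q q k) = y3 at *
  calc _ = y3 * wellPoised q (a * x ^ 2) l k * q ^ k *
      (y1 * (qShifted q (e * x * q ^ k) s * qShifted q (a * x * q / e * q ^ k / q ^ s) s)) *
      (y2 * (qShifted q (b * x * q ^ k) (n - s) *
        qShifted q (a * x * q / b * q ^ k / q ^ (n - s)) (n - s))) := by ring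
    _ = _ := by rw [SE, SB]; ring

/-- The factor relating the `s`-th column of the right-hand determinant to a single series. -/
def rightFactor (q μ : K) (l : List K) (M n s : ℕ) : K :=
  qShifted q (μ * q) (2 * s) * q ^ s * (qShifted q (q ^ M)⁻¹ (n - s) *
    qShifted q (μ * q * q ^ M / q ^ (n - s)) (n - s)) *
    wellPoised q μ (l ++ [(q ^ M)⁻¹ * q ^ (n - s)]) s

/-- The roots built on μ contribute (q^(k+1-s))_s, which vanishes for k < s. Those built on q^(-N-n)
turn this parameter into q^(-N-s), so the terms vanish for k > N + s. The index shift by s makes the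
window s ≤ k ≤ N + s the full range of a series of base μ q^(2s). -/
theorem right_row {q μ : K} (hq0 : q ≠ 0) (hq : ∀ n : ℕ, q ^ (n + 1) ≠ 1) (hμ0 : μ ≠ 0)
    (hμ : QGeneric q μ) (l : List K) {n s : ℕ} (hs : s ≤ n) (N : ℕ) :
    ∑ k ∈ Finset.range (N + n + 1), vwpTerm q μ (l ++ [(q ^ (N + n))⁻¹]) k *
      ((q ^ k) ^ s * (q ^ k) ^ (n - s) *
      (mixedProduct (fun t => (q ^ (N + n))⁻¹ * q ^ t + μ / ((q ^ (N + n))⁻¹ * q ^ t))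
        (fun u => μ * q ^ u + μ / (μ * q ^ u)) n s).eval (1 / q ^ k + μ * q ^ k)) =
    rightFactor q μ l (N + n) n s * ∑ k ∈ Finset.range (N + 1),
      vwpTerm q (μ * q ^ (2 * s)) (l.map (· * q ^ s) ++ [(q ^ N)⁻¹]) k := by
  obtain ⟨M, hM⟩ : ∃ M, M = N + n := ⟨_, rfl⟩
  have key : ∀ k, vwpTerm q μ (l ++ [(q ^ M)⁻¹]) k *
      ((q ^ k) ^ s * (q ^ k) ^ (n - s) *
      (mixedProduct (fun t => (q ^ M)⁻¹ * q ^ t + μ / ((q ^ M)⁻¹ * q ^ t))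
        (fun u => μ * q ^ u + μ / (μ * q ^ u)) n s).eval (1 / q ^ k + μ * q ^ k)) =
      (1 - μ * q ^ (2 * k)) / (1 - μ) * (qShifted q μ (k + s) *
        (qShifted q (q ^ k * q / q ^ s) s / qShifted q q k)) * q ^ k *
      (qShifted q (q ^ M)⁻¹ (n - s) * qShifted q (μ * q * q ^ M / q ^ (n - s)) (n - s)) *
      wellPoised q μ (l ++ [(q ^ M)⁻¹ * q ^ (n - s)]) k := by
    intro k
    have hy : q ^ k ≠ 0 := pow_ne_zero _ hq0
    have hi : (q ^ M)⁻¹ ≠ 0 := inv_ne_zero (pow_ne_zero _ hq0)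
    have A := pow_mul_prod_sub (a := μ) hq0 hμ0 hy s
    have B := pow_mul_prod_sub (a := μ) hq0 hi hy (n - s)
    have e1 : μ * q ^ k * q / (μ * q ^ s) = q ^ k * q / q ^ s := by field_simp
    have e2 : μ * q ^ k * q / ((q ^ M)⁻¹ * q ^ (n - s)) =
      μ * q * q ^ M * q ^ k / q ^ (n - s) := by field_simp
    have e3 : μ * q / (q ^ M)⁻¹ = μ * q * q ^ M := by field_simp
    have e4 : μ * q / ((q ^ M)⁻¹ * q ^ (n - s)) = μ * q * q ^ M / q ^ (n - s) := by field_simp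
    have S := shift_parameter (u := (q ^ M)⁻¹) (v := μ * q * q ^ M) (m := n - s) (k := k) hq0
      ((hμ.mul_zpow hq0 (1 + M) (by
        rw [zpow_add₀ hq0, zpow_one, zpow_natCast]; ring)).qShifted_ne_zero k)
      ((hμ.mul_zpow hq0 (1 + M - (n - s : ℕ)) (by
        rw [zpow_sub₀ hq0, zpow_add₀ hq0, zpow_one, zpow_natCast, zpow_natCast]
        ring)).qShifted_ne_zero k)
    rw [e1] at A
    rw [e2] at B
    rw [eval_mixedProduct, mul_mul_mul_comm, A, B, vwpTerm_eq]
    simp only [wellPoised_append, wellPoised_cons, wellPoised_nil, mul_one, e3, e4]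
    rw [qShifted_add]
    calc _ = (1 - μ * q ^ (2 * k)) / (1 - μ) * (qShifted q μ k * qShifted q (μ * q ^ k) s *
          (qShifted q (q ^ k * q / q ^ s) s / qShifted q q k)) * wellPoised q μ l k * q ^ k *
          (qShifted q (q ^ M)⁻¹ k / qShifted q (μ * q * q ^ M) k *
            (qShifted q ((q ^ M)⁻¹ * q ^ k) (n - s) *
              qShifted q (μ * q * q ^ M * q ^ k / q ^ (n - s)) (n - s))) := by ring
      _ = _ := by rw [S]; ring
  have hqn := QGeneric.qShifted_self_ne_zero hq
  have hlow : ∀ k, k < s → qShifted q (q ^ k * q / q ^ s) s = 0 := by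
    intro k hk
    refine Finset.prod_eq_zero (i := s - 1 - k) (Finset.mem_range.2 (by omega)) ?_
    have : q ^ s = q ^ k * q * q ^ (s - 1 - k) := by
      rw [← pow_succ, ← pow_add]; congr 1; omega
    rw [this]
    field_simp
    ring
  have hhigh : ∀ k, vwpTerm q μ (l ++ [(q ^ M)⁻¹]) (s + k) *
      ((q ^ (s + k)) ^ s * (q ^ (s + k)) ^ (n - s) *
      (mixedProduct (fun t => (q ^ M)⁻¹ * q ^ t + μ / ((q ^ M)⁻¹ * q ^ t))
        (fun u => μ * q ^ u + μ / (μ * q ^ u)) n s).eval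
          (1 / q ^ (s + k) + μ * q ^ (s + k))) = rightFactor q μ l M n s *
        vwpTerm q (μ * q ^ (2 * s)) (l.map (· * q ^ s) ++ [(q ^ N)⁻¹]) k := by
    intro k
    have e1 : q ^ (s + k) * q / q ^ s = q * q ^ k := by rw [pow_add]; field_simp
    have e2 : qShifted q q (s + k) = qShifted q q k * qShifted q (q * q ^ k) s := by
      rw [add_comm, qShifted_add]
    have e3 : qShifted q (q * q ^ k) s ≠ 0 := fun h => hqn (s + k) (by rw [e2, h, mul_zero])
    have e4 : qShifted q μ (s + k + s) = (1 - μ) * qShifted q (μ * q) (2 * s) /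
        (1 - μ * q ^ (2 * s)) * qShifted q (μ * q ^ (2 * s)) k := by
      rw [← qShifted_succ', qShifted_succ, mul_div_assoc,
        div_self (hμ.one_sub_mul_pow_ne_zero _), mul_one, ← qShifted_add]
      congr 1; ring
    have e5 : (q ^ M)⁻¹ * q ^ (n - s) * q ^ s = (q ^ N)⁻¹ := by
      rw [mul_assoc, ← pow_add, Nat.sub_add_cancel hs, hM, pow_add]
      field_simp
    rw [key, e1, e2, e4, rightFactor, vwpTerm_eq, wellPoised_add hq0, List.map_append,
      List.map_cons, List.map_nil, e5]
    have n1 := hμ.one_sub_ne_zero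
    have n2 := hμ.one_sub_mul_pow_ne_zero (2 * s)
    have n3 := hqn k
    have e6 : μ * q ^ (2 * (s + k)) = μ * q ^ (2 * s) * q ^ (2 * k) := by ring
    rw [e6]
    generalize qShifted q (q * q ^ k) s = y1 at *
    generalize qShifted q q k = y2 at *
    generalize 1 - μ * q ^ (2 * s) * q ^ (2 * k) = y3 at *
    generalize 1 - μ * q ^ (2 * s) = y4 at *
    generalize 1 - μ = y5 at *
    rw [pow_add]
    field_simp
  -- The s indices below the window, its N + 1 indices, and the n - s indices past termination.
  have hsplit : N + n + 1 = s + (N + 1 + (n - s)) := by omega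
  have hend : ∀ k, N < k →
      vwpTerm q (μ * q ^ (2 * s)) (l.map (· * q ^ s) ++ [(q ^ N)⁻¹]) k = 0 := by
    intro k hk
    rw [vwpTerm_eq, wellPoised_append, wellPoised_cons, qShifted_inv_pow_eq_zero hq0 hk]
    simp
  rw [← hM] at hsplit ⊢
  rw [hsplit, Finset.sum_range_add, Finset.sum_eq_zero fun k hk => by
      rw [key, hlow k (Finset.mem_range.1 hk)]; simp, zero_add,
    Finset.sum_congr rfl fun k _ => hhigh k, ← Finset.mul_sum, Finset.sum_range_add]
  congr 1
  rw [Finset.sum_eq_zero (s := Finset.range (n - s)) fun k _ => hend _ (by omega), add_zero]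

end Rows

/-! ### Separating the row and column factors. -/

section Entries

variable {K : Type*} [Field K]

/-- The power of `q`, with sign, that arises when `(z q ^ m; q)_k` is reversed. -/
def reflSign (q : K) (m k : ℕ) : K := ∏ j ∈ Finset.range k, -(q ^ (m + j))⁻¹

theorem reflSign_ne_zero {q : K} (hq : q ≠ 0) (m k : ℕ) : reflSign q m k ≠ 0 :=
  Finset.prod_ne_zero_iff.2 fun _ _ => neg_ne_zero.2 (inv_ne_zero (pow_ne_zero _ hq))

theorem qShifted_eq_reflect {q z u : K} (hq : q ≠ 0) (hz : z ≠ 0) {m k : ℕ}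
    (hu : u * (z * q ^ (m + k)) = q) :
    qShifted q u k = qShifted q (z * q ^ m) k * reflSign q m k / z ^ k := by
  rw [eq_div_iff (pow_ne_zero _ hz), reflSign, ← qShifted_reflect hq hz]
  congr 2
  rw [eq_div_iff (mul_ne_zero hz (pow_ne_zero _ hq)), hu]

/-- The factor of the `i`-th row, depending on `x = x_i` only. -/
def rowFactor (q a b c d e f g x : K) (N n : ℕ) : K :=
  (e * x) ^ N * qShifted q (a * x ^ 2 * q) N * qShifted q (b * x) (N + n) *
      qShifted q (a * x * q / (b * q ^ n)) n /
    (qShifted q (a * x * q / c) N * qShifted q (a * x * q / d) N * qShifted q (a * x * q / e) N *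
      qShifted q (a * x * q / f) N * qShifted q (a * x * q / g) N)

/-- The part of `rightFactor` that depends on neither the row nor the parameters `c, d, f, g`. -/
def columnBase (q μ : K) (M n s : ℕ) : K :=
  qShifted q (μ * q) (2 * s) * q ^ s * (qShifted q (q ^ M)⁻¹ (n - s) *
    qShifted q (μ * q * q ^ M / q ^ (n - s)) (n - s)) *
    (qShifted q ((q ^ M)⁻¹ * q ^ (n - s)) s /
      qShifted q (μ * q / ((q ^ M)⁻¹ * q ^ (n - s))) s)

/-- The factor of the `s`-th column, apart from `columnBase`. -/
def columnFactor (q a b c d e f g : K) (N n s : ℕ) : K :=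
  (q ^ s) ^ N * reflSign q (N + (n - s)) s * reflSign q N s ^ 3 *
    ((a * q / (b * e * q ^ s)) ^ s / ((a * q / (c * e * q ^ s)) ^ s *
      (a * q / (d * e * q ^ s)) ^ s * (a * q / (e * f * q ^ s)) ^ s *
      (a * q / (e * g * q ^ s)) ^ s)) *
    (qShifted q (a * q / (c * e * q ^ s)) (N + s) * qShifted q (a * q / (d * e * q ^ s)) (N + s) *
      qShifted q (a * q / (e * f * q ^ s)) (N + s) *
      qShifted q (a * q / (e * g * q ^ s)) (N + s) /
    (qShifted q (a * q / (b * c * q ^ n)) s * qShifted q (a * q / (b * d * q ^ n)) s *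
      qShifted q (a * q / (b * f * q ^ n)) s * qShifted q (a * q / (b * g * q ^ n)) s)) /
    qShifted q (b * q ^ (n - s) / (e * q ^ s)) N

set_option maxHeartbeats 2000000 in
-- The determinants can be compared only if the prefactor of the (x, s) entry is a function of x
-- times a function of s. Factors that mix x and s are split, swapped or reversed until they cancel.
-- `columnBase` stays on the left as a multiplier, so that nothing need be divided by it here.
theorem entry_factor {q a b c d e f g x μ : K} (hq0 : q ≠ 0)
    (ha : a ≠ 0) (hb : b ≠ 0) (hc : c ≠ 0) (hd : d ≠ 0) (he : e ≠ 0) (hf : f ≠ 0) (hg : g ≠ 0)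
    (hx : x ≠ 0) {N n s : ℕ} (hs : s ≤ n) (hμ : μ = e / (b * q ^ (N + n)))
    (gbx : QGeneric q (b * x)) (gxb : QGeneric q (a * x / b)) (gxc : QGeneric q (a * x / c))
    (gxd : QGeneric q (a * x / d)) (gxe : QGeneric q (a * x / e)) (gxf : QGeneric q (a * x / f))
    (gxg : QGeneric q (a * x / g)) (gce : QGeneric q (a / (c * e)))
    (gde : QGeneric q (a / (d * e))) (gef : QGeneric q (a / (e * f)))
    (geg : QGeneric q (a / (e * g))) (gbc : QGeneric q (a / (b * c)))
    (gbd : QGeneric q (a / (b * d))) (gbf : QGeneric q (a / (b * f)))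
    (gbg : QGeneric q (a / (b * g))) (gex : QGeneric q (e * x)) :
    qShifted q (b * x) (n - s) * qShifted q (a * x * q / (b * q ^ (n - s))) (n - s) *
      (qShifted q (e * x) s * qShifted q (a * x * q / (e * q ^ s)) s) *
      iteratedFactor q (a * x ^ 2) (b * x * q ^ (n - s)) (c * x) (d * x) (e * x * q ^ s) (f * x)
        (g * x) N * columnBase q μ (N + n) n s =
    rowFactor q a b c d e f g x N n * columnFactor q a b c d e f g N n s *
      rightFactor q μ [e * x, e / (a * x * q ^ N), a * q / (b * c * q ^ n),
        a * q / (b * d * q ^ n), a * q / (b * f * q ^ n), a * q / (b * g * q ^ n)] (N + n) n s := by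
  obtain ⟨j, rfl⟩ : ∃ j, n = j + s := ⟨n - s, by omega⟩
  have sub : j + s - s = j := by omega
  have nz : ∀ {u v : K}, QGeneric q u → ∀ i : ℕ, v * q ^ i = u * q → ∀ k, qShifted q v k ≠ 0 :=
    fun {u v} h i hv k => (h.mul_zpow hq0 (1 - (i : ℤ)) (by
      rw [zpow_sub₀ hq0, zpow_one, zpow_natCast, mul_div_assoc', ← hv,
        mul_div_cancel_right₀ _ (pow_ne_zero _ hq0)])).qShifted_ne_zero k
  have e1 : ∀ c, c ≠ 0 → a * x ^ 2 * q / (c * x) = a * x * q / c := fun c _ => by field_simp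
  have e2 : ∀ c, c ≠ 0 → a * x ^ 2 * q / (c * x * (e * x * q ^ s)) = a * q / (c * e * q ^ s) :=
    fun c _ => by field_simp
  have e3 : ∀ c, c ≠ 0 → a * x ^ 2 * q / (e * x * q ^ s * (c * x)) = a * q / (e * c * q ^ s) :=
    fun c _ => by field_simp
  have e4 : a * x ^ 2 * q / (e * x * q ^ s) = a * x * q / (e * q ^ s) := by field_simp
  have e5 : b * x * q ^ j / (e * x * q ^ s) = b * q ^ j / (e * q ^ s) := by field_simp
  have e6 : μ * q / (e / (a * x * q ^ N)) = a * x * q / (b * q ^ (j + s)) := by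
    rw [hμ]; field_simp; ring
  have h1 : qShifted q (μ * q / (e * x)) s =
      qShifted q (b * x * q ^ (N + j)) s * reflSign q (N + j) s / (b * x) ^ s := by
    refine qShifted_eq_reflect hq0 (mul_ne_zero hb hx) ?_
    rw [hμ]; field_simp; ring
  have h2 : qShifted q (b * x) (N + (j + s)) =
      qShifted q (b * x) j * qShifted q (b * x * q ^ j) N * qShifted q (b * x * q ^ (N + j)) s := by
    rw [← qShifted_add, add_comm j N, ← qShifted_add]
    congr 1; ring
  have h3 : qShifted q (a * x * q / (b * q ^ (j + s))) (j + s) =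
      qShifted q (a * x * q / (b * q ^ (j + s))) s * qShifted q (a * x * q / (b * q ^ j)) j := by
    rw [add_comm j s, qShifted_add]
    congr 2
    field_simp
    ring
  have h4 : qShifted q (e / (a * x * q ^ N)) s = qShifted q (a * x * q / (e * q ^ s) * q ^ N) s *
      reflSign q N s / (a * x * q / (e * q ^ s)) ^ s := by
    refine qShifted_eq_reflect hq0 (by simp [*]) ?_
    field_simp
    ring
  have h5 := qShifted_mul_swap q (a * x * q / (e * q ^ s)) s N
  rw [show a * x * q / (e * q ^ s) * q ^ s = a * x * q / e by field_simp] at h5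
  have h6 : ∀ c, c ≠ 0 → qShifted q (μ * q / (a * q / (b * c * q ^ (j + s)))) s =
      qShifted q (a * q / (c * e * q ^ s) * q ^ N) s * reflSign q N s /
        (a * q / (c * e * q ^ s)) ^ s := by
    intro c hc
    refine qShifted_eq_reflect hq0 (by simp [*]) ?_
    rw [hμ]; field_simp; ring
  have h7 : ∀ c, qShifted q (a * q / (c * e * q ^ s)) (N + s) =
      qShifted q (a * q / (c * e * q ^ s)) N * qShifted q (a * q / (c * e * q ^ s) * q ^ N) s :=
    fun c => qShifted_add ..
  have fc := h6 c hc
  have fd := h6 d hd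
  have ff := h6 f hf
  have fg := h6 g hg
  have tc := h7 c
  have td := h7 d
  have tf := h7 f
  have tg := h7 g
  rw [mul_comm f e] at ff tf
  rw [mul_comm g e] at fg tg
  have n1 := nz gxe 0 (v := a * x * q / e) (by rw [pow_zero]; ring) N
  have n2 := nz gxe s (v := a * x * q / (e * q ^ s)) (by field_simp) N
  have hz' : qShifted q (a * x * q / (e * q ^ s)) s = qShifted q (a * x * q / (e * q ^ s)) N *
      qShifted q (a * x * q / (e * q ^ s) * q ^ N) s / qShifted q (a * x * q / e) N := by
    rw [eq_div_iff n1, h5]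
  have sh : ∀ {u : K} (i k : ℕ), QGeneric q u → qShifted q (u * q ^ i) k ≠ 0 := fun i k h =>
    (h.mul_zpow hq0 (i : ℤ) (by rw [zpow_natCast])).qShifted_ne_zero k
  have gz : ∀ {u : K}, QGeneric q (a / u) → QGeneric q (a * q / (u * q ^ s)) := fun {u} h =>
    h.mul_zpow hq0 (1 - (s : ℤ)) (by
      rw [zpow_sub₀ hq0, zpow_one, zpow_natCast, div_mul_div_comm])
  have n3 := sh N s (gxe.mul_zpow hq0 (1 - (s : ℤ)) (v := a * x * q / (e * q ^ s)) (by
    rw [zpow_sub₀ hq0, zpow_one, zpow_natCast, div_mul_div_comm]))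
  have n4 := sh (N + j) s gbx
  have n5 := nz gxb (j + s) (v := a * x * q / (b * q ^ (j + s))) (by field_simp) s
  have n6 := gex.qShifted_ne_zero s
  have n7 := sh N s (gz gce)
  have n8 := sh N s (gz gde)
  have n9 := sh N s (gz gef)
  have n10 := sh N s (gz geg)
  have n11 := nz gbc (j + s) (v := a * q / (b * c * q ^ (j + s))) (by field_simp) s
  have n12 := nz gbd (j + s) (v := a * q / (b * d * q ^ (j + s))) (by field_simp) s
  have n13 := nz gbf (j + s) (v := a * q / (b * f * q ^ (j + s))) (by field_simp) s
  have n14 := nz gbg (j + s) (v := a * q / (b * g * q ^ (j + s))) (by field_simp) s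
  have n15 := nz gxc 0 (v := a * x * q / c) (by rw [pow_zero]; ring) N
  have n16 := nz gxd 0 (v := a * x * q / d) (by rw [pow_zero]; ring) N
  have n17 := nz gxf 0 (v := a * x * q / f) (by rw [pow_zero]; ring) N
  have n18 := nz gxg 0 (v := a * x * q / g) (by rw [pow_zero]; ring) N
  have p0 : ∀ {u : K}, u ≠ 0 → u ^ s ≠ 0 := fun h => pow_ne_zero s h
  have p1 := p0 (mul_ne_zero hb hx)
  have p2 := p0 (div_ne_zero (mul_ne_zero (mul_ne_zero ha hx) hq0)
    (mul_ne_zero he (pow_ne_zero s hq0)))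
  have pz : ∀ {u : K}, u ≠ 0 → (a * q / (u * q ^ s)) ^ s ≠ 0 := fun h =>
    p0 (div_ne_zero (mul_ne_zero ha hq0) (mul_ne_zero h (pow_ne_zero s hq0)))
  have p3 := pz (mul_ne_zero hc he)
  have p4 := pz (mul_ne_zero hd he)
  have p5 := pz (mul_ne_zero he hf)
  have p6 := pz (mul_ne_zero he hg)
  have p7 : (a * q / (b * e * q ^ s)) ^ s = (a * x * q / (e * q ^ s)) ^ s / (b * x) ^ s := by
    rw [← div_pow]
    congr 1
    field_simp
  have r1 := reflSign_ne_zero hq0 (N + j) s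
  have r2 := reflSign_ne_zero hq0 N s
  have p8 : (e * x * q ^ s) ^ N = (e * x) ^ N * (q ^ s) ^ N := mul_pow _ _ _
  rw [rowFactor, columnFactor, rightFactor, columnBase, iteratedFactor, sub, p7, p8, h2, h3, hz']
  simp only [List.cons_append, List.nil_append, wellPoised_cons, wellPoised_nil]
  rw [e1 c hc, e1 d hd, e1 f hf, e1 g hg, e2 c hc, e2 d hd, e3 f hf, e3 g hg, e4, e5, e6, h1, h4,
    fc, fd, ff, fg, tc, td, tf, tg]
  clear nz e1 e2 e3 e4 e5 e6 h1 h2 h3 h4 h5 h6 h7 fc fd ff fg tc td tf tg hz' sh gz p0 pz p7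
    p8
  generalize qShifted q (b * x) j = y1 at *
  generalize qShifted q (a * x * q / (b * q ^ j)) j = y2 at *
  generalize qShifted q (e * x) s = y3 at *
  generalize qShifted q (a * x * q / (e * q ^ s)) N = y4 at *
  generalize qShifted q (a * x * q / (e * q ^ s) * q ^ N) s = y5 at *
  generalize qShifted q (a * x * q / e) N = y6 at *
  generalize qShifted q (a * x ^ 2 * q) N = y7 at *
  generalize qShifted q (b * x * q ^ j) N = y8 at *
  generalize qShifted q (b * q ^ j / (e * q ^ s)) N = y9 at *
  generalize qShifted q (a * q / (c * e * q ^ s)) N = y10 at *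
  generalize qShifted q (a * q / (d * e * q ^ s)) N = y11 at *
  generalize qShifted q (a * q / (e * f * q ^ s)) N = y12 at *
  generalize qShifted q (a * q / (e * g * q ^ s)) N = y13 at *
  generalize qShifted q (a * q / (c * e * q ^ s) * q ^ N) s = y14 at *
  generalize qShifted q (a * q / (d * e * q ^ s) * q ^ N) s = y15 at *
  generalize qShifted q (a * q / (e * f * q ^ s) * q ^ N) s = y16 at *
  generalize qShifted q (a * q / (e * g * q ^ s) * q ^ N) s = y17 at *
  generalize qShifted q (a * x * q / c) N = y18 at *
  generalize qShifted q (a * x * q / d) N = y19 at *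
  generalize qShifted q (a * x * q / f) N = y20 at *
  generalize qShifted q (a * x * q / g) N = y21 at *
  generalize qShifted q (μ * q) (2 * s) = y22 at *
  generalize qShifted q (q ^ (N + (j + s)))⁻¹ j = y23 at *
  generalize qShifted q (μ * q * q ^ (N + (j + s)) / q ^ j) j = y24 at *
  generalize qShifted q ((q ^ (N + (j + s)))⁻¹ * q ^ j) s /
    qShifted q (μ * q / ((q ^ (N + (j + s)))⁻¹ * q ^ j)) s = y25 at *
  generalize qShifted q (a * x * q / (b * q ^ (j + s))) s = y26 at *
  generalize qShifted q (b * x * q ^ (N + j)) s = y27 at *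
  generalize qShifted q (a * q / (b * c * q ^ (j + s))) s = y28 at *
  generalize qShifted q (a * q / (b * d * q ^ (j + s))) s = y29 at *
  generalize qShifted q (a * q / (b * f * q ^ (j + s))) s = y30 at *
  generalize qShifted q (a * q / (b * g * q ^ (j + s))) s = y31 at *
  generalize reflSign q (N + j) s = s1 at *
  generalize reflSign q N s = s2 at *
  generalize (b * x) ^ s = u1 at *
  generalize (a * x * q / (e * q ^ s)) ^ s = u2 at *
  generalize (a * q / (c * e * q ^ s)) ^ s = u3 at *
  generalize (a * q / (d * e * q ^ s)) ^ s = u4 at *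
  generalize (a * q / (e * f * q ^ s)) ^ s = u5 at *
  generalize (a * q / (e * g * q ^ s)) ^ s = u6 at *
  generalize (e * x) ^ N = u7 at *
  generalize (q ^ s) ^ N = u8 at *
  -- The common pattern of c, d, f, g, each of which contributes 1 / s2. The four cancel against
  -- three sign factors in `columnFactor` and one from the parameter e / (a x q^N).
  have block : ∀ u v w z : K, u ≠ 0 → v ≠ 0 → w ≠ 0 → z * v / w * (w / (v * s2 / u)) / u = z / s2 := by
    intro u v w z hu hv hw
    field_simp
  have b1 := block u3 y14 y28 y10 p3 n7 n11
  have b2 := block u4 y15 y29 y11 p4 n8 n12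
  have b3 := block u5 y16 y30 y12 p5 n9 n13
  have b4 := block u6 y17 y31 y13 p6 n10 n14
  have b5 : u2 * y26 * (y5 * s2 / u2 / y26) = y5 * s2 := by field_simp
  have b6 : y27 * s1 / u1 * (y3 / (y27 * s1 / u1)) = y3 := by field_simp
  have b7 : y4 * y5 / y6 / y4 = y5 / y6 := by field_simp
  have b8 : s2 ^ 3 * s2 * (1 / s2) ^ 4 = 1 := by field_simp
  symm
  calc _ = u7 * y7 * y1 * y8 * y2 / (y18 * y19 * y6 * y20 * y21) * u8 / y9 *
        (y22 * q ^ s * (y23 * y24) * y25) * s2 ^ 3 * (y27 * s1 / u1 * (y3 / (y27 * s1 / u1))) *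
        (u2 * y26 * (y5 * s2 / u2 / y26)) * (y10 * y14 / y28 * (y28 / (y14 * s2 / u3)) / u3) *
        (y11 * y15 / y29 * (y29 / (y15 * s2 / u4)) / u4) *
        (y12 * y16 / y30 * (y30 / (y16 * s2 / u5)) / u5) *
        (y13 * y17 / y31 * (y31 / (y17 * s2 / u6)) / u6) := by ring
    _ = u7 * y7 * y1 * y8 * y2 / (y18 * y19 * y20 * y21) * u8 / y9 *
        (y22 * q ^ s * (y23 * y24) * y25) * y3 * (y5 / y6) * (y10 * y11 * y12 * y13) *
        (s2 ^ 3 * s2 * (1 / s2) ^ 4) := by rw [b1, b2, b3, b4, b5, b6]; ring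
    _ = _ := by rw [b8, ← b7]; ring

end Entries

/-! ### Multiple sums as determinants. -/

section Multiple

variable {K : Type*} [Field K]

/-- Each row of the homogeneous Vandermonde matrix in the pair (y ζ, y) has the common factor y^n.
-/
theorem prod_Ioi_homogeneous {n : ℕ} (y ζ : Fin (n + 1) → K) :
    ∏ i, ∏ j ∈ Finset.Ioi i, (y j * ζ j * y i - y i * ζ i * y j) =
      (∏ i, y i ^ n) * ∏ i, ∏ j ∈ Finset.Ioi i, (ζ j - ζ i) := by
  rw [← Matrix.det_projVandermonde, ← Matrix.det_vandermonde, ← Matrix.det_mul_column]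
  congr 1
  ext i j
  rw [Matrix.of_apply, Matrix.projVandermonde_apply, Matrix.vandermonde_apply, mul_pow,
    Fin.val_rev, mul_right_comm, ← pow_add]
  congr 2
  omega

/-- Uses (y_i - y_j)(1 - a y_i y_j) = y_i y_j (ζ_j - ζ_i) for ζ = 1/y + a y, and then multilinearity
in the rows. The power y^n is written y^s y^(n-s) to give each linear factor of column s its own y,
as `pow_mul_prod_sub` requires. -/
theorem sum_vandermonde_eq_det (p p' : ℕ → K) (n M : ℕ) (a : K)
    (w y : Fin (n + 1) → ℕ → K) (hy : ∀ i k, y i k ≠ 0) :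
    (∏ m ∈ Finset.range n, ∏ u ∈ Finset.range (m + 1), (p' u - p (m - u))) *
      ∑ k ∈ cube (n + 1) M, (∏ i, ∏ j ∈ Finset.Ioi i,
        ((y i (k i) - y j (k j)) * (1 - a * y i (k i) * y j (k j)))) * ∏ i, w i (k i) =
    (Matrix.of fun i s : Fin (n + 1) => ∑ k ∈ Finset.range (M + 1), w i k *
      (y i k ^ (s : ℕ) * y i k ^ (n - s) *
        (mixedProduct p p' n s).eval (1 / y i k + a * y i k))).det := by
  rw [cube, ← sum_prod_mul_det, Finset.mul_sum]
  refine Finset.sum_congr rfl fun k _ => ?_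
  have h1 : ∀ i j, (y i (k i) - y j (k j)) * (1 - a * y i (k i) * y j (k j)) =
      y j (k j) * (1 / y j (k j) + a * y j (k j)) * y i (k i) -
        y i (k i) * (1 / y i (k i) + a * y i (k i)) * y j (k j) := by
    intro i j
    have := hy i (k i)
    have := hy j (k j)
    field_simp
    ring
  simp only [h1]
  rw [prod_Ioi_homogeneous (fun i => y i (k i)) fun i => 1 / y i (k i) + a * y i (k i)]
  have h2 : (Matrix.of fun i s : Fin (n + 1) => y i (k i) ^ (s : ℕ) * y i (k i) ^ (n - s) *
      (mixedProduct p p' n s).eval (1 / y i (k i) + a * y i (k i))).det =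
      (∏ i, y i (k i) ^ n) * (Matrix.of fun i s : Fin (n + 1) =>
        (mixedProduct p p' n s).eval (1 / y i (k i) + a * y i (k i))).det := by
    rw [← Matrix.det_mul_column]
    congr 1
    ext i s
    rw [Matrix.of_apply, Matrix.of_apply, Matrix.of_apply, ← pow_add]
    congr 2
    omega
  rw [h2, det_eval_mixedProduct]
  ring

/-- The monomials in the parameters that must avoid the powers of `q` for the one-dimensional
transformations to make sense. -/
structure GenericParameters (q a b c d e f g x : K) : Prop where
  ax2 : QGeneric q (a * x ^ 2)
  abcdx : QGeneric q (a / (b * c * d * x))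
  a2xbcd : QGeneric q (a ^ 2 * x / (b * c * d))
  abfgx : QGeneric q (a / (b * f * g * x))
  acd : QGeneric q (a / (c * d))
  afg : QGeneric q (a / (f * g))
  bx : QGeneric q (b * x)
  cx : QGeneric q (c * x)
  dx : QGeneric q (d * x)
  ex : QGeneric q (e * x)
  fx : QGeneric q (f * x)
  gx : QGeneric q (g * x)
  axb : QGeneric q (a * x / b)
  axc : QGeneric q (a * x / c)
  axd : QGeneric q (a * x / d)
  axe : QGeneric q (a * x / e)
  axf : QGeneric q (a * x / f)
  axg : QGeneric q (a * x / g)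
  be : QGeneric q (b / e)
  abe : QGeneric q (a / (b * e))
  ace : QGeneric q (a / (c * e))
  ade : QGeneric q (a / (d * e))
  aef : QGeneric q (a / (e * f))
  aeg : QGeneric q (a / (e * g))
  abc : QGeneric q (a / (b * c))
  abd : QGeneric q (a / (b * d))
  abf : QGeneric q (a / (b * f))
  abg : QGeneric q (a / (b * g))

/-- The chain is `left_row`, then `bailey_transformation_iterated` with B = b x q^(n-s) and E = e x
q^s, then `right_row` backwards. One balancing condition serves every s because B E always contains
q^(n-s) q^s = q^n. -/
theorem column_transformation {q a b c d e f g x μ : K} (hq0 : q ≠ 0)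
    (hq : ∀ n : ℕ, q ^ (n + 1) ≠ 1)
    (ha : a ≠ 0) (hb : b ≠ 0) (hc : c ≠ 0) (hd : d ≠ 0) (he : e ≠ 0) (hf : f ≠ 0) (hg : g ≠ 0)
    (hx : x ≠ 0) {N n s : ℕ} (hs : s ≤ n) (hμ : μ = e / (b * q ^ (N + n)))
    (hbal : a ^ 3 * q ^ (N + 2) = b * c * d * e * f * g * q ^ n)
    (h : GenericParameters q a b c d e f g x) :
    (∑ k ∈ Finset.range (N + 1),
      vwpTerm q (a * x ^ 2) [b * x, e * x, c * x, d * x, f * x, g * x, (q ^ N)⁻¹] k *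
        ((x * q ^ k) ^ s * (x * q ^ k) ^ (n - s) *
        (mixedProduct (fun t => b * q ^ t + a / (b * q ^ t)) (fun u => e * q ^ u + a / (e * q ^ u))
          n s).eval (1 / (x * q ^ k) + a * (x * q ^ k)))) * columnBase q μ (N + n) n s =
    rowFactor q a b c d e f g x N n * columnFactor q a b c d e f g N n s *
      ∑ k ∈ Finset.range (N + n + 1),
        vwpTerm q μ [e * x, e / (a * x * q ^ N), a * q / (b * c * q ^ n),
          a * q / (b * d * q ^ n), a * q / (b * f * q ^ n), a * q / (b * g * q ^ n),
          (q ^ (N + n))⁻¹] k *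
        ((q ^ k) ^ s * (q ^ k) ^ (n - s) *
        (mixedProduct (fun t => (q ^ (N + n))⁻¹ * q ^ t + μ / ((q ^ (N + n))⁻¹ * q ^ t))
          (fun u => μ * q ^ u + μ / (μ * q ^ u)) n s).eval (1 / q ^ k + μ * q ^ k)) := by
  have hμ0 : μ ≠ 0 := by rw [hμ]; simp [*]
  have gμ : QGeneric q μ := h.be.inv_mul_zpow hq0 (-(N + n : ℕ)) (by
    rw [hμ, zpow_neg, zpow_natCast]; field_simp)
  have R := right_row hq0 hq hμ0 gμ [e * x, e / (a * x * q ^ N), a * q / (b * c * q ^ n),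
    a * q / (b * d * q ^ n), a * q / (b * f * q ^ n), a * q / (b * g * q ^ n)] hs N
  simp only [List.cons_append, List.nil_append, List.map_cons, List.map_nil] at R
  have sh : ∀ {u v : K} (i : ℤ), v = u * q ^ i → QGeneric q u → QGeneric q v := fun i hv hu =>
    hu.mul_zpow hq0 i hv
  rw [R, Finset.sum_congr rfl fun k _ => left_row hq0 hb he hx h.axb h.axe
    [c * x, d * x, f * x, g * x, (q ^ N)⁻¹] n s k, ← Finset.mul_sum]
  obtain ⟨j, hj⟩ : ∃ j, n - s = j := ⟨_, rfl⟩
  have hjs : n = j + s := by omega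
  have perm : ∀ k, vwpTerm q (a * x ^ 2) [b * x * q ^ j, e * x * q ^ s, c * x, d * x, f * x, g * x,
      (q ^ N)⁻¹] k = vwpTerm q (a * x ^ 2) [b * x * q ^ j, c * x, d * x, e * x * q ^ s, f * x,
        g * x, (q ^ N)⁻¹] k := fun k => vwpTerm_perm (.cons _
          ((List.perm_append_comm (l₁ := [e * x * q ^ s]) (l₂ := [c * x, d * x])).append_right
            [f * x, g * x, (q ^ N)⁻¹])) k
  have pj : q ^ (j : ℤ) = q ^ j := zpow_natCast _ _
  have pnj : q ^ (-(j : ℤ)) = (q ^ j)⁻¹ := by rw [zpow_neg, zpow_natCast]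
  have pns : q ^ (-(s : ℤ)) = (q ^ s)⁻¹ := by rw [zpow_neg, zpow_natCast]
  have pjs : q ^ ((j : ℤ) - s) = q ^ j / q ^ s := by
    rw [zpow_sub₀ hq0, zpow_natCast, zpow_natCast]
  have qj := pow_ne_zero j hq0
  have qs := pow_ne_zero s hq0
  have T := bailey_transformation_iterated (A := a * x ^ 2) (B := b * x * q ^ j) (C := c * x)
    (D := d * x) (E := e * x * q ^ s) (F := f * x) (G := g * x) (N := N) hq0 hq
    (by simp [*]) (by simp [*]) (by simp [*]) (by simp [*]) (by simp [*]) (by simp [*])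
    (by simp [*])
    (by rw [hjs] at hbal; linear_combination x ^ 6 * hbal)
    h.ax2 (sh (-j) (by rw [pnj]; field_simp) h.abcdx)
    (sh (-j) (by rw [pnj]; field_simp) h.a2xbcd)
    (sh (-j) (by rw [pnj]; field_simp) h.abfgx)
    (sh 0 (by rw [zpow_zero]; field_simp) h.acd)
    (sh 0 (by rw [zpow_zero]; field_simp) h.afg)
    (sh j (by rw [pj]) h.bx) h.cx h.dx h.fx h.gx
    (sh (-j) (by rw [pnj]; field_simp) h.axb)
    (sh 0 (by rw [zpow_zero]; field_simp) h.axc)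
    (sh 0 (by rw [zpow_zero]; field_simp) h.axd)
    (sh (-s) (by rw [pns]; field_simp) h.axe)
    (sh 0 (by rw [zpow_zero]; field_simp) h.axf)
    (sh 0 (by rw [zpow_zero]; field_simp) h.axg)
    (sh (j - s) (by rw [pjs]; field_simp) h.be)
    (sh (-s) (by rw [pns]; field_simp) h.ace)
    (sh (-s) (by rw [pns]; field_simp) h.ade)
    (sh (-s) (by rw [pns]; field_simp) h.aef)
    (sh (-s) (by rw [pns]; field_simp) h.aeg)
  have entry := entry_factor (N := N) hq0 ha hb hc hd he hf hg hx hs hμ h.bx h.axb h.axc h.axd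
    h.axe h.axf h.axg h.ace h.ade h.aef h.aeg h.abc h.abd h.abf h.abg h.ex
  have base : e * x * q ^ s * (q ^ N)⁻¹ / (b * x * q ^ j) = μ * q ^ (2 * s) := by
    rw [hμ, hjs]; field_simp; ring
  have l1 : e * x * q ^ s * (q ^ N)⁻¹ / (a * x ^ 2) = e / (a * x * q ^ N) * q ^ s := by
    field_simp
  have l2 : ∀ c, c ≠ 0 → a * x ^ 2 * q / (b * x * q ^ j * (c * x)) =
      a * q / (b * c * q ^ n) * q ^ s := by
    intro c hc; rw [hjs]; field_simp; ring
  rw [hj] at entry ⊢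
  rw [Finset.sum_congr rfl fun k _ => perm k, T, base, l1, l2 c hc, l2 d hd, l2 f hf, l2 g hg]
  generalize ∑ k ∈ Finset.range (N + 1), vwpTerm q (μ * q ^ (2 * s)) _ k = W
  linear_combination W * entry

/-- With the row and column factors pulled inside, the two determinants agree entry by entry, by
`column_transformation`. -/
theorem multiple_transformation {q a b c d e f g μ : K} {N n : ℕ} {x : Fin (n + 1) → K}
    (hq0 : q ≠ 0) (hq : ∀ n : ℕ, q ^ (n + 1) ≠ 1)
    (ha : a ≠ 0) (hb : b ≠ 0) (hc : c ≠ 0) (hd : d ≠ 0) (he : e ≠ 0) (hf : f ≠ 0) (hg : g ≠ 0)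
    (hx : ∀ i, x i ≠ 0) (hμ : μ = e / (b * q ^ (N + n)))
    (hbal : a ^ 3 * q ^ (N + 2) = b * c * d * e * f * g * q ^ n)
    (h : ∀ i, GenericParameters q a b c d e f g (x i)) :
    (∏ m ∈ Finset.range n, ∏ u ∈ Finset.range (m + 1),
      (e * q ^ u + a / (e * q ^ u) - (b * q ^ (m - u) + a / (b * q ^ (m - u))))) *
    (∑ k ∈ cube (n + 1) N, (∏ i, ∏ j ∈ Finset.Ioi i,
      ((x i * q ^ k i - x j * q ^ k j) * (1 - a * (x i * q ^ k i) * (x j * q ^ k j)))) *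
      ∏ i, vwpTerm q (a * x i ^ 2)
        [b * x i, e * x i, c * x i, d * x i, f * x i, g * x i, (q ^ N)⁻¹] (k i)) *
      ∏ s ∈ Finset.range (n + 1), columnBase q μ (N + n) n s =
    (∏ m ∈ Finset.range n, ∏ u ∈ Finset.range (m + 1),
      (μ * q ^ u + μ / (μ * q ^ u) -
        ((q ^ (N + n))⁻¹ * q ^ (m - u) + μ / ((q ^ (N + n))⁻¹ * q ^ (m - u))))) *
    (∑ k ∈ cube (n + 1) (N + n), (∏ i, ∏ j ∈ Finset.Ioi i,
      ((q ^ k i - q ^ k j) * (1 - μ * q ^ k i * q ^ k j))) *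
      ∏ i, vwpTerm q μ [e * x i, e / (a * x i * q ^ N), a * q / (b * c * q ^ n),
        a * q / (b * d * q ^ n), a * q / (b * f * q ^ n), a * q / (b * g * q ^ n),
        (q ^ (N + n))⁻¹] (k i)) *
      ((∏ i, rowFactor q a b c d e f g (x i) N n) *
        ∏ s ∈ Finset.range (n + 1), columnFactor q a b c d e f g N n s) := by
  rw [sum_vandermonde_eq_det (fun t => b * q ^ t + a / (b * q ^ t))
      (fun u => e * q ^ u + a / (e * q ^ u)) n N a _ (fun i k => x i * q ^ k)
      fun i k => mul_ne_zero (hx i) (pow_ne_zero _ hq0),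
    sum_vandermonde_eq_det (fun t => (q ^ (N + n))⁻¹ * q ^ t + μ / ((q ^ (N + n))⁻¹ * q ^ t))
      (fun u => μ * q ^ u + μ / (μ * q ^ u)) n (N + n) μ _ (fun _ k => q ^ k)
      fun _ k => pow_ne_zero _ hq0,
    Finset.prod_range, Finset.prod_range, mul_comm, ← Matrix.det_mul_row, mul_comm (Matrix.det _),
    mul_assoc, ← Matrix.det_mul_row, ← Matrix.det_mul_column]
  congr 1
  ext i s
  have col := column_transformation hq0 hq ha hb hc hd he hf hg (hx i)
    (Nat.lt_succ_iff.1 s.2) hμ hbal (h i)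
  simp only [Matrix.of_apply]
  linear_combination col

end Multiple

/-! ### Evaluation of the constant factor. -/

section Prefactor

variable {K : Type*} [Field K]

/-- The value m = n - (t + 1) occurs for the m + 1 choices s = n - m, …, n. -/
theorem prod_range_prod_range_sub {R : Type*} [CommMonoid R] (G : ℕ → R) (n : ℕ) :
    ∏ s ∈ Finset.range (n + 1), ∏ t ∈ Finset.range s, G (n - (t + 1)) =
      ∏ m ∈ Finset.range n, G m ^ (m + 1) := by
  induction n with
  | zero => simp
  | succ n ih =>
    rw [Finset.prod_range_succ', Finset.prod_range_zero, mul_one, Finset.prod_range_succ (fun m => G m ^ (m + 1)), ← ih]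
    have : ∀ s ∈ Finset.range (n + 1), ∏ t ∈ Finset.range (s + 1), G (n + 1 - (t + 1)) =
        (∏ t ∈ Finset.range s, G (n - (t + 1))) * G n := by
      intro s _
      rw [Finset.prod_range_succ']
      simp
    rw [Finset.prod_congr rfl this, Finset.prod_mul_distrib]
    simp

/-- `H m` occurs m + 1 times in the first product and n - m times in the second. -/
theorem prod_pow_mul_prod_prod {R : Type*} [CommMonoid R] (H : ℕ → R) (n : ℕ) :
    (∏ m ∈ Finset.range n, H m ^ (m + 1)) *
      ∏ s ∈ Finset.range (n + 1), ∏ t ∈ Finset.range s, H t =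
    (∏ m ∈ Finset.range n, H m) ^ (n + 1) := by
  induction n with
  | zero => simp
  | succ n ih =>
    rw [Finset.prod_range_succ _ (n + 1), Finset.prod_range_succ (fun m => H m ^ (m + 1)),
      mul_mul_mul_comm, ih, Finset.prod_range_succ, mul_pow, pow_succ _ (n + 1),
      pow_succ (H n) (n + 1)]
    ac_rfl

theorem choose_two_cast (n : ℕ) : 2 * (n.choose 2 : ℤ) = n * (n - 1) := by
  induction n with
  | zero => simp
  | succ n ih =>
    rw [Nat.choose_succ_succ' n 1, Nat.choose_one_right]
    push_cast
    linarith

theorem choose_three_cast (n : ℕ) : 3 * ((n + 1).choose 3 : ℤ) = (n + 1) * n.choose 2 := by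
  induction n with
  | zero => simp [Nat.choose]
  | succ n ih =>
    rw [Nat.choose_succ_succ' (n + 1) 2, Nat.choose_succ_succ' n 1, Nat.choose_one_right]
    push_cast
    linarith [choose_two_cast n]

theorem sum_range_cast (n : ℕ) : ∑ s ∈ Finset.range (n + 1), (s : ℤ) = (n + 1).choose 2 := by
  induction n with
  | zero => simp
  | succ n ih =>
    rw [Finset.sum_range_succ, ih, Nat.choose_succ_succ' (n + 1) 1, Nat.choose_one_right]
    push_cast
    ring

theorem sum_range_sq_cast (n : ℕ) :
    ∑ s ∈ Finset.range (n + 1), (s : ℤ) ^ 2 = 2 * (n + 1).choose 3 + (n + 1).choose 2 := by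
  induction n with
  | zero => simp [Nat.choose]
  | succ n ih =>
    rw [Finset.sum_range_succ, ih, Nat.choose_succ_succ' (n + 1) 2,
      Nat.choose_succ_succ' (n + 1) 1, Nat.choose_one_right]
    have c := choose_two_cast (n + 1)
    push_cast at c ⊢
    linear_combination -c

theorem reflSign_eq {q : K} (hq : q ≠ 0) (m k : ℕ) :
    reflSign q m k = (-1) ^ k * q ^ (-((m * k + k.choose 2 : ℕ) : ℤ)) := by
  induction k with
  | zero => simp [reflSign]
  | succ k ih =>
    have : reflSign q m (k + 1) = reflSign q m k * -(q ^ (m + k))⁻¹ := Finset.prod_range_succ ..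
    rw [this, ih, Nat.choose_succ_succ' k 1, Nat.choose_one_right, zpow_neg, zpow_natCast, zpow_neg,
      zpow_natCast]
    field_simp
    ring

/-- For m = u + v the factor built from a, b, e equals e q^u (1 - (b/e) q^(v-u)) (1 - a/(b e q^m)).
Replacing a and e by μ, and b by q^(-N-n), leaves the middle factor unchanged. Hence the quotient of
corresponding factors depends on m only. -/
theorem det_ratio {q a b e μ : K} (hq0 : q ≠ 0) (hb : b ≠ 0) (he : e ≠ 0)
    {N n : ℕ} (hμ : μ = e / (b * q ^ (N + n))) :
    (∏ m ∈ Finset.range n, ∏ u ∈ Finset.range (m + 1),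
      (μ * q ^ u + μ / (μ * q ^ u) -
        ((q ^ (N + n))⁻¹ * q ^ (m - u) + μ / ((q ^ (N + n))⁻¹ * q ^ (m - u))))) *
      ∏ s ∈ Finset.range (n + 1), qShifted q (a * q / (b * e * q ^ n)) s =
    (∏ m ∈ Finset.range n, ∏ u ∈ Finset.range (m + 1),
      (e * q ^ u + a / (e * q ^ u) - (b * q ^ (m - u) + a / (b * q ^ (m - u))))) *
      ((b * q ^ (N + n))⁻¹ ^ (n + 1).choose 2 *
        ∏ m ∈ Finset.range n, (1 - q ^ (N + n - m)) ^ (m + 1)) := by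
  have h1 : ∏ s ∈ Finset.range (n + 1), qShifted q (a * q / (b * e * q ^ n)) s =
      ∏ m ∈ Finset.range n, (1 - a / (b * e * q ^ m)) ^ (m + 1) := by
    rw [← prod_range_prod_range_sub (fun m => 1 - a / (b * e * q ^ m))]
    refine Finset.prod_congr rfl fun s hs => Finset.prod_congr rfl fun t ht => ?_
    have := Finset.mem_range.1 hs
    have := Finset.mem_range.1 ht
    obtain ⟨i, rfl⟩ : ∃ i, n = t + 1 + i := ⟨n - (t + 1), by omega⟩
    rw [Nat.add_sub_cancel_left]
    field_simp
    ring
  have h2 : (b * q ^ (N + n))⁻¹ ^ (n + 1).choose 2 =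
      ∏ m ∈ Finset.range n, (b * q ^ (N + n))⁻¹ ^ (m + 1) := by
    rw [Finset.prod_pow_eq_pow_sum]
    congr 1
    have := sum_range_cast n
    rw [Finset.sum_range_succ'] at this
    exact_mod_cast this.symm
  rw [h1, h2, ← Finset.prod_mul_distrib, ← Finset.prod_mul_distrib, ← Finset.prod_mul_distrib]
  refine Finset.prod_congr rfl fun m hm => ?_
  have hm := Finset.mem_range.1 hm
  conv_lhs => rw [← Finset.card_range (m + 1), ← Finset.prod_const, Finset.card_range,
    ← Finset.prod_mul_distrib]
  conv_rhs => rw [← Finset.card_range (m + 1), ← Finset.prod_const, ← Finset.prod_const,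
    Finset.card_range, ← Finset.prod_mul_distrib, ← Finset.prod_mul_distrib]
  refine Finset.prod_congr rfl fun u hu => ?_
  obtain ⟨v, rfl⟩ : ∃ v, m = u + v := ⟨m - u, by have := Finset.mem_range.1 hu; omega⟩
  obtain ⟨M, hM⟩ : ∃ M, N + n = u + v + M := ⟨N + n - (u + v), by omega⟩
  rw [hμ, hM, Nat.add_sub_cancel_left, Nat.add_sub_cancel_left]
  field_simp
  ring

/-- The monomial left over when `columnBase` is written in terms of `b / e`. -/
def columnMonomial (q h : K) (N n s : ℕ) : K :=
  q ^ s / q ^ n * reflSign q N n * reflSign q N (2 * s) *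
    (reflSign q 0 (n - s) / reflSign q 0 s) / ((h * q ^ (n - s) / q ^ s) ^ s * h ^ (n - s))

/-- After reversal the factorials involving μ have argument built on h = b/e or Z = h q^(n-s)/q^s,
and Z q^s = h q^(n-s) glues them into (h)_(N+n), which is free of s. The product over s thus yields
the power (b/e)_(N+n)^(n+1). -/
theorem columnBase_eq {q b e μ : K} (hq0 : q ≠ 0) (hb : b ≠ 0) (he : e ≠ 0) {N n s : ℕ}
    (hs : s ≤ n) (hμ : μ = e / (b * q ^ (N + n))) (hbe : QGeneric q (b / e)) :
    qShifted q (b * q ^ (n - s) / (e * q ^ s)) N * columnBase q μ (N + n) n s =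
      qShifted q (b / e) (N + n) * qShifted q (q * q ^ N) n * columnMonomial q (b / e) N n s := by
  obtain ⟨j, rfl⟩ : ∃ j, n = j + s := ⟨n - s, by omega⟩
  obtain ⟨h, hh⟩ : ∃ h, h = b / e := ⟨_, rfl⟩
  have h0 : h ≠ 0 := hh ▸ div_ne_zero hb he
  have hμh : μ = 1 / (h * q ^ (N + (j + s))) := by rw [hμ, hh]; field_simp
  obtain ⟨Z, hZ⟩ : ∃ Z, Z = h * q ^ j / q ^ s := ⟨_, rfl⟩
  have hZ0 : Z ≠ 0 := by rw [hZ]; simp [*]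
  have e1 : b * q ^ j / (e * q ^ s) = Z := by rw [hZ, hh]; field_simp
  have r1 : qShifted q (q ^ (N + (j + s)))⁻¹ j =
      qShifted q (q * q ^ (N + s)) j * reflSign q (N + s) j / q ^ j :=
    qShifted_eq_reflect hq0 hq0 (by field_simp; ring)
  have r2 : qShifted q ((q ^ (N + (j + s)))⁻¹ * q ^ j) s =
      qShifted q (q * q ^ N) s * reflSign q N s / q ^ s :=
    qShifted_eq_reflect hq0 hq0 (by field_simp; ring)
  have r3 : qShifted q (μ * q) (2 * s) =
      qShifted q (Z * q ^ N) (2 * s) * reflSign q N (2 * s) / Z ^ (2 * s) :=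
    qShifted_eq_reflect hq0 hZ0 (by rw [hμh, hZ]; field_simp; ring)
  have r4 : qShifted q (μ * q * q ^ (N + (j + s)) / q ^ j) j =
      qShifted q (h * q ^ 0) j * reflSign q 0 j / h ^ j :=
    qShifted_eq_reflect hq0 h0 (by rw [hμh]; field_simp; ring)
  have r5 : qShifted q (μ * q / ((q ^ (N + (j + s)))⁻¹ * q ^ j)) s =
      qShifted q (Z * q ^ 0) s * reflSign q 0 s / Z ^ s :=
    qShifted_eq_reflect hq0 hZ0 (by rw [hμh, hZ]; field_simp; ring)
  have c1 : qShifted q Z s * qShifted q h (N + (j + s)) =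
      qShifted q Z N * qShifted q (Z * q ^ N) (2 * s) * qShifted q h j := by
    rw [show N + (j + s) = j + (N + s) by ring, qShifted_add, mul_left_comm,
      show h * q ^ j = Z * q ^ s by rw [hZ]; field_simp, ← qShifted_add, ← qShifted_add, mul_comm]
    congr 2
    ring
  have c2 : qShifted q (q * q ^ N) (j + s) =
      qShifted q (q * q ^ N) s * qShifted q (q * q ^ (N + s)) j := by
    rw [add_comm, qShifted_add, mul_assoc, ← pow_add]
  have c3 : reflSign q N (j + s) = reflSign q N s * reflSign q (N + s) j := by
    rw [reflSign, add_comm, Finset.prod_range_add]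
    simp only [reflSign, add_assoc]
  have n1 : qShifted q Z s ≠ 0 := by
    refine (hbe.mul_zpow hq0 ((j : ℤ) - s) ?_).qShifted_ne_zero s
    rw [zpow_sub₀ hq0, zpow_natCast, zpow_natCast, hZ, hh, mul_div_assoc]
  have n2 := reflSign_ne_zero hq0 0 s
  have hM : qShifted q h (N + (j + s)) =
      qShifted q Z N * qShifted q (Z * q ^ N) (2 * s) * qShifted q h j / qShifted q Z s := by
    rw [eq_div_iff n1, mul_comm, c1]
  rw [columnBase, columnMonomial, Nat.add_sub_cancel, ← hh, e1, r1, r2, r3, r4, r5, ← hZ, hM, c2, c3,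
    pow_zero, mul_one, mul_one, pow_mul', sq]
  generalize qShifted q (Z * q ^ N) (2 * s) = y1
  generalize qShifted q Z N = y2
  generalize qShifted q Z s = y3 at *
  generalize qShifted q (q * q ^ (N + s)) j = y4
  generalize qShifted q (q * q ^ N) s = y5
  generalize reflSign q N s = y6
  generalize reflSign q (N + s) j = y7
  generalize reflSign q N (2 * s) = y8
  generalize reflSign q 0 j = y9
  generalize reflSign q 0 s = y10 at *
  have p1 := pow_ne_zero s hZ0
  generalize Z ^ s = y11 at *
  rw [pow_add]
  field_simp

theorem prod_zpow_range {q : K} (hq : q ≠ 0) (F : ℕ → ℤ) (n : ℕ) :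
    ∏ s ∈ Finset.range n, q ^ F s = q ^ ∑ s ∈ Finset.range n, F s := by
  induction n with
  | zero => simp
  | succ n ih => rw [Finset.prod_range_succ, ih, Finset.sum_range_succ, zpow_add₀ hq]

/-- The exponent of q is made explicit, except for a quotient of two sign factors that disappears in
the product over s. -/
theorem columnMonomial_eq {q h : K} (hq : q ≠ 0) {N n s : ℕ} (hs : s ≤ n) :
    columnMonomial q h N n s = (-1) ^ n * h⁻¹ ^ n *
      q ^ (2 * (s : ℤ) - n - N * n - n.choose 2 - 2 * N * s - n * s) *
      (reflSign q 0 (n - s) / reflSign q 0 s) := by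
  obtain ⟨j, rfl⟩ : ∃ j, n = j + s := ⟨n - s, by omega⟩
  have hZ : (h * q ^ j / q ^ s) ^ s * h ^ j = h ^ (j + s) * q ^ (((j : ℤ) - s) * s) := by
    rw [zpow_mul, zpow_sub₀ hq, zpow_natCast, zpow_natCast, zpow_natCast, mul_div_assoc, mul_pow,
      pow_add]
    ring
  have h2 : q ^ s / q ^ (j + s) = q ^ (-(j : ℤ)) := by
    rw [zpow_neg, zpow_natCast, pow_add]; field_simp
  rw [columnMonomial, Nat.add_sub_cancel, hZ, reflSign_eq hq N (j + s), reflSign_eq hq N (2 * s), h2,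
    pow_mul (-1 : K) 2 s]
  have c := choose_two_cast (2 * s)
  have hexp : q ^ (2 * (s : ℤ) - (j + s : ℕ) - N * (j + s : ℕ) - (j + s).choose 2 - 2 * N * s -
      (j + s : ℕ) * s) = q ^ (-(j : ℤ)) * q ^ (-((N * (j + s) + (j + s).choose 2 : ℕ) : ℤ)) *
        q ^ (-((N * (2 * s) + (2 * s).choose 2 : ℕ) : ℤ)) * (q ^ (((j : ℤ) - s) * s))⁻¹ := by
    rw [← zpow_neg, ← zpow_add₀ hq, ← zpow_add₀ hq, ← zpow_add₀ hq]
    congr 1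
    push_cast at c ⊢
    linarith
  rw [hexp]
  simp only [div_eq_mul_inv, mul_inv, inv_pow]
  ring

/-- The monomial part of `columnFactor`. -/
theorem columnFactor_monomial {q h : K} (hq : q ≠ 0) {N n s : ℕ} (hs : s ≤ n) :
    (q ^ s) ^ N * reflSign q (N + (n - s)) s * reflSign q N s ^ 3 *
      (h⁻¹ ^ 2 * q ^ (3 * (s : ℤ) - 1 + N - n)) ^ s =
    h⁻¹ ^ (2 * s) * q ^ ((s : ℤ) * (2 * s + 1 - 2 * N - 2 * n)) := by
  obtain ⟨j, rfl⟩ : ∃ j, n = j + s := ⟨n - s, by omega⟩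
  have c := choose_two_cast s
  rw [Nat.add_sub_cancel, reflSign_eq hq, reflSign_eq hq, mul_pow, mul_pow, ← pow_mul, ← pow_mul,
    ← pow_mul, ← zpow_natCast q (s * N), ← zpow_natCast (q ^ (-(_ : ℤ))) 3, ← zpow_mul,
    ← zpow_natCast (q ^ (_ : ℤ)) s, ← zpow_mul]
  have hexp : q ^ ((s : ℤ) * (2 * s + 1 - 2 * N - 2 * (j + s : ℕ))) = q ^ ((s * N : ℕ) : ℤ) *
      q ^ (-(((N + j) * s + s.choose 2 : ℕ) : ℤ)) * q ^ (-((N * s + s.choose 2 : ℕ) : ℤ) * (3 : ℕ)) *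
      q ^ ((3 * (s : ℤ) - 1 + N - (j + s : ℕ)) * s) := by
    rw [← zpow_add₀ hq, ← zpow_add₀ hq, ← zpow_add₀ hq]
    congr 1
    push_cast
    linarith
  have hsign : (-1 : K) ^ s * (-1) ^ (s * 3) = 1 := by
    rw [← pow_add, show s + s * 3 = 2 * (2 * s) by ring, pow_mul]
    simp
  rw [hexp]
  linear_combination (q ^ ((s * N : ℕ) : ℤ) *
      q ^ (-(((N + j) * s + s.choose 2 : ℕ) : ℤ)) * q ^ (-((N * s + s.choose 2 : ℕ) : ℤ) * (3 : ℕ)) *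
      q ^ ((3 * (s : ℤ) - 1 + N - (j + s : ℕ)) * s) * h⁻¹ ^ (2 * s)) * hsign

/-- A comparison of exponents of q. The sum of s² over s is the source of the binomial coefficient
(r choose 3) in the theorem. -/
theorem monomial_identity {q h : K} (hq : q ≠ 0) (N n : ℕ) :
    (q ^ (N + n))⁻¹ ^ (n + 1).choose 2 * ∏ s ∈ Finset.range (n + 1),
      (h⁻¹ ^ (2 * s) * q ^ ((s : ℤ) * (2 * s + 1 - 2 * N - 2 * n))) =
    (∏ s ∈ Finset.range (n + 1), columnMonomial q h N n s) *
      (q ^ (n + 1).choose 3 * (q ^ (N + 1)) ^ (n + 1).choose 2) := by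
  -- The substitution s ↦ n - s exchanges numerator and denominator.
  have hR : ∏ s ∈ Finset.range (n + 1), (reflSign q 0 (n - s) / reflSign q 0 s) = 1 := by
    rw [Finset.prod_div_distrib]
    have := Finset.prod_range_reflect (fun s => reflSign q 0 s) (n + 1)
    simp only [Nat.add_sub_cancel] at this
    rw [this, div_self]
    exact Finset.prod_ne_zero_iff.2 fun s _ => reflSign_ne_zero hq 0 s
  rw [Finset.prod_congr rfl fun s hs => columnMonomial_eq hq (N := N)
    (Nat.lt_succ_iff.1 (Finset.mem_range.1 hs))]
  simp only [Finset.prod_mul_distrib]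
  rw [hR, prod_zpow_range hq, prod_zpow_range hq, Finset.prod_pow_eq_pow_sum, ← Finset.mul_sum,
    mul_comm 2 (∑ s ∈ Finset.range (n + 1), s), Finset.sum_range_id_mul_two, Finset.prod_const,
    Finset.prod_const, Finset.card_range, ← pow_mul, ← pow_mul, Nat.add_sub_cancel,
    (Nat.even_mul_succ_self n).neg_one_pow, mul_comm n (n + 1), inv_pow, ← pow_mul, ← pow_mul,
    ← zpow_natCast, ← zpow_natCast q (_ * _), ← zpow_natCast q ((n + 1).choose 3), ← zpow_neg]
  have hexp : ∀ u v w x y : ℤ, u + v = w + (x + y) →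
      q ^ u * (h⁻¹ ^ ((n + 1) * n) * q ^ v) = 1 * h⁻¹ ^ ((n + 1) * n) * q ^ w * 1 * (q ^ x * q ^ y) := by
    intro u v w x y huv
    rw [← zpow_add₀ hq, mul_one, mul_assoc _ (q ^ w), ← zpow_add₀ hq, ← huv, zpow_add₀ hq]
    ring
  refine hexp _ _ _ _ _ ?_
  have s1 : ∑ s ∈ Finset.range (n + 1), ((s : ℤ) * (2 * s + 1 - 2 * N - 2 * n)) =
      2 * ∑ s ∈ Finset.range (n + 1), (s : ℤ) ^ 2 +
        (1 - 2 * N - 2 * n) * ∑ s ∈ Finset.range (n + 1), (s : ℤ) := by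
    rw [Finset.mul_sum, Finset.mul_sum, ← Finset.sum_add_distrib]
    exact Finset.sum_congr rfl fun s _ => by ring
  have s2 : ∑ s ∈ Finset.range (n + 1), (2 * (s : ℤ) - n - N * n - n.choose 2 - 2 * N * s - n * s) =
      (2 - 2 * N - n) * ∑ s ∈ Finset.range (n + 1), (s : ℤ) -
        (n + 1) * (n + N * n + n.choose 2) := by
    rw [Finset.mul_sum]
    have : ((n : ℤ) + 1) * (n + N * n + n.choose 2) =
        ∑ s ∈ Finset.range (n + 1), ((n : ℤ) + N * n + n.choose 2) := by simp
    rw [this, ← Finset.sum_sub_distrib]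
    exact Finset.sum_congr rfl fun s _ => by ring
  rw [s1, s2, sum_range_sq_cast, sum_range_cast]
  have c3 := choose_three_cast n
  have c2 := choose_two_cast (n + 1)
  have c2' := choose_two_cast n
  push_cast at c2 ⊢
  linear_combination (-(N : ℤ) - n) * c2 + ((n : ℤ) + 1) * c2' + c3

/-- The factor of the `s`-th column, apart from monomials. -/
def columnQuotient (q a b c d e f g : K) (N n s : ℕ) : K :=
  qShifted q (a * q / (c * e * q ^ s)) (N + s) * qShifted q (a * q / (d * e * q ^ s)) (N + s) *
      qShifted q (a * q / (e * f * q ^ s)) (N + s) *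
      qShifted q (a * q / (e * g * q ^ s)) (N + s) /
    (qShifted q (a * q / (b * c * q ^ n)) s * qShifted q (a * q / (b * d * q ^ n)) s *
      qShifted q (a * q / (b * f * q ^ n)) s * qShifted q (a * q / (b * g * q ^ n)) s)

/-- The balancing condition removes a, c, d, f, g from the s-th powers and leaves only b/e and q. -/
theorem columnFactor_eq {q a b c d e f g : K} (hq0 : q ≠ 0)
    (ha : a ≠ 0) (hb : b ≠ 0) (hc : c ≠ 0) (hd : d ≠ 0) (he : e ≠ 0) (hf : f ≠ 0) (hg : g ≠ 0)
    {N n s : ℕ} (hs : s ≤ n) (hbal : a ^ 3 * q ^ (N + 2) = b * c * d * e * f * g * q ^ n) :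
    columnFactor q a b c d e f g N n s =
      (b / e)⁻¹ ^ (2 * s) * q ^ ((s : ℤ) * (2 * s + 1 - 2 * N - 2 * n)) *
        columnQuotient q a b c d e f g N n s / qShifted q (b * q ^ (n - s) / (e * q ^ s)) N := by
  have hP : (a * q / (b * e * q ^ s)) ^ s / ((a * q / (c * e * q ^ s)) ^ s *
      (a * q / (d * e * q ^ s)) ^ s * (a * q / (e * f * q ^ s)) ^ s *
      (a * q / (e * g * q ^ s)) ^ s) = ((b / e)⁻¹ ^ 2 * q ^ (3 * (s : ℤ) - 1 + N - n)) ^ s := by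
    rw [← mul_pow, ← mul_pow, ← mul_pow, ← div_pow]
    congr 1
    rw [zpow_sub₀ hq0, zpow_add₀ hq0, zpow_sub₀ hq0, zpow_one, zpow_natCast, zpow_natCast,
      show (3 * (s : ℤ)) = (3 * s : ℕ) by push_cast; rfl, zpow_natCast]
    field_simp
    linear_combination (-q ^ (3 * s)) * hbal
  rw [columnFactor, columnQuotient, hP, ← columnFactor_monomial hq0 hs]

theorem qShifted_pow_sub (q : K) {m s : ℕ} (hs : s ≤ m) :
    qShifted q (q ^ (m + 1 - s)) s = ∏ t ∈ Finset.range s, (1 - q ^ (m - t)) := by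
  rw [qShifted, ← Finset.prod_range_reflect]
  refine Finset.prod_congr rfl fun t ht => ?_
  have := Finset.mem_range.1 ht
  rw [← pow_add]
  congr 2
  omega

/-- Three independent parts: powers of q (`monomial_identity`), factors 1 - q^(N+n-t)
(`prod_pow_mul_prod_prod`), and the determinant constants (`det_ratio`). The factorials (b
q^(n-s)/(e q^s))_N divide both `columnBase` and `columnFactor`, and cancel. -/
theorem scalar_identity {q a b c d e f g μ : K} (hq0 : q ≠ 0)
    (ha : a ≠ 0) (hb : b ≠ 0) (hc : c ≠ 0) (hd : d ≠ 0) (he : e ≠ 0) (hf : f ≠ 0) (hg : g ≠ 0)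
    {N n : ℕ} (hμ : μ = e / (b * q ^ (N + n)))
    (hbal : a ^ 3 * q ^ (N + 2) = b * c * d * e * f * g * q ^ n) (hbe : QGeneric q (b / e)) :
    (∏ m ∈ Finset.range n, ∏ u ∈ Finset.range (m + 1),
      (μ * q ^ u + μ / (μ * q ^ u) -
        ((q ^ (N + n))⁻¹ * q ^ (m - u) + μ / ((q ^ (N + n))⁻¹ * q ^ (m - u))))) *
      (∏ s ∈ Finset.range (n + 1), columnFactor q a b c d e f g N n s) *
      ((∏ s ∈ Finset.range (n + 1), qShifted q (q ^ (N + n + 1 - s)) s *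
        qShifted q (a * q / (b * e * q ^ n)) s) * qShifted q (b / e) (N + n) ^ (n + 1)) =
    (∏ m ∈ Finset.range n, ∏ u ∈ Finset.range (m + 1),
      (e * q ^ u + a / (e * q ^ u) - (b * q ^ (m - u) + a / (b * q ^ (m - u))))) *
      (∏ s ∈ Finset.range (n + 1), columnBase q μ (N + n) n s) *
      (q ^ (n + 1).choose 3 * (q ^ (N + 1) / b) ^ (n + 1).choose 2 *
        ∏ s ∈ Finset.range (n + 1), columnQuotient q a b c d e f g N n s) := by
  have le : ∀ s ∈ Finset.range (n + 1), s ≤ n := fun s hs =>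
    Nat.lt_succ_iff.1 (Finset.mem_range.1 hs)
  have hZ : ∀ s, qShifted q (b * q ^ (n - s) / (e * q ^ s)) N ≠ 0 := fun s =>
    (hbe.mul_zpow hq0 (((n - s : ℕ) : ℤ) - s) (by
      rw [zpow_sub₀ hq0, zpow_natCast, zpow_natCast, div_mul_div_comm])).qShifted_ne_zero N
  have hCB : ∏ s ∈ Finset.range (n + 1), columnBase q μ (N + n) n s =
      (∏ s ∈ Finset.range (n + 1), qShifted q (b / e) (N + n) * qShifted q (q * q ^ N) n *
        columnMonomial q (b / e) N n s) /
      ∏ s ∈ Finset.range (n + 1), qShifted q (b * q ^ (n - s) / (e * q ^ s)) N := by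
    rw [← Finset.prod_div_distrib]
    refine Finset.prod_congr rfl fun s hs => ?_
    rw [eq_div_iff (hZ s), mul_comm, columnBase_eq hq0 hb he (le s hs) hμ hbe]
  rw [hCB, Finset.prod_congr rfl fun s hs => columnFactor_eq hq0 ha hb hc hd he hf hg (le s hs)
    hbal, Finset.prod_div_distrib]
  have hQ : ∀ s ∈ Finset.range (n + 1), qShifted q (q ^ (N + n + 1 - s)) s =
      ∏ t ∈ Finset.range s, (1 - q ^ (N + n - t)) := fun s hs =>
    qShifted_pow_sub q (by have := le s hs; omega)
  have hn : qShifted q (q * q ^ N) n = ∏ t ∈ Finset.range n, (1 - q ^ (N + n - t)) := by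
    rw [← qShifted_pow_sub q (by omega), show N + n + 1 - n = N + 1 by omega, pow_succ']
  rw [hn]
  simp only [Finset.prod_mul_distrib, Finset.prod_const, Finset.card_range]
  rw [Finset.prod_congr rfl hQ]
  have m1 := monomial_identity (h := b / e) hq0 N n
  have m2 := prod_pow_mul_prod_prod (fun t => 1 - q ^ (N + n - t)) n
  have m3 := det_ratio (a := a) hq0 hb he hμ
  rw [Finset.prod_mul_distrib] at m1
  rw [mul_inv, mul_pow] at m3
  rw [div_pow, div_eq_mul_inv ((q ^ (N + 1)) ^ _), ← inv_pow b]
  rw [← m2]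
  generalize (∏ s ∈ Finset.range (n + 1), (b / e)⁻¹ ^ (2 * s)) = y1 at *
  generalize (∏ s ∈ Finset.range (n + 1), q ^ ((s : ℤ) * (2 * s + 1 - 2 * N - 2 * n))) = y2 at *
  generalize (∏ s ∈ Finset.range (n + 1), columnMonomial q (b / e) N n s) = y3 at *
  generalize (∏ s ∈ Finset.range (n + 1), qShifted q (a * q / (b * e * q ^ n)) s) = y4 at *
  generalize (∏ s ∈ Finset.range (n + 1), qShifted q (b * q ^ (n - s) / (e * q ^ s)) N) = y5 at *
  generalize (∏ s ∈ Finset.range (n + 1), columnQuotient q a b c d e f g N n s) = y6 at *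
  generalize (∏ m ∈ Finset.range n, (1 - q ^ (N + n - m)) ^ (m + 1)) = y7 at *
  generalize (∏ s ∈ Finset.range (n + 1), ∏ t ∈ Finset.range s, (1 - q ^ (N + n - t))) = y8 at *
  generalize (∏ m ∈ Finset.range n, ∏ u ∈ Finset.range (m + 1),
      (μ * q ^ u + μ / (μ * q ^ u) -
        ((q ^ (N + n))⁻¹ * q ^ (m - u) + μ / ((q ^ (N + n))⁻¹ * q ^ (m - u))))) = y9 at *
  generalize (∏ m ∈ Finset.range n, ∏ u ∈ Finset.range (m + 1),
      (e * q ^ u + a / (e * q ^ u) - (b * q ^ (m - u) + a / (b * q ^ (m - u))))) = y10 at *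
  generalize qShifted q (b / e) (N + n) ^ (n + 1) = y11
  generalize (q ^ (N + n))⁻¹ ^ (n + 1).choose 2 = y12 at *
  generalize b⁻¹ ^ (n + 1).choose 2 = y13 at *
  generalize (q ^ (N + 1)) ^ (n + 1).choose 2 = y14 at *
  generalize q ^ (n + 1).choose 3 = y15 at *
  rw [div_eq_mul_inv, div_eq_mul_inv]
  generalize y5⁻¹ = y16
  linear_combination y1 * y2 * y6 * y16 * y8 * y11 * m3 + y10 * y13 * y7 * y6 * y16 * y8 * y11 * m1

end Prefactor

/-! ### The transformation for generic parameters. -/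

section Generic

variable {K : Type*} [Field K]

/-- Each difference factors as e q^u (1 - (b/e) q^(v-u)) (1 - a/(b e q^(u+v))), where m = u + v. -/
theorem prod_sub_ne_zero {q a b e : K} (hq0 : q ≠ 0) (hb : b ≠ 0) (he : e ≠ 0)
    (hbe : QGeneric q (b / e)) (habe : QGeneric q (a / (b * e))) (n : ℕ) :
    (∏ m ∈ Finset.range n, ∏ u ∈ Finset.range (m + 1),
      (e * q ^ u + a / (e * q ^ u) - (b * q ^ (m - u) + a / (b * q ^ (m - u))))) ≠ 0 := by
  refine Finset.prod_ne_zero_iff.2 fun m _ => Finset.prod_ne_zero_iff.2 fun u hu => ?_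
  obtain ⟨v, rfl⟩ : ∃ v, m = u + v := ⟨m - u, by have := Finset.mem_range.1 hu; omega⟩
  have h1 : 1 - b / e * q ^ ((v : ℤ) - u) ≠ 0 := hbe.one_sub_mul_ne_zero _
  have h2 : 1 - a / (b * e) * q ^ (-((u + v : ℕ) : ℤ)) ≠ 0 := habe.one_sub_mul_ne_zero _
  rw [zpow_sub₀ hq0, zpow_natCast, zpow_natCast] at h1
  rw [zpow_neg, zpow_natCast] at h2
  have : e * q ^ u + a / (e * q ^ u) - (b * q ^ v + a / (b * q ^ v)) =
      e * q ^ u * ((1 - b / e * (q ^ v / q ^ u)) * (1 - a / (b * e) * (q ^ (u + v))⁻¹)) := by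
    field_simp
    ring
  rw [Nat.add_sub_cancel_left, this]
  exact mul_ne_zero (mul_ne_zero he (pow_ne_zero _ hq0)) (mul_ne_zero h1 h2)

theorem qShifted_pow_ne_zero {q : K} (hq : ∀ n : ℕ, q ^ (n + 1) ≠ 1) (m k : ℕ) :
    qShifted q (q ^ (m + 1)) k ≠ 0 := by
  refine Finset.prod_ne_zero_iff.2 fun j _ => sub_ne_zero.2 ?_
  rw [← pow_add, show m + 1 + j = m + j + 1 by ring]
  exact (hq _).symm

theorem columnBase_ne_zero {q b e μ : K} (hq0 : q ≠ 0) (hq : ∀ n : ℕ, q ^ (n + 1) ≠ 1)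
    (hb : b ≠ 0) (he : e ≠ 0) {N n s : ℕ}
    (hs : s ≤ n) (hμ : μ = e / (b * q ^ (N + n))) (hbe : QGeneric q (b / e)) :
    columnBase q μ (N + n) n s ≠ 0 := by
  refine right_ne_zero_of_mul (a := qShifted q (b * q ^ (n - s) / (e * q ^ s)) N) ?_
  rw [columnBase_eq hq0 hb he hs hμ hbe, ← pow_succ']
  refine mul_ne_zero (mul_ne_zero (hbe.qShifted_ne_zero _) (qShifted_pow_ne_zero hq _ _)) ?_
  have := reflSign_ne_zero hq0
  simp [columnMonomial, *]

/-- `multiple_transformation` and `scalar_identity` have the left determinant constant and the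
product of the `columnBase` in common. Both are nonzero by genericity and are cancelled. -/
theorem generic_transformation {q a b c d e f g μ : K} {N n : ℕ} {x : Fin (n + 1) → K}
    (hq0 : q ≠ 0) (hq : ∀ n : ℕ, q ^ (n + 1) ≠ 1)
    (ha : a ≠ 0) (hb : b ≠ 0) (hc : c ≠ 0) (hd : d ≠ 0) (he : e ≠ 0) (hf : f ≠ 0) (hg : g ≠ 0)
    (hx : ∀ i, x i ≠ 0) (hμ : μ = e / (b * q ^ (N + n)))
    (hbal : a ^ 3 * q ^ (N + 2) = b * c * d * e * f * g * q ^ n)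
    (h : ∀ i, GenericParameters q a b c d e f g (x i)) :
    (∑ k ∈ cube (n + 1) N, (∏ i, ∏ j ∈ Finset.Ioi i,
      ((x i * q ^ k i - x j * q ^ k j) * (1 - a * (x i * q ^ k i) * (x j * q ^ k j)))) *
      ∏ i, vwpTerm q (a * x i ^ 2)
        [b * x i, e * x i, c * x i, d * x i, f * x i, g * x i, (q ^ N)⁻¹] (k i)) =
    q ^ (n + 1).choose 3 * (q ^ (N + 1) / b) ^ (n + 1).choose 2 *
      (1 / qShifted q (b / e) (N + n) ^ (n + 1)) *
      (∏ i, rowFactor q a b c d e f g (x i) N n) *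
      (∏ s ∈ Finset.range (n + 1), columnQuotient q a b c d e f g N n s /
        (qShifted q (q ^ (N + n + 1 - s)) s * qShifted q (a * q / (b * e * q ^ n)) s)) *
      ∑ k ∈ cube (n + 1) (N + n), (∏ i, ∏ j ∈ Finset.Ioi i,
      ((q ^ k i - q ^ k j) * (1 - μ * q ^ k i * q ^ k j))) *
      ∏ i, vwpTerm q μ [e * x i, e / (a * x i * q ^ N), a * q / (b * c * q ^ n),
        a * q / (b * d * q ^ n), a * q / (b * f * q ^ n), a * q / (b * g * q ^ n),
        (q ^ (N + n))⁻¹] (k i) := by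
  have hbe := (h 0).be
  have habe := (h 0).abe
  have T := multiple_transformation hq0 hq ha hb hc hd he hf hg hx hμ hbal h
  have S := scalar_identity hq0 ha hb hc hd he hf hg hμ hbal hbe
  have n1 := prod_sub_ne_zero hq0 hb he hbe habe n
  have n2 : ∏ s ∈ Finset.range (n + 1), columnBase q μ (N + n) n s ≠ 0 :=
    Finset.prod_ne_zero_iff.2 fun s hs => columnBase_ne_zero hq0 hq hb he
      (Nat.lt_succ_iff.1 (Finset.mem_range.1 hs)) hμ hbe
  have n3 : ∏ s ∈ Finset.range (n + 1), qShifted q (q ^ (N + n + 1 - s)) s *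
      qShifted q (a * q / (b * e * q ^ n)) s ≠ 0 := by
    refine Finset.prod_ne_zero_iff.2 fun s hs => mul_ne_zero ?_ ?_
    · have := Finset.mem_range.1 hs
      rw [show N + n + 1 - s = N + n - s + 1 by omega]
      exact qShifted_pow_ne_zero hq _ _
    · refine (habe.mul_zpow hq0 (1 - (n : ℤ)) ?_).qShifted_ne_zero s
      rw [zpow_sub₀ hq0, zpow_one, zpow_natCast, div_mul_div_comm]
  have n4 := pow_ne_zero (n + 1) (hbe.qShifted_ne_zero (N + n))
  rw [Finset.prod_div_distrib]
  generalize ∑ k ∈ cube (n + 1) N, (_ : K) = L at *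
  generalize ∑ k ∈ cube (n + 1) (N + n), (_ : K) = R at *
  generalize (∏ m ∈ Finset.range n, ∏ u ∈ Finset.range (m + 1),
      (μ * q ^ u + μ / (μ * q ^ u) -
        ((q ^ (N + n))⁻¹ * q ^ (m - u) + μ / ((q ^ (N + n))⁻¹ * q ^ (m - u))))) = y1 at *
  generalize (∏ m ∈ Finset.range n, ∏ u ∈ Finset.range (m + 1),
      (e * q ^ u + a / (e * q ^ u) - (b * q ^ (m - u) + a / (b * q ^ (m - u))))) = y2 at *
  generalize ∏ s ∈ Finset.range (n + 1), columnBase q μ (N + n) n s = y3 at *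
  generalize ∏ s ∈ Finset.range (n + 1), columnFactor q a b c d e f g N n s = y4 at *
  generalize ∏ s ∈ Finset.range (n + 1), columnQuotient q a b c d e f g N n s = y5 at *
  generalize ∏ s ∈ Finset.range (n + 1), qShifted q (q ^ (N + n + 1 - s)) s *
      qShifted q (a * q / (b * e * q ^ n)) s = y6 at *
  generalize qShifted q (b / e) (N + n) ^ (n + 1) = y7 at *
  generalize ∏ i, rowFactor q a b c d e f g (x i) N n = y8 at *
  generalize q ^ (n + 1).choose 3 * (q ^ (N + 1) / b) ^ (n + 1).choose 2 = y9 at *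
  rw [show y9 * (1 / y7) * y8 * (y5 / y6) * R = y9 * y8 * y5 * R / (y6 * y7) by
    field_simp, eq_div_iff (mul_ne_zero n3 n4)]
  refine mul_left_cancel₀ (mul_ne_zero n1 n2) ?_
  linear_combination y6 * y7 * T + R * y8 * S

/-- The left side of the transformation. -/
def leftSide (q : K) (r N : ℕ) (a b c d e f g : K) (x : Fin r → K) : K :=
  ∑ k ∈ cube r N,
      (∏ i, ∏ j ∈ Finset.Ioi i,
        ((x i * q ^ k i - x j * q ^ k j) * (1 - a * x i * x j * q ^ (k i + k j))) /
          ((x i - x j) * (1 - a * x i * x j))) *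
      (∏ i, (1 - a * x i ^ 2 * q ^ (2 * k i)) / (1 - a * x i ^ 2) * q ^ k i) *
      (∏ i,
        qShiftedProd q
          [a * x i ^ 2, b * x i, c * x i, d * x i, e * x i, f * x i, g * x i,
            q ^ (-(N : ℤ))] (k i) /
        qShiftedProd q
          [q, a * x i * q / b, a * x i * q / c, a * x i * q / d, a * x i * q / e,
            a * x i * q / f, a * x i * q / g, a * x i ^ 2 * q ^ (1 + N)] (k i))

/-- The summand of the right side of the transformation. -/
def rightSummand (q : K) (r N : ℕ) (a b c d e f g : K) (x : Fin r → K) (k : Fin r → ℕ) : K :=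
  (∏ i, ∏ j ∈ Finset.Ioi i,
          (q ^ k i - q ^ k j) *
            (1 - e * q ^ (1 - (r : ℤ) - (N : ℤ) + (k i : ℤ) + (k j : ℤ)) / b)) *
        (∏ i,
          ((1 - e * q ^ (1 - (r : ℤ) - (N : ℤ) + 2 * (k i : ℤ)) / b) *
            qShiftedProd q
              [e * q ^ (1 - (r : ℤ) - (N : ℤ)) / b, e * x i, e * q ^ (-(N : ℤ)) / (a * x i),
                q ^ (1 - (r : ℤ) - (N : ℤ))] (k i)) /
          ((1 - e * q ^ (1 - (r : ℤ) - (N : ℤ)) / b) *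
            qShiftedProd q
              [q, q ^ (2 - (r : ℤ) - (N : ℤ)) / (b * x i), a * x i * q ^ (2 - (r : ℤ)) / b,
                e * q / b] (k i))) *
        (∏ i,
          qShiftedProd q
            [a * q ^ (2 - (r : ℤ)) / (b * c), a * q ^ (2 - (r : ℤ)) / (b * d),
              a * q ^ (2 - (r : ℤ)) / (b * f), a * q ^ (2 - (r : ℤ)) / (b * g)] (k i) /
          qShiftedProd q
            [c * e * q ^ (-(N : ℤ)) / a, d * e * q ^ (-(N : ℤ)) / a,
              e * f * q ^ (-(N : ℤ)) / a, e * g * q ^ (-(N : ℤ)) / a] (k i) * q ^ k i)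

/-- The factor in front of the sum on the right side of the transformation. -/
def prefactor (q : K) (r N : ℕ) (a b c d e f g : K) (x : Fin r → K) : K :=
  q ^ r.choose 3 * (q ^ (N + 1) / b) ^ r.choose 2 *
      (1 / qShifted q (b / e) (N + r - 1) ^ r) *
      (∏ i, ∏ j ∈ Finset.Ioi i, 1 / ((x i - x j) * (1 - a * x i * x j))) *
      (∏ i : Fin r,
        ((e * x i) ^ N * qShifted q (a * x i ^ 2 * q) N * qShifted q (b * x i) (N + r - 1) *
          qShifted q (q ^ (2 - (r : ℤ)) * a * x i / b) (r - 1)) /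
        qShiftedProd q
          [q ^ ((N : ℤ) + r - (i : ℕ)),
            a * q ^ (2 - (r : ℤ)) / (b * e), a * q ^ (2 - (r : ℤ)) / (b * c),
            a * q ^ (2 - (r : ℤ)) / (b * d), a * q ^ (2 - (r : ℤ)) / (b * f),
            a * q ^ (2 - (r : ℤ)) / (b * g)] (i : ℕ)) *
      (∏ i : Fin r,
        qShiftedProd q
          [q ^ (1 - ((i : ℕ) : ℤ)) * a / (c * e), q ^ (1 - ((i : ℕ) : ℤ)) * a / (d * e),
            q ^ (1 - ((i : ℕ) : ℤ)) * a / (e * f), q ^ (1 - ((i : ℕ) : ℤ)) * a / (e * g)]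
          (N + (i : ℕ)) /
        qShiftedProd q
          [a * x i * q / c, a * x i * q / d, a * x i * q / e, a * x i * q / f,
            a * x i * q / g] N)

theorem leftSide_eq {q a b c d e f g : K} {n N : ℕ} {x : Fin (n + 1) → K}
    (hx : ∀ i, x i ≠ 0) :
    leftSide q (n + 1) N a b c d e f g x =
      (∏ i, ∏ j ∈ Finset.Ioi i, 1 / ((x i - x j) * (1 - a * x i * x j))) *
      ∑ k ∈ cube (n + 1) N, (∏ i, ∏ j ∈ Finset.Ioi i,
      ((x i * q ^ k i - x j * q ^ k j) * (1 - a * (x i * q ^ k i) * (x j * q ^ k j)))) *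
      ∏ i, vwpTerm q (a * x i ^ 2)
        [b * x i, e * x i, c * x i, d * x i, f * x i, g * x i, (q ^ N)⁻¹] (k i) := by
  rw [leftSide, Finset.mul_sum]
  refine Finset.sum_congr rfl fun k _ => ?_
  rw [mul_assoc, ← Finset.prod_mul_distrib]
  conv_rhs => rw [← mul_assoc, ← Finset.prod_mul_distrib]
  congr 1
  · refine Finset.prod_congr rfl fun i _ => ?_
    rw [← Finset.prod_mul_distrib]
    refine Finset.prod_congr rfl fun j _ => ?_
    rw [pow_add, div_eq_mul_inv, one_div]
    ring
  · refine Finset.prod_congr rfl fun i _ => ?_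
    have hi := hx i
    have e1 : ∀ c, a * x i ^ 2 * q / (c * x i) = a * x i * q / c := fun c => by
      rw [show a * x i ^ 2 * q = a * x i * q * x i by ring, mul_div_mul_right _ _ hi]
    simp only [vwpTerm, qShiftedProd, List.map_cons, List.map_nil, List.prod_cons, List.prod_nil,
      e1, zpow_neg, zpow_natCast, div_inv_eq_mul, div_eq_mul_inv _ (_ * _ : K), mul_inv, mul_one]
    rw [show a * x i ^ 2 * q * q ^ N = a * x i ^ 2 * q ^ (1 + N) by ring]
    simp only [div_eq_mul_inv]
    ring

theorem rightSummand_eq {q a b c d e f g μ : K} {n N : ℕ} {x : Fin (n + 1) → K} (hq0 : q ≠ 0)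
    (ha : a ≠ 0) (hb : b ≠ 0) (hc : c ≠ 0) (hd : d ≠ 0) (he : e ≠ 0) (hf : f ≠ 0) (hg : g ≠ 0)
    (hx : ∀ i, x i ≠ 0) (hμ : μ = e / (b * q ^ (N + n))) (k : Fin (n + 1) → ℕ) :
    rightSummand q (n + 1) N a b c d e f g x k =
      (∏ i, ∏ j ∈ Finset.Ioi i,
      ((q ^ k i - q ^ k j) * (1 - μ * q ^ k i * q ^ k j))) *
      ∏ i, vwpTerm q μ [e * x i, e / (a * x i * q ^ N), a * q / (b * c * q ^ n),
        a * q / (b * d * q ^ n), a * q / (b * f * q ^ n), a * q / (b * g * q ^ n),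
        (q ^ (N + n))⁻¹] (k i) := by
  have z1 : q ^ (1 - ((n + 1 : ℕ) : ℤ) - (N : ℤ)) = (q ^ (N + n))⁻¹ := by
    rw [← zpow_natCast, ← zpow_neg]
    congr 1
    push_cast
    ring
  have z2 : q ^ (2 - ((n + 1 : ℕ) : ℤ)) = q / q ^ n := by
    rw [show 2 - ((n + 1 : ℕ) : ℤ) = 1 - n by push_cast; ring, zpow_sub₀ hq0, zpow_one,
      zpow_natCast]
  have z3 : q ^ (2 - ((n + 1 : ℕ) : ℤ) - (N : ℤ)) = q / q ^ (N + n) := by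
    rw [show 2 - ((n + 1 : ℕ) : ℤ) - N = 1 - (N + n : ℕ) by push_cast; ring, zpow_sub₀ hq0,
      zpow_one, zpow_natCast]
  have z4 : ∀ k l : ℕ, q ^ (1 - ((n + 1 : ℕ) : ℤ) - (N : ℤ) + (k : ℤ) + (l : ℤ)) =
      (q ^ (N + n))⁻¹ * q ^ k * q ^ l := fun k l => by
    rw [zpow_add₀ hq0, zpow_add₀ hq0, z1, zpow_natCast, zpow_natCast]
  have z5 : ∀ k : ℕ, q ^ (1 - ((n + 1 : ℕ) : ℤ) - (N : ℤ) + 2 * (k : ℤ)) =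
      (q ^ (N + n))⁻¹ * q ^ (2 * k) := fun k => by
    rw [zpow_add₀ hq0, z1, ← zpow_natCast q (2 * k)]
    push_cast
    rfl
  have m1 : e * (q ^ (N + n))⁻¹ / b = μ := by rw [hμ]; field_simp
  rw [rightSummand, mul_assoc, ← Finset.prod_mul_distrib]
  congr 1
  · refine Finset.prod_congr rfl fun i _ => Finset.prod_congr rfl fun j _ => ?_
    rw [z4, ← m1]
    ring
  · refine Finset.prod_congr rfl fun i _ => ?_
    have hi := hx i
    have w1 : μ * q / (e * x i) = q / q ^ (N + n) / (b * x i) := by rw [hμ]; field_simp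
    have w2 : μ * q / (e / (a * x i * q ^ N)) = a * x i * (q / q ^ n) / b := by
      rw [hμ]; field_simp; ring
    have w3 : ∀ c, c ≠ 0 → μ * q / (a * q / (b * c * q ^ n)) = c * e / (q ^ N * a) := by
      intro c hc; rw [hμ]; field_simp; ring
    have w4 : μ * q / (q ^ (N + n))⁻¹ = e * q / b := by rw [hμ]; field_simp
    have w5 : e * (q ^ N)⁻¹ / (a * x i) = e / (a * x i * q ^ N) := by field_simp
    have w6 : ∀ c, a * (q / q ^ n) / (b * c) = a * q / (b * c * q ^ n) := fun c => by
      rw [← mul_div_assoc, div_div, mul_comm (q ^ n)]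
    have w7 : ∀ u, u * (q ^ N)⁻¹ / a = u / (q ^ N * a) := fun u => by
      rw [← div_eq_mul_inv, div_div]
    have w8 : e * ((q ^ (N + n))⁻¹ * q ^ (2 * k i)) / b = μ * q ^ (2 * k i) := by rw [← m1]; ring
    simp only [z5, z1, z2, z3, m1, zpow_neg, zpow_natCast, vwpTerm, qShiftedProd, List.map_cons,
      List.map_nil, List.prod_cons, List.prod_nil, w1, w2, w3 c hc, w3 d hd, w3 f hf, w3 g hg, w4,
      w5, w6, w7, w8]
    rw [mul_comm f e, mul_comm g e]
    simp only [div_eq_mul_inv (_ * _ : K) (qShifted _ _ _ * _), div_eq_mul_inv (_ * _ : K) ((1 - μ) * _), mul_inv,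
      div_eq_mul_inv (qShifted _ _ _), div_eq_mul_inv (1 - _ : K)]
    ring

theorem prefactor_eq {q a b c d e f g : K} {n N : ℕ} {x : Fin (n + 1) → K} (hq0 : q ≠ 0) :
    prefactor q (n + 1) N a b c d e f g x =
      (∏ i, ∏ j ∈ Finset.Ioi i, 1 / ((x i - x j) * (1 - a * x i * x j))) *
      (q ^ (n + 1).choose 3 * (q ^ (N + 1) / b) ^ (n + 1).choose 2 *
      (1 / qShifted q (b / e) (N + n) ^ (n + 1)) *
      (∏ i, rowFactor q a b c d e f g (x i) N n) *
      (∏ s ∈ Finset.range (n + 1), columnQuotient q a b c d e f g N n s /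
        (qShifted q (q ^ (N + n + 1 - s)) s * qShifted q (a * q / (b * e * q ^ n)) s))) := by
  have z2 : q ^ (2 - ((n + 1 : ℕ) : ℤ)) = q / q ^ n := by
    rw [show 2 - ((n + 1 : ℕ) : ℤ) = 1 - n by push_cast; ring, zpow_sub₀ hq0, zpow_one,
      zpow_natCast]
  rw [prefactor, mul_assoc, ← Finset.prod_mul_distrib, mul_right_comm, mul_comm]
  congr 1
  conv_rhs => rw [Finset.prod_range, mul_assoc, ← Finset.prod_mul_distrib]
  congr 1
  refine Finset.prod_congr rfl fun i _ => ?_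
  have z1 : q ^ ((N : ℤ) + (n + 1 : ℕ) - (i : ℕ)) = q ^ (N + n + 1 - i) := by
    rw [← zpow_natCast, Nat.cast_sub (by omega)]
    congr 1
  have z3 : ∀ u, q ^ (1 - ((i : ℕ) : ℤ)) * a / u = a * q / (u * q ^ (i : ℕ)) := fun u => by
    rw [zpow_sub₀ hq0, zpow_one, zpow_natCast]
    field_simp
  have w6 : ∀ c, a * (q / q ^ n) / (b * c) = a * q / (b * c * q ^ n) := fun c => by
      rw [← mul_div_assoc, div_div, mul_comm (q ^ n)]
  have w7 : q / q ^ n * a * x i / b = a * x i * q / (b * q ^ n) := by field_simp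
  simp only [rowFactor, columnQuotient, z1, z2, z3, w6, w7, qShiftedProd, List.map_cons,
    List.map_nil, List.prod_cons, List.prod_nil]
  simp only [Nat.add_sub_cancel, ← Nat.add_assoc]
  generalize qShifted q = Q
  simp only [div_eq_mul_inv (_ * _ : K) (Q _ _ * _), div_eq_mul_inv (_ * _ : K) (_ * Q _ _), mul_inv]
  ring

theorem transformation_of_generic {q a b c d e f g : K} {N n : ℕ} {x : Fin (n + 1) → K}
    (hq0 : q ≠ 0) (hq : ∀ n : ℕ, q ^ (n + 1) ≠ 1)
    (ha : a ≠ 0) (hb : b ≠ 0) (hc : c ≠ 0) (hd : d ≠ 0) (he : e ≠ 0) (hf : f ≠ 0) (hg : g ≠ 0)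
    (hx : ∀ i, x i ≠ 0)
    (hbal : a ^ 3 * q ^ (N + 2) = b * c * d * e * f * g * q ^ n)
    (h : ∀ i, GenericParameters q a b c d e f g (x i)) :
    leftSide q (n + 1) N a b c d e f g x =
      prefactor q (n + 1) N a b c d e f g x *
        ∑ k ∈ cube (n + 1) (N + n), rightSummand q (n + 1) N a b c d e f g x k := by
  rw [leftSide_eq hx, prefactor_eq hq0, Finset.sum_congr rfl fun k _ =>
    rightSummand_eq hq0 ha hb hc hd he hf hg hx rfl k,
    generic_transformation hq0 hq ha hb hc hd he hf hg hx rfl hbal h]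
  ring

end Generic

/-! ### Continuity of both sides in the parameters. -/

section Continuity

open Filter Topology

/-- The theorem assumes nonvanishing at the largest index only; factorials of smaller index divide
that one. -/
theorem qShifted_ne_zero_of_le {K : Type*} [Field K] {q u : K} {m k : ℕ} (h : qShifted q u m ≠ 0)
    (hk : k ≤ m) : qShifted q u k ≠ 0 := by
  obtain ⟨j, rfl⟩ := Nat.exists_eq_add_of_le hk
  rw [qShifted_add] at h
  exact left_ne_zero_of_mul h

@[fun_prop]
theorem ContinuousAt.qShifted {K X : Type*} [CommRing K] [TopologicalSpace K] [IsTopologicalRing K]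
    [TopologicalSpace X] {u : X → K} {t : X} (hu : ContinuousAt u t) (q : K) (k : ℕ) :
    ContinuousAt (fun s => _root_.qShifted q (u s) k) t := by
  unfold _root_.qShifted
  fun_prop

theorem ContinuousAt.finset_prod {K X ι : Type*} [CommMonoid K] [TopologicalSpace K]
    [ContinuousMul K] [TopologicalSpace X] {u : ι → X → K} {t : X} {s : Finset ι}
    (h : ∀ i ∈ s, ContinuousAt (u i) t) : ContinuousAt (fun y => ∏ i ∈ s, u i y) t :=
  tendsto_finsetProd s h

theorem ContinuousAt.finset_sum {K X ι : Type*} [AddCommMonoid K] [TopologicalSpace K]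
    [ContinuousAdd K] [TopologicalSpace X] {u : ι → X → K} {t : X} {s : Finset ι}
    (h : ∀ i ∈ s, ContinuousAt (u i) t) : ContinuousAt (fun y => ∑ i ∈ s, u i y) t :=
  tendsto_finsetSum s h

variable {q : ℂ} {r N : ℕ} {a b c d e f g : ℂ → ℂ} {x : Fin r → ℂ → ℂ} {t : ℂ}

/-- The parameters are functions of one variable t, so that a limit along a curve suffices; the
denominators need to be nonzero only at the limit point. -/
theorem continuousAt_leftSide
    (ca : ContinuousAt a t) (cb : ContinuousAt b t) (cc : ContinuousAt c t) (cd : ContinuousAt d t)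
    (ce : ContinuousAt e t) (cf : ContinuousAt f t) (cg : ContinuousAt g t)
    (cx : ∀ i, ContinuousAt (x i) t) (hb : b t ≠ 0) (hc : c t ≠ 0) (hd : d t ≠ 0) (he : e t ≠ 0)
    (hf : f t ≠ 0) (hg : g t ≠ 0) (hq : ∀ n : ℕ, q ^ (n + 1) ≠ 1)
    (hxinj : Function.Injective fun i => x i t) (hax : ∀ i j, 1 - a t * x i t * x j t ≠ 0)
    (hleft : ∀ i, qShiftedProd q
      [a t * x i t * q / b t, a t * x i t * q / c t, a t * x i t * q / d t, a t * x i t * q / e t,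
        a t * x i t * q / f t, a t * x i t * q / g t, a t * x i t ^ 2 * q ^ (1 + N)] N ≠ 0) :
    ContinuousAt (fun t => leftSide q r N (a t) (b t) (c t) (d t) (e t) (f t) (g t)
      fun i => x i t) t := by
  unfold leftSide
  refine ContinuousAt.finset_sum fun k hk => ?_
  have hk : ∀ i, k i ≤ N := by simpa [cube, Nat.lt_succ_iff] using hk
  refine ContinuousAt.mul (ContinuousAt.mul ?_ ?_) ?_
  · refine ContinuousAt.finset_prod fun i _ => ContinuousAt.finset_prod fun j hj => ?_
    have : x i t - x j t ≠ 0 := sub_ne_zero.2 (hxinj.ne (Finset.mem_Ioi.1 hj).ne)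
    exact ContinuousAt.div (by fun_prop) (by fun_prop) (mul_ne_zero this (hax i j))
  · refine ContinuousAt.finset_prod fun i _ => ?_
    have := hax i i
    rw [mul_assoc, ← sq] at this
    refine ContinuousAt.mul (ContinuousAt.div ?_ ?_ ?_) ?_
    exacts [by fun_prop, by fun_prop, this, by fun_prop]
  · refine ContinuousAt.finset_prod fun i _ => ?_
    have h := hleft i
    simp only [qShiftedProd, List.map_cons, List.map_nil, List.prod_cons, List.prod_nil, mul_one,
      mul_ne_zero_iff] at h ⊢
    refine ContinuousAt.div (by fun_prop) (by fun_prop (disch := assumption)) ?_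
    simp only [mul_ne_zero_iff]
    obtain ⟨h1, h2, h3, h4, h5, h6, h7⟩ := h
    have le := hk i
    exact ⟨QGeneric.qShifted_self_ne_zero hq _, qShifted_ne_zero_of_le h1 le,
      qShifted_ne_zero_of_le h2 le, qShifted_ne_zero_of_le h3 le, qShifted_ne_zero_of_le h4 le,
      qShifted_ne_zero_of_le h5 le, qShifted_ne_zero_of_le h6 le, qShifted_ne_zero_of_le h7 le⟩

theorem continuousAt_prefactor
    (ca : ContinuousAt a t) (cb : ContinuousAt b t) (cc : ContinuousAt c t) (cd : ContinuousAt d t)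
    (ce : ContinuousAt e t) (cf : ContinuousAt f t) (cg : ContinuousAt g t)
    (cx : ∀ i, ContinuousAt (x i) t) (hb : b t ≠ 0) (hc : c t ≠ 0) (hd : d t ≠ 0) (he : e t ≠ 0)
    (hf : f t ≠ 0) (hg : g t ≠ 0) (hq : ∀ n : ℕ, q ^ (n + 1) ≠ 1)
    (hxinj : Function.Injective fun i => x i t) (hax : ∀ i j, 1 - a t * x i t * x j t ≠ 0)
    (hleft : ∀ i, qShiftedProd q
      [a t * x i t * q / b t, a t * x i t * q / c t, a t * x i t * q / d t, a t * x i t * q / e t,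
        a t * x i t * q / f t, a t * x i t * q / g t, a t * x i t ^ 2 * q ^ (1 + N)] N ≠ 0)
    (hbe : qShifted q (b t / e t) (N + r - 1) ≠ 0)
    (hpre : qShiftedProd q
      [a t * q ^ (2 - (r : ℤ)) / (b t * e t), a t * q ^ (2 - (r : ℤ)) / (b t * c t),
        a t * q ^ (2 - (r : ℤ)) / (b t * d t), a t * q ^ (2 - (r : ℤ)) / (b t * f t),
        a t * q ^ (2 - (r : ℤ)) / (b t * g t)] (r - 1) ≠ 0) :
    ContinuousAt (fun t => prefactor q r N (a t) (b t) (c t) (d t) (e t) (f t) (g t)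
      fun i => x i t) t := by
  unfold prefactor
  have hbc := mul_ne_zero hb hc
  have hbd := mul_ne_zero hb hd
  have hbe' := mul_ne_zero hb he
  have hbf := mul_ne_zero hb hf
  have hbg := mul_ne_zero hb hg
  have hce := mul_ne_zero hc he
  have hde := mul_ne_zero hd he
  have hef := mul_ne_zero he hf
  have heg := mul_ne_zero he hg
  refine ContinuousAt.mul (ContinuousAt.mul (ContinuousAt.mul (ContinuousAt.mul ?_ ?_) ?_) ?_) ?_
  · fun_prop (disch := assumption)
  · exact ContinuousAt.div (by fun_prop) (by fun_prop (disch := assumption)) (pow_ne_zero _ hbe)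
  · refine ContinuousAt.finset_prod fun i _ => ContinuousAt.finset_prod fun j hj => ?_
    have : x i t - x j t ≠ 0 := sub_ne_zero.2 (hxinj.ne (Finset.mem_Ioi.1 hj).ne)
    exact ContinuousAt.div (by fun_prop) (by fun_prop) (mul_ne_zero this (hax i j))
  · refine ContinuousAt.finset_prod fun i _ => ?_
    have h := hpre
    simp only [qShiftedProd, List.map_cons, List.map_nil, List.prod_cons, List.prod_nil, mul_one,
      mul_ne_zero_iff] at h ⊢
    refine ContinuousAt.div (by fun_prop (disch := assumption))
      (by fun_prop (disch := assumption)) ?_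
    simp only [mul_ne_zero_iff]
    obtain ⟨h1, h2, h3, h4, h5⟩ := h
    have le : (i : ℕ) ≤ r - 1 := by omega
    refine ⟨?_, qShifted_ne_zero_of_le h1 le, qShifted_ne_zero_of_le h2 le,
      qShifted_ne_zero_of_le h3 le, qShifted_ne_zero_of_le h4 le, qShifted_ne_zero_of_le h5 le⟩
    -- The exponent is at least N + 1, hence positive, so no factor of this factorial is 1 - q^0.
    rw [show (N : ℤ) + r - (i : ℕ) = (N + (r - 1 - i) + 1 : ℕ) by omega, zpow_natCast]
    exact qShifted_pow_ne_zero hq _ _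
  · refine ContinuousAt.finset_prod fun i _ => ?_
    have h := hleft i
    simp only [qShiftedProd, List.map_cons, List.map_nil, List.prod_cons, List.prod_nil, mul_one,
      mul_ne_zero_iff] at h ⊢
    refine ContinuousAt.div (by fun_prop (disch := assumption))
      (by fun_prop (disch := assumption)) ?_
    simp only [mul_ne_zero_iff]
    obtain ⟨-, h2, h3, h4, h5, h6, -⟩ := h
    exact ⟨h2, h3, h4, h5, h6⟩

theorem continuousAt_rightSummand
    (ca : ContinuousAt a t) (cb : ContinuousAt b t) (cc : ContinuousAt c t) (cd : ContinuousAt d t)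
    (ce : ContinuousAt e t) (cf : ContinuousAt f t) (cg : ContinuousAt g t)
    (cx : ∀ i, ContinuousAt (x i) t) (ha : a t ≠ 0) (hb : b t ≠ 0) (hc : c t ≠ 0) (hd : d t ≠ 0)
    (hf : f t ≠ 0) (hg : g t ≠ 0) (hx : ∀ i, x i t ≠ 0)
    (hq : ∀ n : ℕ, q ^ (n + 1) ≠ 1)
    (heb : 1 - e t * q ^ (1 - (r : ℤ) - (N : ℤ)) / b t ≠ 0)
    (hright : ∀ i, qShiftedProd q
      [q ^ (2 - (r : ℤ) - (N : ℤ)) / (b t * x i t), a t * x i t * q ^ (2 - (r : ℤ)) / b t,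
        e t * q / b t, c t * e t * q ^ (-(N : ℤ)) / a t, d t * e t * q ^ (-(N : ℤ)) / a t,
        e t * f t * q ^ (-(N : ℤ)) / a t, e t * g t * q ^ (-(N : ℤ)) / a t] (N + r - 1) ≠ 0)
    {k : Fin r → ℕ} (hk : ∀ i, k i ≤ N + r - 1) :
    ContinuousAt (fun t => rightSummand q r N (a t) (b t) (c t) (d t) (e t) (f t) (g t)
      (fun i => x i t) k) t := by
  unfold rightSummand
  have hbc := mul_ne_zero hb hc
  have hbd := mul_ne_zero hb hd
  have hbf := mul_ne_zero hb hf
  have hbg := mul_ne_zero hb hg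
  have hbx := fun i => mul_ne_zero hb (hx i)
  have hax := fun i => mul_ne_zero ha (hx i)
  refine ContinuousAt.mul (ContinuousAt.mul ?_ ?_) ?_
  · fun_prop (disch := assumption)
  all_goals
    refine ContinuousAt.finset_prod fun i _ => ?_
    have h := hright i
    have hbx' := hbx i
    have hax' := hax i
    simp only [qShiftedProd, List.map_cons, List.map_nil, List.prod_cons, List.prod_nil, mul_one,
      mul_ne_zero_iff] at h ⊢
    obtain ⟨h1, h2, h3, h4, h5, h6, h7⟩ := h
    have le := hk i
  · refine ContinuousAt.div (by fun_prop (disch := assumption))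
      (by fun_prop (disch := assumption)) ?_
    simp only [mul_ne_zero_iff]
    exact ⟨heb, QGeneric.qShifted_self_ne_zero hq _, qShifted_ne_zero_of_le h1 le,
      qShifted_ne_zero_of_le h2 le, qShifted_ne_zero_of_le h3 le⟩
  · refine (ContinuousAt.div (by fun_prop (disch := assumption))
      (by fun_prop (disch := assumption)) ?_).mul (by fun_prop)
    simp only [mul_ne_zero_iff]
    exact ⟨qShifted_ne_zero_of_le h4 le, qShifted_ne_zero_of_le h5 le,
      qShifted_ne_zero_of_le h6 le, qShifted_ne_zero_of_le h7 le⟩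

end Continuity

/-! ### Perturbation to generic parameters. -/

section Perturbation

open Filter Topology

theorem eventually_ne_zero : ∀ᶠ t : ℂ in cocountable, t ≠ 0 := by
  rw [Filter.Eventually, mem_cocountable]
  exact (Set.countable_singleton (0 : ℂ)).mono fun t ht => by simpa using ht

/-- For each k the equation u q^k t^m = t^n has at most finitely many solutions t ≠ 0, because m ≠
n; the union over k is countable. -/
theorem eventually_qGeneric {q : ℂ} (u : ℂ) {m n : ℕ} (hmn : m ≠ n) :
    ∀ᶠ t in cocountable, QGeneric q (u * t ^ m / t ^ n) := by
  suffices h : ∀ k : ℤ, ∀ᶠ t in cocountable, u * t ^ m / t ^ n * q ^ k ≠ 1 by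
    rw [Filter.Eventually, mem_cocountable]
    simp only [QGeneric, Set.ofPred_forall, Set.compl_iInter]
    exact Set.countable_iUnion fun k => mem_cocountable.1 (h k)
  intro k
  obtain ⟨v, hv⟩ : ∃ v, v = u * q ^ k := ⟨_, rfl⟩
  -- A vanishing coefficient is harmless, since then the expression is 0 and never 1.
  rcases eq_or_ne v 0 with rfl | hv0
  · refine Eventually.of_forall fun t ht => ?_
    rw [mul_div_assoc, mul_right_comm, ← hv, zero_mul] at ht
    exact zero_ne_one ht
  have roots : ∀ (w : ℂ) (j : ℕ), 0 < j → ∀ᶠ t : ℂ in cocountable, t ^ j ≠ w := by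
    intro w j hj
    rw [Filter.Eventually, mem_cocountable]
    refine ((Polynomial.nthRoots j w).toFinset.countable_toSet).mono fun t ht => ?_
    simpa [Polynomial.mem_nthRoots hj] using ht
  rcases hmn.lt_or_gt with h | h
  · obtain ⟨j, rfl⟩ := Nat.exists_eq_add_of_lt h
    filter_upwards [eventually_ne_zero, roots v (j + 1) j.succ_pos] with t ht hroot h1
    refine hroot ?_
    rw [hv]
    rw [add_assoc, pow_add] at h1
    field_simp at h1
    exact h1.symm
  · obtain ⟨j, rfl⟩ := Nat.exists_eq_add_of_lt h
    filter_upwards [eventually_ne_zero, roots v⁻¹ (j + 1) j.succ_pos] with t ht hroot h1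
    refine hroot (eq_inv_of_mul_eq_one_left ?_)
    rw [hv, ← h1, add_assoc, pow_add]
    field_simp
    ring

/-- The weights 1, 2, 4, 8, 16, 32 of b, …, g add up to 63 = 3 · 21, so weight 21 for a preserves
balancing. No monomial of `GenericParameters` gets weight 0: the weight 100 of x outweighs the
others, 21 = 1 + 4 + 16 is not a sum of two of the six weights, and b/e has weight -7. -/
theorem eventually_genericParameters {q a b c d e f g x : ℂ} (hb : b ≠ 0) (hc : c ≠ 0)
    (hd : d ≠ 0) (he : e ≠ 0) (hf : f ≠ 0) (hg : g ≠ 0) (hx : x ≠ 0) :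
    ∀ᶠ t in cocountable, GenericParameters q (a * t ^ 21) (b * t) (c * t ^ 2) (d * t ^ 4)
      (e * t ^ 8) (f * t ^ 16) (g * t ^ 32) (x * t ^ 100) := by
  have key : ∀ (u : ℂ) (m n : ℕ) (F : ℂ → ℂ), m ≠ n →
      (∀ t, t ≠ 0 → F t = u * t ^ m / t ^ n) → ∀ᶠ t in cocountable, QGeneric q (F t) := by
    intro u m n F hmn hF
    filter_upwards [eventually_ne_zero, eventually_qGeneric u hmn] with t ht h
    rwa [hF t ht]
  filter_upwards [
    key (a * x ^ 2) 221 0 (fun t => a * t ^ 21 * (x * t ^ 100) ^ 2) (by norm_num)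
      fun t _ => by ring,
    key (a / (b * c * d * x)) 21 107
      (fun t => a * t ^ 21 / (b * t * (c * t ^ 2) * (d * t ^ 4) * (x * t ^ 100))) (by norm_num)
      fun t _ => by field_simp,
    key (a ^ 2 * x / (b * c * d)) 142 7
      (fun t => (a * t ^ 21) ^ 2 * (x * t ^ 100) / (b * t * (c * t ^ 2) * (d * t ^ 4)))
      (by norm_num) fun t _ => by field_simp,
    key (a / (b * f * g * x)) 21 149
      (fun t => a * t ^ 21 / (b * t * (f * t ^ 16) * (g * t ^ 32) * (x * t ^ 100))) (by norm_num)
      fun t _ => by field_simp,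
    key (a / (c * d)) 21 6 (fun t => a * t ^ 21 / (c * t ^ 2 * (d * t ^ 4))) (by norm_num)
      fun t _ => by field_simp,
    key (a / (f * g)) 21 48 (fun t => a * t ^ 21 / (f * t ^ 16 * (g * t ^ 32))) (by norm_num)
      fun t _ => by field_simp,
    key (b * x) 101 0 (fun t => b * t * (x * t ^ 100)) (by norm_num) fun t _ => by ring,
    key (c * x) 102 0 (fun t => c * t ^ 2 * (x * t ^ 100)) (by norm_num) fun t _ => by ring,
    key (d * x) 104 0 (fun t => d * t ^ 4 * (x * t ^ 100)) (by norm_num) fun t _ => by ring,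
    key (e * x) 108 0 (fun t => e * t ^ 8 * (x * t ^ 100)) (by norm_num) fun t _ => by ring,
    key (f * x) 116 0 (fun t => f * t ^ 16 * (x * t ^ 100)) (by norm_num) fun t _ => by ring,
    key (g * x) 132 0 (fun t => g * t ^ 32 * (x * t ^ 100)) (by norm_num) fun t _ => by ring,
    key (a * x / b) 121 1 (fun t => a * t ^ 21 * (x * t ^ 100) / (b * t)) (by norm_num)
      fun t _ => by field_simp,
    key (a * x / c) 121 2 (fun t => a * t ^ 21 * (x * t ^ 100) / (c * t ^ 2)) (by norm_num)
      fun t _ => by field_simp,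
    key (a * x / d) 121 4 (fun t => a * t ^ 21 * (x * t ^ 100) / (d * t ^ 4)) (by norm_num)
      fun t _ => by field_simp,
    key (a * x / e) 121 8 (fun t => a * t ^ 21 * (x * t ^ 100) / (e * t ^ 8)) (by norm_num)
      fun t _ => by field_simp,
    key (a * x / f) 121 16 (fun t => a * t ^ 21 * (x * t ^ 100) / (f * t ^ 16)) (by norm_num)
      fun t _ => by field_simp,
    key (a * x / g) 121 32 (fun t => a * t ^ 21 * (x * t ^ 100) / (g * t ^ 32)) (by norm_num)
      fun t _ => by field_simp,
    key (b / e) 1 8 (fun t => b * t / (e * t ^ 8)) (by norm_num) fun t _ => by field_simp,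
    key (a / (b * e)) 21 9 (fun t => a * t ^ 21 / (b * t * (e * t ^ 8))) (by norm_num)
      fun t _ => by field_simp,
    key (a / (c * e)) 21 10 (fun t => a * t ^ 21 / (c * t ^ 2 * (e * t ^ 8))) (by norm_num)
      fun t _ => by field_simp,
    key (a / (d * e)) 21 12 (fun t => a * t ^ 21 / (d * t ^ 4 * (e * t ^ 8))) (by norm_num)
      fun t _ => by field_simp,
    key (a / (e * f)) 21 24 (fun t => a * t ^ 21 / (e * t ^ 8 * (f * t ^ 16))) (by norm_num)
      fun t _ => by field_simp,
    key (a / (e * g)) 21 40 (fun t => a * t ^ 21 / (e * t ^ 8 * (g * t ^ 32))) (by norm_num)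
      fun t _ => by field_simp,
    key (a / (b * c)) 21 3 (fun t => a * t ^ 21 / (b * t * (c * t ^ 2))) (by norm_num)
      fun t _ => by field_simp,
    key (a / (b * d)) 21 5 (fun t => a * t ^ 21 / (b * t * (d * t ^ 4))) (by norm_num)
      fun t _ => by field_simp,
    key (a / (b * f)) 21 17 (fun t => a * t ^ 21 / (b * t * (f * t ^ 16))) (by norm_num)
      fun t _ => by field_simp,
    key (a / (b * g)) 21 33 (fun t => a * t ^ 21 / (b * t * (g * t ^ 32))) (by norm_num)
      fun t _ => by field_simp]
    with t h1 h2 h3 h4 h5 h6 h7 h8 h9 h10 h11 h12 h13 h14 h15 h16 h17 h18 h19 h20 h21 h22 h23 h24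
      h25 h26 h27 h28
  exact ⟨h1, h2, h3, h4, h5, h6, h7, h8, h9, h10, h11, h12, h13, h14, h15, h16, h17, h18, h19, h20,
    h21, h22, h23, h24, h25, h26, h27, h28⟩

/-- The complement of a countable set is dense in ℂ. -/
theorem frequently_nhds_of_eventually_cocountable {p : ℂ → Prop} (h : ∀ᶠ t in cocountable, p t)
    (t : ℂ) : ∃ᶠ s in 𝓝 t, p s := by
  have := (mem_cocountable.1 h).dense_compl ℂ
  rw [compl_compl] at this
  exact mem_closure_iff_frequently.1 (this t)

end Perturbation

/-! ### The transformation for all admissible parameters. -/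

theorem corollary5p3 (r N : ℕ) (hr : 1 ≤ r)
    (q : ℂ) (hq0 : 0 < ‖q‖) (hq1 : ‖q‖ < 1)
    (a b c d e f g : ℂ) (x : Fin r → ℂ)
    (hbal : a ^ 3 * q ^ (3 - (r : ℤ) + (N : ℤ)) = b * c * d * e * f * g)
    -- no denominator vanishes
    (ha : a ≠ 0) (hx : ∀ i, x i ≠ 0) (hxinj : Function.Injective x)
    (hax : ∀ i j, 1 - a * x i * x j ≠ 0)
    (hleft : ∀ i, qShiftedProd q
      [a * x i * q / b, a * x i * q / c, a * x i * q / d, a * x i * q / e,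
        a * x i * q / f, a * x i * q / g, a * x i ^ 2 * q ^ (1 + N)] N ≠ 0)
    (hbe : qShifted q (b / e) (N + r - 1) ≠ 0)
    (hpre : qShiftedProd q
      [a * q ^ (2 - (r : ℤ)) / (b * e), a * q ^ (2 - (r : ℤ)) / (b * c),
        a * q ^ (2 - (r : ℤ)) / (b * d), a * q ^ (2 - (r : ℤ)) / (b * f),
        a * q ^ (2 - (r : ℤ)) / (b * g)] (r - 1) ≠ 0)
    (heb : 1 - e * q ^ (1 - (r : ℤ) - (N : ℤ)) / b ≠ 0)
    (hright : ∀ i, qShiftedProd q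
      [q ^ (2 - (r : ℤ) - (N : ℤ)) / (b * x i), a * x i * q ^ (2 - (r : ℤ)) / b, e * q / b,
        c * e * q ^ (-(N : ℤ)) / a, d * e * q ^ (-(N : ℤ)) / a,
        e * f * q ^ (-(N : ℤ)) / a, e * g * q ^ (-(N : ℤ)) / a] (N + r - 1) ≠ 0) :
    ∑ k ∈ cube r N,
      (∏ i, ∏ j ∈ Finset.Ioi i,
        ((x i * q ^ k i - x j * q ^ k j) * (1 - a * x i * x j * q ^ (k i + k j))) /
          ((x i - x j) * (1 - a * x i * x j))) *
      (∏ i, (1 - a * x i ^ 2 * q ^ (2 * k i)) / (1 - a * x i ^ 2) * q ^ k i) *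
      (∏ i,
        qShiftedProd q
          [a * x i ^ 2, b * x i, c * x i, d * x i, e * x i, f * x i, g * x i,
            q ^ (-(N : ℤ))] (k i) /
        qShiftedProd q
          [q, a * x i * q / b, a * x i * q / c, a * x i * q / d, a * x i * q / e,
            a * x i * q / f, a * x i * q / g, a * x i ^ 2 * q ^ (1 + N)] (k i))
    =
    q ^ r.choose 3 * (q ^ (N + 1) / b) ^ r.choose 2 *
      (1 / qShifted q (b / e) (N + r - 1) ^ r) *
      (∏ i, ∏ j ∈ Finset.Ioi i, 1 / ((x i - x j) * (1 - a * x i * x j))) *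
      (∏ i : Fin r,
        ((e * x i) ^ N * qShifted q (a * x i ^ 2 * q) N * qShifted q (b * x i) (N + r - 1) *
          qShifted q (q ^ (2 - (r : ℤ)) * a * x i / b) (r - 1)) /
        qShiftedProd q
          [q ^ ((N : ℤ) + r - (i : ℕ)),
            a * q ^ (2 - (r : ℤ)) / (b * e), a * q ^ (2 - (r : ℤ)) / (b * c),
            a * q ^ (2 - (r : ℤ)) / (b * d), a * q ^ (2 - (r : ℤ)) / (b * f),
            a * q ^ (2 - (r : ℤ)) / (b * g)] (i : ℕ)) *
      (∏ i : Fin r,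
        qShiftedProd q
          [q ^ (1 - ((i : ℕ) : ℤ)) * a / (c * e), q ^ (1 - ((i : ℕ) : ℤ)) * a / (d * e),
            q ^ (1 - ((i : ℕ) : ℤ)) * a / (e * f), q ^ (1 - ((i : ℕ) : ℤ)) * a / (e * g)]
          (N + (i : ℕ)) /
        qShiftedProd q
          [a * x i * q / c, a * x i * q / d, a * x i * q / e, a * x i * q / f,
            a * x i * q / g] N) *
      ∑ k ∈ cube r (N + r - 1),
        (∏ i, ∏ j ∈ Finset.Ioi i,
          (q ^ k i - q ^ k j) *
            (1 - e * q ^ (1 - (r : ℤ) - (N : ℤ) + (k i : ℤ) + (k j : ℤ)) / b)) *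
        (∏ i,
          ((1 - e * q ^ (1 - (r : ℤ) - (N : ℤ) + 2 * (k i : ℤ)) / b) *
            qShiftedProd q
              [e * q ^ (1 - (r : ℤ) - (N : ℤ)) / b, e * x i, e * q ^ (-(N : ℤ)) / (a * x i),
                q ^ (1 - (r : ℤ) - (N : ℤ))] (k i)) /
          ((1 - e * q ^ (1 - (r : ℤ) - (N : ℤ)) / b) *
            qShiftedProd q
              [q, q ^ (2 - (r : ℤ) - (N : ℤ)) / (b * x i), a * x i * q ^ (2 - (r : ℤ)) / b,
                e * q / b] (k i))) *
        (∏ i,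
          qShiftedProd q
            [a * q ^ (2 - (r : ℤ)) / (b * c), a * q ^ (2 - (r : ℤ)) / (b * d),
              a * q ^ (2 - (r : ℤ)) / (b * f), a * q ^ (2 - (r : ℤ)) / (b * g)] (k i) /
          qShiftedProd q
            [c * e * q ^ (-(N : ℤ)) / a, d * e * q ^ (-(N : ℤ)) / a,
              e * f * q ^ (-(N : ℤ)) / a, e * g * q ^ (-(N : ℤ)) / a] (k i) * q ^ k i) := by
  have hq : q ≠ 0 := norm_pos_iff.1 hq0
  have hq' : ∀ n : ℕ, q ^ (n + 1) ≠ 1 := fun n h => by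
    have := congrArg norm h
    rw [norm_pow, norm_one] at this
    exact (pow_lt_one₀ hq0.le hq1 n.succ_ne_zero).ne this
  obtain ⟨n, rfl⟩ : ∃ n, r = n + 1 := ⟨r - 1, by omega⟩
  have hbal' : a ^ 3 * q ^ (N + 2) = b * c * d * e * f * g * q ^ n := by
    rw [← hbal, mul_assoc, ← zpow_natCast q, ← zpow_natCast q, ← zpow_add₀ hq]
    congr 2
    push_cast
    ring
  have hne : b * c * d * e * f * g ≠ 0 := by
    rw [← hbal]
    exact mul_ne_zero (pow_ne_zero _ ha) (zpow_ne_zero _ hq)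
  simp only [mul_ne_zero_iff] at hne
  obtain ⟨⟨⟨⟨⟨hb, hc⟩, hd⟩, he⟩, hf⟩, hg⟩ := hne
  -- The given parameters are the point t = 1 of the curve, and generic values of t accumulate
  -- there.
  have generic : ∃ᶠ t : ℂ in nhds 1, t ≠ 0 ∧ ∀ i, GenericParameters q (a * t ^ 21) (b * t) (c * t ^ 2)
      (d * t ^ 4) (e * t ^ 8) (f * t ^ 16) (g * t ^ 32) (x i * t ^ 100) :=
    frequently_nhds_of_eventually_cocountable (eventually_ne_zero.and (Filter.eventually_all.2 fun i =>
      eventually_genericParameters hb hc hd he hf hg (hx i))) 1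
  have hL : ContinuousAt (fun t : ℂ => leftSide q (n + 1) N (a * t ^ 21) (b * t) (c * t ^ 2)
      (d * t ^ 4) (e * t ^ 8) (f * t ^ 16) (g * t ^ 32) fun i => x i * t ^ 100) 1 := by
    refine continuousAt_leftSide (by fun_prop) (by fun_prop) (by fun_prop) (by fun_prop)
      (by fun_prop) (by fun_prop) (by fun_prop) (fun i => by fun_prop) ?_ ?_ ?_ ?_ ?_ ?_ hq' ?_ ?_ ?_
    all_goals simpa only [one_pow, mul_one]
  have hR : ContinuousAt (fun t : ℂ => prefactor q (n + 1) N (a * t ^ 21) (b * t) (c * t ^ 2)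
      (d * t ^ 4) (e * t ^ 8) (f * t ^ 16) (g * t ^ 32) (fun i => x i * t ^ 100) *
      ∑ k ∈ cube (n + 1) (N + n), rightSummand q (n + 1) N (a * t ^ 21) (b * t) (c * t ^ 2)
      (d * t ^ 4) (e * t ^ 8) (f * t ^ 16) (g * t ^ 32) (fun i => x i * t ^ 100) k) 1 := by
    refine ContinuousAt.mul ?_ (ContinuousAt.finset_sum fun k hk => ?_)
    · refine continuousAt_prefactor (by fun_prop) (by fun_prop) (by fun_prop) (by fun_prop)
        (by fun_prop) (by fun_prop) (by fun_prop) (fun i => by fun_prop) ?_ ?_ ?_ ?_ ?_ ?_ hq'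
        ?_ ?_ ?_ ?_ ?_
      all_goals simpa only [one_pow, mul_one]
    · have hk : ∀ i, k i ≤ N + (n + 1) - 1 := by simpa [cube, Nat.lt_succ_iff] using hk
      refine continuousAt_rightSummand (by fun_prop) (by fun_prop) (by fun_prop) (by fun_prop)
        (by fun_prop) (by fun_prop) (by fun_prop) (fun i => by fun_prop) ?_ ?_ ?_ ?_ ?_ ?_ ?_ hq'
        ?_ ?_ hk
      all_goals simpa only [one_pow, mul_one]
  -- Two functions continuous at 1 that agree at points accumulating there agree at 1.
  have key := tendsto_nhds_unique_of_frequently_eq hL hR (generic.mono fun t ht => by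
    have h0 := ht.1
    refine transformation_of_generic hq hq' ?_ ?_ ?_ ?_ ?_ ?_ ?_ ?_ ?_ ht.2
    -- Along the curve both sides of the balancing condition are multiplied by t^63.
    case refine_9 => linear_combination t ^ 63 * hbal'
    all_goals simp [*])
  simp only [one_pow, mul_one] at key
  exact key
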